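/- For $a\ge 0$ and $b>0$ let $\mathrm{SGa}(a,b)$ be the distribution on $\mathbb R$ with Fourier transform $t\mapsto(1+t^2/b^2)^{-a}$ (so $\mathrm{SGa}(0,b)=\delta_0$), and let $\mathrm{Ga}(a,b)$ be the Gamma distribution with shape $a$ and rate $b$. Let $\mathcal X$ be a Polish space with its Borel $\sigma$-algebra, $F$ a probability measure on $\mathcal X$, and $\alpha,\eta>0$. A Pólya urn sequence with base distribution $\alpha F$ is a sequence of $\mathcal X$-valued random variables $X_1,\dots,X_p$ such that for every measurable $A$, almost surely, $$P(X_1\in A)=F(A),\qquad P(X_{k+1}\in A\mid X_1,\dots,X_k)=\frac{F_k(A)}{F_k(\mathcal X)},\quad 1\le k\le p-1,\qquad F_k:=\alpha F+\sum_{i=1}^k\delta_{X_i}.$$ A symmetric Gamma random measure with base distribution $\alpha F$ and scale parameter $b>0$ is a random finite signed measure $Q$ on $\mathcal X$ such that $Q(A)$ has distribution $\mathrm{SGa}(\alpha F(A),b)$ for every measurable $A$, and $Q(A_1),\dots,Q(A_k)$ are independent whenever $A_1,\dots,A_k$ are measurable and pairwise disjoint. Let $\mathcal M(\mathcal X)$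 be the space of (finite) signed Radon measures on $\mathcal X$, with the vague topology, i.e. the coarsest topology for which $\mu\mapsto\int f\,d\mu$ is continuous for every continuous $f:\mathcal X\to\mathbb R$ with compact support, and with the corresponding Borel $\sigma$-algebra. **Theorem.** For every $p$, let $T\sim\mathrm{Ga}(\alpha,\eta)$, let $J_1,\dots,J_p$ be i.i.d. with distribution $\mathrm{SGa}(1,1)$ and independent of $T$, and let $X_1,\dots,X_p$ be a Pólya urn sequence with base distribution $\alpha F$, independent of $(T,J_1,\dots,J_p)$ (the probability space may depend on $p$). Put $$Q_p:=\sqrt{T/p}\,\sum_{i=1}^p J_i\,\delta_{X_i}.$$ Then, as $p\to\infty$, $Q_p$ converges in distribution, as a random element of $\mathcal M(\mathcal X)$, to a symmetric Gamma random measure with base distribution $\alpha F$ and scale parameter $\sqrt\eta$. That is, such a random measure $Q$ exists, and for every such $Q$, $Q_p$ and $Q$ are measurable random elements of $\mathcal M(\mathcal X)$ (up to null sets) and $\mathbb E\,\Phi(Q_p)\to\mathbb E\,\Phi(Q)$ for every bounded function $\Phi:\mathcal M(\mathcal X)\to\mathbb R$ that is continuous for the vague topology. -/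

import Mathlib

open MeasureTheory ProbabilityTheory Filter
open scoped CompactlySupported

universe u v w

noncomputable section

/-! ### The space of signed Radon measures with the vague topology

On a Polish space every finite signed Borel measure is Radon (see
`signedMeasure_innerRegular_of_polish`), so the space of signed Radon measures on `𝓧` is
`SignedMeasure 𝓧`. -/

/-- On a Polish space, the total variation of any signed Borel measure is inner regular with
respect to compact sets, that is, every signed Borel measure is Radon. -/
theorem signedMeasure_innerRegular_of_polish {𝓧 : Type u} [TopologicalSpace 𝓧] [PolishSpace 𝓧]
    [MeasurableSpace 𝓧] [BorelSpace 𝓧] (μ : SignedMeasure 𝓧) :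
    μ.totalVariation.InnerRegularWRT (fun s => IsCompact s ∧ IsClosed s) MeasurableSet :=
  innerRegular_isCompact_isClosed_measurableSet_of_finite μ.totalVariation

/-- The vague topology on signed measures: the coarsest topology for which `μ ↦ ∫ f dμ` is
continuous for every continuous `f : 𝓧 → ℝ` with compact support. -/
instance vagueTopology {𝓧 : Type u} [TopologicalSpace 𝓧] [MeasurableSpace 𝓧] :
    TopologicalSpace (SignedMeasure 𝓧) :=
  ⨅ f : C_c(𝓧, ℝ), TopologicalSpace.induced
    (fun μ : SignedMeasure 𝓧 => VectorMeasure.integral μ (fun x => f x)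
      (ContinuousLinearMap.lsmul ℝ ℝ)) inferInstance

/-- Signed measures carry the Borel σ-algebra of the vague topology. -/
instance vagueMeasurableSpace {𝓧 : Type u} [TopologicalSpace 𝓧] [MeasurableSpace 𝓧] :
    MeasurableSpace (SignedMeasure 𝓧) :=
  borel (SignedMeasure 𝓧)

instance vagueBorelSpace {𝓧 : Type u} [TopologicalSpace 𝓧] [MeasurableSpace 𝓧] :
    BorelSpace (SignedMeasure 𝓧) :=
  ⟨rfl⟩

/-! ### Symmetric Gamma distributions and random measures -/

/-- The real random variable `Z` has the symmetric Gamma distribution `SGa(a, b)`, the distribution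
with Fourier transform `t ↦ (1 + t² / b²) ^ (-a)`; for `a = 0` this is the point mass at `0`. -/
structure HasSymmetricGammaLaw {Ω : Type v} [MeasurableSpace Ω] (Z : Ω → ℝ) (a b : ℝ)
    (P : Measure Ω) : Prop where
  aemeasurable : AEMeasurable Z P
  charFun_eq : ∀ t : ℝ, charFun (P.map Z) t = (((1 + t ^ 2 / b ^ 2) ^ (-a) : ℝ) : ℂ)

/-- `Q` is a symmetric Gamma random measure with base distribution `α F` and scale parameter `b`:
a random signed measure whose values on disjoint sets are independent and whose value on `A` has
distribution `SGa(α F(A), b)`. -/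
structure IsSymmetricGammaRandomMeasure {𝓧 : Type u} [MeasurableSpace 𝓧] {Ω : Type v}
    [MeasurableSpace Ω] (Q : Ω → SignedMeasure 𝓧) (α : ℝ) (F : Measure 𝓧) (b : ℝ)
    (P : Measure Ω) : Prop where
  measurable_apply : ∀ A : Set 𝓧, MeasurableSet A → Measurable (fun ω => Q ω A)
  hasLaw_apply : ∀ A : Set 𝓧, MeasurableSet A →
    HasSymmetricGammaLaw (fun ω => Q ω A) (α * F.real A) b P
  iIndepFun_apply : ∀ (k : ℕ) (A : Fin k → Set 𝓧), (∀ i, MeasurableSet (A i)) →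
    Pairwise (fun i j => Disjoint (A i) (A j)) → iIndepFun (fun i ω => Q ω (A i)) P

/-! ### Pólya urn sequences -/

/-- The measure `α F + ∑_{i < k} δ_{x i}`. -/
def urnMeasure {𝓧 : Type u} [MeasurableSpace 𝓧] {p : ℕ} (α : ℝ) (F : Measure 𝓧)
    (x : Fin p → 𝓧) (k : Fin p) : Measure 𝓧 :=
  ENNReal.ofReal α • F + ∑ i ∈ Finset.Iio k, Measure.dirac (x i)

/-- `X 0, …, X (p - 1)` is a Pólya urn sequence with base distribution `α F`: the conditional
distribution of `X k` given `(X i)_{i < k}` is the normalization of `α F + ∑_{i < k} δ_{X i}`.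
For `k = 0` the conditioning σ-algebra is trivial and this says that `X 0` has distribution `F`. -/
structure IsPolyaUrn {𝓧 : Type u} [MeasurableSpace 𝓧] {Ω : Type v} [MeasurableSpace Ω] {p : ℕ}
    (X : Fin p → Ω → 𝓧) (α : ℝ) (F : Measure 𝓧) (P : Measure Ω) : Prop where
  measurable : ∀ i, Measurable (X i)
  condProb : ∀ (k : Fin p) (A : Set 𝓧), MeasurableSet A →
    P⟦X k ⁻¹' A | ⨆ i : Set.Iio k, MeasurableSpace.comap (X i) inferInstance⟧ =ᵐ[P]
      fun ω => (urnMeasure α F (fun i => X i ω) k).real A /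
        (urnMeasure α F (fun i => X i ω) k).real Set.univ

/-! ### The particle approximation -/

/-- The random signed measure `Q_p = √(T / p) ∑_{i < p} J_i δ_{X_i}`. -/
def particleMeasure {𝓧 : Type u} [MeasurableSpace 𝓧] {Ω : Type v} (p : ℕ) (T : Ω → ℝ)
    (J : Fin p → Ω → ℝ) (X : Fin p → Ω → 𝓧) (ω : Ω) : SignedMeasure 𝓧 :=
  Real.sqrt (T ω / p) • ∑ i, J i ω • VectorMeasure.dirac (X i ω) (1 : ℝ)

end

/-! Everything is identified through characteristic functionals `f ↦ E exp(i ∫ f dQ)`. Given `T` and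
the urn, the jumps are independent with characteristic function `1 / (1 + t²)`, so the functional of
`Q_p` is the expectation of `∏ (1 + T f(X_i)² / p)⁻¹`. After integrating over `T`, and up to an
error vanishing uniformly in the urn points, the product may be replaced by `exp(-T M)`, with `M`
the mean of `f²` over the `X_i`; the Gamma variable then gives `(1 + M / η) ^ (-α)`
(`abs_integral_prod_sub_le`).

The expectation of this power over the urn tends to `exp(-α ∫ log(1 + f² / η) dF)`, a Markov–Krein
identity. Only moments are needed, not a random limit of the empirical measures. Exchangeability
(`lintegral_urnLaw_comp_perm`) turns moments of the mean into product moments, up to index tuples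
with repetitions, whose proportion vanishes. The urn recursion says that the product moments,
suitably weighted, are the Taylor coefficients of the solution of `H' = α B' H`, where `B(s) = -∫
log(1 - s f) dF` (`hasSum_urnMoment`). The limit is the functional of every symmetric Gamma random
measure: for simple functions by independence, then by bounded approximation
(`IsSymmetricGammaRandomMeasure.integral_exp`).

To pass from functionals to convergence in law, the total variations have to be tight: on bounded
sets of signed measures the vague topology is induced by countably many test functions
(`exists_isOpen_inter_vagueBall`), and `tendsto_probabilityMeasure_of_charFunctional` then applies.
Given the urn, a point of multiplicity `m` carries a sum of `m` independent centred jumps, with mean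
absolute value at most `√(2m)`. The expected sum of `√m` over distinct points is `O(√p)` by the urn
recursion (`integral_invSqrtMultiplicity_le`), which the factor `√(T / p)` compensates.

Existence comes from stick-breaking. The target functional `φ(s)` along a ray satisfies `s φ' = -2α
(1 - g) φ` with `g(s) = ∫ (1 + (s f)²)⁻¹ dF`, and hence `φ(s) = E[g(sβ) φ(sβ)]` for `β` of law
`Beta(2α, 1)`. Iterating this identity produces the almost surely absolutely convergent series `∑
J_n β_0 ⋯ β_n δ_{ξ_n}`, with `ξ_n` i.i.d. from `F`, whose functional is `φ`. -/

open scoped Topology ENNReal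
/-! ### Integrals against signed measures -/

section SignedMeasureIntegral

variable {𝓧 : Type u} [MeasurableSpace 𝓧]

/-- The integral of a real function against a signed measure. -/
noncomputable abbrev signedIntegral (μ : SignedMeasure 𝓧) (f : 𝓧 → ℝ) : ℝ :=
  VectorMeasure.integral μ f (ContinuousLinearMap.lsmul ℝ ℝ)

instance isFiniteMeasure_variation (μ : SignedMeasure 𝓧) :
    IsFiniteMeasure (VectorMeasure.variation μ) := by
  rw [← SignedMeasure.totalVariation_eq_variation]
  infer_instance

lemma integrable_signed_of_bounded (μ : SignedMeasure 𝓧) {f : 𝓧 → ℝ} (hf : Measurable f) {c : ℝ}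
    (hc : ∀ x, |f x| ≤ c) : VectorMeasure.Integrable μ f :=
  Integrable.of_bound hf.aestronglyMeasurable c (ae_of_all _ hc)

lemma exists_abs_signedIntegral_le (μ : SignedMeasure 𝓧) :
    ∃ C : ℝ, 0 ≤ C ∧ ∀ (f : 𝓧 → ℝ) (c : ℝ), (∀ x, |f x| ≤ c) → |signedIntegral μ f| ≤ C * c := by
  refine ⟨‖(ContinuousLinearMap.lsmul ℝ ℝ : ℝ →L[ℝ] ℝ →L[ℝ] ℝ)‖ *
    (VectorMeasure.variation μ).real Set.univ, by positivity, fun f c hf => ?_⟩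
  have := VectorMeasure.norm_integral_le_of_norm_le_const (μ := μ)
    (B := (ContinuousLinearMap.lsmul ℝ ℝ : ℝ →L[ℝ] ℝ →L[ℝ] ℝ)) (C := c) (ae_of_all _ hf)
  calc _ ≤ _ := this
    _ = _ := by ring

lemma signedIntegral_simpleFunc (μ : SignedMeasure 𝓧) (f : SimpleFunc 𝓧 ℝ) :
    signedIntegral μ f = ∑ y ∈ f.range, y * μ (f ⁻¹' {y}) := by
  classical
  have h1 : (f : 𝓧 → ℝ) = fun x => ∑ y ∈ f.range, (f ⁻¹' {y}).indicator (fun _ => y) x := by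
    ext x
    rw [Finset.sum_eq_single (f x)]
    · simp
    · intro b _ hb
      simp [hb.symm]
    · intro h
      exact absurd (f.mem_range_self x) h
  have hm : ∀ y, MeasurableSet (f ⁻¹' {y}) := fun y => f.measurableSet_preimage _
  conv_lhs => rw [signedIntegral, h1]
  rw [VectorMeasure.integral_finsetSum]
  · refine Finset.sum_congr rfl fun y _ => ?_
    rw [VectorMeasure.integral_indicator_const _ (hm y)]
    simp
  · intro y _
    exact integrable_signed_of_bounded μ (measurable_const.indicator (hm y)) (c := |y|) fun x => by
      by_cases hx : x ∈ f ⁻¹' {y}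
      · simp [Set.indicator_of_mem hx]
      · simp [Set.indicator_of_notMem hx]

end SignedMeasureIntegral

section TestFunctions

variable {𝓧 : Type u} [TopologicalSpace 𝓧]

lemma exists_abs_le_of_compactlySupported (f : C_c(𝓧, ℝ)) : ∃ c : ℝ, 0 ≤ c ∧ ∀ x, |f x| ≤ c :=
  ⟨‖f.toBoundedContinuousFunction‖, norm_nonneg _,
    fun x => f.toBoundedContinuousFunction.norm_coe_le_norm x⟩

/-! ### A countable uniformly dense family of test functions -/

/-- The space need not be locally compact. Still, a point where some test function is nonzero is
interior to a compact set, and by the Lindelöf property countably many compact sets have interiors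
covering all such points. The set `{δ ≤ |f|}` lies in finitely many of them; on their union `L` the
space `C(L, ℝ)` has countable dense subsets, and off `L` all functions in play are at most `δ`. -/
lemma exists_countable_uniformly_dense [T2Space 𝓧] [SecondCountableTopology 𝓧] :
    ∃ D : Set C_c(𝓧, ℝ), D.Countable ∧
      ∀ (f : C_c(𝓧, ℝ)) (ε : ℝ), 0 < ε → ∃ g ∈ D, ∀ x, |f x - g x| ≤ ε := by
  classical
  obtain ⟨T, hT, hTU⟩ := TopologicalSpace.isOpen_iUnion_countable
    (fun K : {K : Set 𝓧 // IsCompact K} => interior K.1) (fun K => isOpen_interior)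
  have : Countable T := hT.to_subtype
  have key : ∀ (S : Finset T) (m : ℕ), ∃ D : Set C_c(𝓧, ℝ), D.Countable ∧
      ∀ f : C_c(𝓧, ℝ), (∀ x, x ∉ ⋃ K ∈ S, K.1.1 → |f x| ≤ 1 / ((m : ℝ) + 1)) →
      ∃ g ∈ D, ∀ x, |f x - g x| ≤ 2 * (1 / ((m : ℝ) + 1)) := by
    intro S m
    set δ : ℝ := 1 / ((m : ℝ) + 1) with hδ
    have hδ0 : 0 < δ := by positivity
    set L : Set 𝓧 := ⋃ K ∈ S, K.1.1
    have hL : IsCompact L := S.isCompact_biUnion fun K _ => K.1.2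
    have : CompactSpace L := isCompact_iff_compactSpace.mp hL
    -- Density is taken among restrictions of functions that are small off `L`, so each chosen
    -- element lifts to a test function that is small there too.
    set E : Set C_c(𝓧, ℝ) := {f | ∀ x, x ∉ L → |f x| ≤ δ}
    let r : C_c(𝓧, ℝ) → C(L, ℝ) := fun f => f.toContinuousMap.restrict L
    obtain ⟨D', hD', hdense⟩ := TopologicalSpace.exists_countable_dense (r '' E)
    choose φ hφE hφ using fun y : r '' E => y.2
    refine ⟨φ '' D', hD'.image _, fun f hf => ?_⟩
    obtain ⟨y, hy, hd⟩ := hdense.exists_dist_lt (⟨r f, f, hf, rfl⟩ : r '' E) hδ0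
    refine ⟨φ y, ⟨y, hy, rfl⟩, fun x => ?_⟩
    by_cases hx : x ∈ L
    · have h1 : dist (r f) (y : C(L, ℝ)) < δ := hd
      rw [← hφ y] at h1
      have h2 := (ContinuousMap.dist_apply_le_dist (f := r f) (g := r (φ y)) ⟨x, hx⟩).trans h1.le
      rw [Real.dist_eq] at h2
      change |f x - φ y x| ≤ δ at h2
      linarith
    · have h1 := hf x hx
      have h2 := hφE y x hx
      have := abs_sub (f x) (φ y x)
      linarith
  choose D hD hDd using key
  refine ⟨⋃ S, ⋃ m, D S m, Set.countable_iUnion fun S => Set.countable_iUnion fun m => hD S m,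
    fun f ε hε => ?_⟩
  obtain ⟨m, hm⟩ := exists_nat_one_div_lt (half_pos hε)
  set δ : ℝ := 1 / ((m : ℝ) + 1) with hδ
  have hδ0 : 0 < δ := by positivity
  have hclosed : IsClosed {x | δ ≤ |f x|} := isClosed_le continuous_const f.continuous.abs
  have hcomp : IsCompact {x | δ ≤ |f x|} := by
    refine f.hasCompactSupport.isCompact.of_isClosed_subset hclosed fun x hx => ?_
    refine subset_tsupport _ ?_
    intro h0
    simp only [Set.mem_ofPred_eq, h0, abs_zero] at hx
    linarith
  have hsub : {x | δ ≤ |f x|} ⊆ ⋃ K : T, interior K.1.1 := by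
    intro x hx
    have h1 : x ∈ ⋃ K : {K : Set 𝓧 // IsCompact K}, interior K.1 := by
      refine Set.mem_iUnion.2 ⟨⟨tsupport f, f.hasCompactSupport⟩, ?_⟩
      refine interior_mono (subset_tsupport _) ?_
      have ho : IsOpen (Function.support f) := f.continuous.isOpen_support
      rw [ho.interior_eq]
      intro h0
      simp only [Set.mem_ofPred_eq, h0, abs_zero] at hx
      linarith
    rw [← hTU] at h1
    simpa using h1
  obtain ⟨S, hS⟩ := hcomp.elim_finite_subcover _ (fun K : T => isOpen_interior) hsub
  obtain ⟨g, hg, hfg⟩ := hDd S m f fun x hx => by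
    by_contra hlt
    refine hx ?_
    have := hS (show x ∈ {x | δ ≤ |f x|} from (not_le.1 hlt).le)
    simp only [Set.mem_iUnion] at this ⊢
    obtain ⟨K, hK, hxK⟩ := this
    exact ⟨K, hK, interior_subset hxK⟩
  exact ⟨g, Set.mem_iUnion.2 ⟨S, Set.mem_iUnion.2 ⟨m, hg⟩⟩, fun x => (hfg x).trans (by linarith)⟩

end TestFunctions

/-! ### Pairing with test functions and the vague topology -/

section Vague

variable {𝓧 : Type u} [TopologicalSpace 𝓧] [MeasurableSpace 𝓧]

lemma signedIntegral_linearCombination [BorelSpace 𝓧] (μ : SignedMeasure 𝓧) {ι : Type*}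
    (s : Finset ι) (t : ι → ℝ) (f : ι → C_c(𝓧, ℝ)) :
    signedIntegral μ (⇑(∑ i ∈ s, t i • f i)) = ∑ i ∈ s, t i * signedIntegral μ (f i) := by
  have : (⇑(∑ i ∈ s, t i • f i) : 𝓧 → ℝ) = fun x => ∑ i ∈ s, t i • f i x := by
    ext x
    simp [CompactlySupportedContinuousMap.sum_apply]
  rw [signedIntegral, this, VectorMeasure.integral_finsetSum]
  · refine Finset.sum_congr rfl fun i _ => ?_
    rw [VectorMeasure.integral_fun_smul]
    rfl
  · intro i _
    obtain ⟨c, -, hc⟩ := exists_abs_le_of_compactlySupported (t i • f i)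
    exact integrable_signed_of_bounded μ (t i • f i).continuous.measurable hc

lemma signedIntegral_sub [BorelSpace 𝓧] (μ : SignedMeasure 𝓧) (f g : C_c(𝓧, ℝ)) :
    signedIntegral μ (⇑(f - g)) = signedIntegral μ f - signedIntegral μ g := by
  obtain ⟨c, -, hc⟩ := exists_abs_le_of_compactlySupported f
  obtain ⟨d, -, hd⟩ := exists_abs_le_of_compactlySupported g
  exact VectorMeasure.integral_fun_sub
    (integrable_signed_of_bounded μ f.continuous.measurable hc)
    (integrable_signed_of_bounded μ g.continuous.measurable hd)

/-! ### Bounded sets of signed measures -/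

variable (𝓧) in
/-- The signed measures whose pairing with test functions is bounded by `n` times the
supremum norm. -/
def vagueBall (n : ℕ) : Set (SignedMeasure 𝓧) :=
  {μ | ∀ (f : C_c(𝓧, ℝ)) (c : ℝ), 0 ≤ c → (∀ x, |f x| ≤ c) → |signedIntegral μ f| ≤ n * c}

lemma vagueBall_mono {m n : ℕ} (h : m ≤ n) : vagueBall 𝓧 m ⊆ vagueBall 𝓧 n :=
  fun _ hμ f c hc0 hc => (hμ f c hc0 hc).trans (by gcongr)

lemma exists_mem_vagueBall (μ : SignedMeasure 𝓧) : ∃ n, μ ∈ vagueBall 𝓧 n := by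
  obtain ⟨C, -, hC⟩ := exists_abs_signedIntegral_le μ
  obtain ⟨n, hn⟩ := exists_nat_ge C
  exact ⟨n, fun f c hc0 hc => (hC f c hc).trans (by gcongr)⟩

lemma continuous_signedIntegral (f : C_c(𝓧, ℝ)) :
    Continuous fun μ : SignedMeasure 𝓧 => signedIntegral μ f :=
  continuous_iInf_dom continuous_induced_dom

lemma isClosed_vagueBall (n : ℕ) : IsClosed (vagueBall 𝓧 n) := by
  simp only [vagueBall, Set.ofPred_forall]
  exact isClosed_iInter fun f => isClosed_iInter fun c => isClosed_iInter fun _ =>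
    isClosed_iInter fun _ => isClosed_le (continuous_signedIntegral f).abs continuous_const

/-- `D` approximates every test function uniformly. -/
def IsUniformlyDense (D : Set C_c(𝓧, ℝ)) : Prop :=
  ∀ (f : C_c(𝓧, ℝ)) (ε : ℝ), 0 < ε → ∃ g ∈ D, ∀ x, |f x - g x| ≤ ε

/-- For countable `D` this cuts the ball out by countably many conditions. The approximation error
is controlled by the total variation of the individual `μ`, which may exceed `n` but is finite;
hence `δ` is chosen after `C`. -/
lemma mem_vagueBall_iff [BorelSpace 𝓧] {D : Set C_c(𝓧, ℝ)} (hD : IsUniformlyDense D)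
    (μ : SignedMeasure 𝓧) (n : ℕ) :
    μ ∈ vagueBall 𝓧 n ↔
      ∀ d : D, |signedIntegral μ d.1| ≤ n * ‖d.1.toBoundedContinuousFunction‖ := by
  refine ⟨fun h d => h d.1 _ (norm_nonneg _)
    fun x => d.1.toBoundedContinuousFunction.norm_coe_le_norm x, fun h f c hc0 hc => ?_⟩
  obtain ⟨C, hC0, hC⟩ := exists_abs_signedIntegral_le μ
  refine le_of_forall_pos_le_add fun ε hε => ?_
  set δ : ℝ := ε / (n + C + 1) with hδ
  have hδ0 : 0 < δ := by positivity
  obtain ⟨g, hg, hfg⟩ := hD f δ hδ0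
  have h1 : ‖g.toBoundedContinuousFunction‖ ≤ c + δ := by
    refine (BoundedContinuousFunction.norm_le (by positivity)).2 fun x => ?_
    have := abs_sub_abs_le_abs_sub (g x) (f x)
    rw [abs_sub_comm] at this
    change |g x| ≤ _
    linarith [hc x, hfg x]
  have h2 : |signedIntegral μ (⇑(f - g))| ≤ C * δ := hC _ _ hfg
  rw [signedIntegral_sub] at h2
  have h3 := h ⟨g, hg⟩
  have h4 : |signedIntegral μ g| ≤ n * (c + δ) := h3.trans (by gcongr)
  have h5 := abs_sub_abs_le_abs_sub (signedIntegral μ f) (signedIntegral μ g)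
  have h6 : (n + C) * δ ≤ ε := by
    rw [hδ, mul_div_assoc', div_le_iff₀ (by positivity)]
    nlinarith
  linarith

/-- The values of the integrals of the functions in `D`. -/
noncomputable def testValues (D : Set C_c(𝓧, ℝ)) (μ : SignedMeasure 𝓧) : D → ℝ :=
  fun d => signedIntegral μ d.1

lemma continuous_testValues (D : Set C_c(𝓧, ℝ)) : Continuous (testValues D) :=
  continuous_pi fun d => continuous_signedIntegral d.1

/-- On the ball, replacing `f` by `g` changes the pairing by at most `n` times their sup distance,
for all `μ` at once. Every pairing is thus a uniform limit of pairings with members of `D`, and on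
the ball the topology pulled back from `D → ℝ` is already as fine as the vague one. -/
lemma exists_isOpen_inter_vagueBall [BorelSpace 𝓧] {D : Set C_c(𝓧, ℝ)} (hD : IsUniformlyDense D)
    (n : ℕ) {U : Set (SignedMeasure 𝓧)} (hU : IsOpen U) :
    ∃ V : Set (D → ℝ), IsOpen V ∧
      U ∩ vagueBall 𝓧 n = testValues D ⁻¹' V ∩ vagueBall 𝓧 n := by
  let t : TopologicalSpace (vagueBall 𝓧 n) :=
    TopologicalSpace.induced (fun μ => testValues D μ.1) inferInstance
  have hcont : @Continuous _ _ t _ (fun μ : vagueBall 𝓧 n => μ.1) := by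
    refine continuous_iInf_rng.2 fun f => continuous_induced_rng.2 ?_
    refine continuous_of_uniform_approx_of_continuous fun u hu => ?_
    obtain ⟨ε, hε, hεu⟩ := Metric.mem_uniformity_dist.1 hu
    obtain ⟨g, hg, hfg⟩ := hD f (ε / (n + 1)) (by positivity)
    refine ⟨fun μ => signedIntegral μ.1 g, ?_, fun μ => hεu ?_⟩
    · exact (continuous_apply (⟨g, hg⟩ : D)).comp
        (continuous_induced_dom (f := fun μ : vagueBall 𝓧 n => testValues D μ.1))
    · have := μ.2 (f - g) (ε / (n + 1)) (by positivity) hfg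
      rw [signedIntegral_sub] at this
      rw [Real.dist_eq]
      refine this.trans_lt ?_
      rw [mul_div_assoc', div_lt_iff₀ (by positivity)]
      nlinarith
  obtain ⟨V, hV, hVU⟩ := isOpen_induced_iff.1 (hU.preimage hcont)
  refine ⟨V, hV, ?_⟩
  ext μ
  simp only [Set.mem_inter_iff, Set.mem_preimage, and_congr_left_iff]
  intro hμ
  have : (⟨μ, hμ⟩ : vagueBall 𝓧 n) ∈ (fun μ : vagueBall 𝓧 n => testValues D μ.1) ⁻¹' V ↔ _ :=
    Set.ext_iff.1 hVU ⟨μ, hμ⟩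
  exact this.symm

/-! ### Measurability and weak convergence for the vague topology -/

variable [BorelSpace 𝓧] [T2Space 𝓧] [SecondCountableTopology 𝓧]

/-- A random signed measure is measurable as soon as its integrals are. -/
lemma measurable_of_measurable_signedIntegral {Ω : Type*} [MeasurableSpace Ω]
    {Q : Ω → SignedMeasure 𝓧}
    (hQ : ∀ f : C_c(𝓧, ℝ), Measurable fun ω => signedIntegral (Q ω) f) : Measurable Q := by
  obtain ⟨D, hDc, hD⟩ := exists_countable_uniformly_dense (𝓧 := 𝓧)
  have : Countable D := hDc.to_subtype
  have hB : ∀ n, MeasurableSet (Q ⁻¹' vagueBall 𝓧 n) := by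
    intro n
    have : Q ⁻¹' vagueBall 𝓧 n =
        ⋂ d : D, {ω | |signedIntegral (Q ω) d.1| ≤ n * ‖d.1.toBoundedContinuousFunction‖} := by
      ext ω
      simp only [Set.mem_preimage, mem_vagueBall_iff hD, Set.mem_iInter, Set.mem_ofPred_eq]
    rw [this]
    exact MeasurableSet.iInter fun d => measurableSet_le (hQ d.1).abs measurable_const
  refine measurable_of_isOpen fun U hU => ?_
  choose V hV hUV using fun n => exists_isOpen_inter_vagueBall hD n hU
  -- The balls exhaust the space, so an open set is a countable union of sets cut out by `D`.
  have : Q ⁻¹' U = ⋃ n, Q ⁻¹' (testValues D ⁻¹' V n ∩ vagueBall 𝓧 n) := by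
    rw [← Set.preimage_iUnion]
    congr 1
    simp_rw [← hUV]
    rw [← Set.inter_iUnion]
    refine (Set.inter_eq_left.2 fun μ _ => ?_).symm
    exact Set.mem_iUnion.2 (exists_mem_vagueBall μ)
  rw [this]
  refine MeasurableSet.iUnion fun n => ?_
  rw [Set.preimage_inter]
  refine MeasurableSet.inter ?_ (hB n)
  have hm : Measurable fun ω => testValues D (Q ω) := measurable_pi_iff.2 fun d => hQ d.1
  exact hm (hV n).measurableSet

/-- Convergence of the characteristic functionals together with tightness for the total variation
implies weak convergence in the vague topology. -/
theorem tendsto_probabilityMeasure_of_charFunctional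
    {μ : ℕ → ProbabilityMeasure (SignedMeasure 𝓧)} {μ₀ : ProbabilityMeasure (SignedMeasure 𝓧)}
    (hchar : ∀ f : C_c(𝓧, ℝ),
      Tendsto (fun p => ∫ ν, Complex.exp ((signedIntegral ν f : ℝ) * Complex.I) ∂(μ p : Measure _))
        atTop (𝓝 (∫ ν, Complex.exp ((signedIntegral ν f : ℝ) * Complex.I) ∂(μ₀ : Measure _))))
    (htight : ∀ ε : ℝ≥0∞, 0 < ε → ∃ n, ∀ p, (μ p : Measure _) (vagueBall 𝓧 n)ᶜ ≤ ε) :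
    Tendsto μ atTop (𝓝 μ₀) := by
  classical
  obtain ⟨D, hDc, hD⟩ := exists_countable_uniformly_dense (𝓧 := 𝓧)
  have : Countable D := hDc.to_subtype
  have hΨ : Measurable (testValues D) := (continuous_testValues D).measurable
  let ρ : ProbabilityMeasure (SignedMeasure 𝓧) → ProbabilityMeasure (D → ℝ) :=
    fun m => m.map hΨ.aemeasurable
  have hconv : Tendsto (fun p => ρ (μ p)) atTop (𝓝 (ρ μ₀)) := by
    -- Finitely supported vectors serve as the dual of `D → ℝ`; with the discrete topology on them,
    -- joint continuity of the pairing reduces to continuity in the first variable.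
    let : TopologicalSpace (D →₀ ℝ) := ⊥
    have : DiscreteTopology (D →₀ ℝ) := ⟨rfl⟩
    let L : (D → ℝ) →ₗ[ℝ] (D →₀ ℝ) →ₗ[ℝ] ℝ := LinearMap.mk₂ ℝ
      (fun v w => w.sum fun d c => c * v d)
      (fun v v' w => by simp [Finsupp.sum, mul_add, Finset.sum_add_distrib])
      (fun c v w => by simp [Finsupp.sum, Finset.mul_sum]; exact Finset.sum_congr rfl fun _ _ => by ring)
      (fun v w w' => by
        rw [Finsupp.sum_add_index'] <;> simp [add_mul])
      (fun c v w => by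
        rw [Finsupp.sum_smul_index'] <;> simp [Finsupp.sum, Finset.mul_sum, mul_assoc])
    have hL : Continuous fun p : (D → ℝ) × (D →₀ ℝ) => L p.1 p.2 := by
      refine continuous_prod_of_discrete_right.2 fun w => ?_
      change Continuous fun v : D → ℝ => w.sum fun d c => c * v d
      exact continuous_finsetSum _ fun d _ => continuous_const.mul (continuous_apply d)
    have hL' : ∀ v ≠ 0, L v ≠ 0 := by
      intro v hv h
      refine hv (funext fun d => ?_)
      have := LinearMap.congr_fun h (Finsupp.single d 1)
      simpa [L] using this
    refine ProbabilityMeasure.tendsto_of_tight_of_separatesPoints (𝕜 := ℂ)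
      (A := BoundedContinuousFunction.charPoly Real.continuous_probChar hL) ?_
      (BoundedContinuousFunction.separatesPoints_charPoly Real.continuous_probChar
        Real.probChar_ne_one hL hL') ?_
    · rw [isTightMeasureSet_iff_exists_isCompact_measure_compl_le]
      intro ε hε
      obtain ⟨n, hn⟩ := htight ε hε
      -- By Tychonoff, a ball is mapped into a compact box.
      refine ⟨Set.univ.pi fun d : D => Set.Icc (-(n * ‖d.1.toBoundedContinuousFunction‖))
        (n * ‖d.1.toBoundedContinuousFunction‖), isCompact_univ_pi fun _ => isCompact_Icc, ?_⟩
      rintro _ ⟨p, rfl⟩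
      refine le_trans ?_ (hn p)
      change (Measure.map (testValues D) (μ p : Measure _)) _ ≤ _
      rw [Measure.map_apply hΨ
        (MeasurableSet.univ_pi fun _ => measurableSet_Icc).compl]
      refine measure_mono fun ν hν hB => hν fun d _ => ?_
      exact abs_le.1 ((mem_vagueBall_iff hD ν n).1 hB d)
    · intro g hg
      rw [BoundedContinuousFunction.mem_charPoly] at hg
      obtain ⟨w, hw⟩ := hg
      -- A finite combination of pairings is the pairing with one combined test function, so the
      -- hypothesis on single test functions covers all trigonometric polynomials.
      have heq : ∀ m : ProbabilityMeasure (SignedMeasure 𝓧), ∫ x, g x ∂(ρ m : Measure (D → ℝ)) =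
          ∑ a ∈ w.coeff.support, w.coeff a *
            ∫ ν, Complex.exp ((signedIntegral ν (⇑(∑ d ∈ a.support, a d • d.1)) : ℝ) * Complex.I)
              ∂(m : Measure _) := by
        intro m
        change ∫ x, g x ∂(Measure.map (testValues D) (m : Measure _)) = _
        rw [integral_map hΨ.aemeasurable g.continuous.aestronglyMeasurable]
        simp_rw [hw, Finsupp.sum]
        rw [integral_finsetSum]
        · refine Finset.sum_congr rfl fun a _ => ?_
          rw [integral_const_mul]
          congr 1
          refine integral_congr_ae (ae_of_all _ fun ν => ?_)
          refine (Real.probChar_apply _).trans ?_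
          beta_reduce
          rw [signedIntegral_linearCombination]
          rfl
        · intro a _
          refine Integrable.const_mul ?_ _
          refine Integrable.of_bound (C := 1) ?_ (ae_of_all _ fun ν => (Circle.norm_coe _).le)
          have h1 : Continuous fun v : D → ℝ => L v a :=
            hL.comp (Continuous.prodMk_left a)
          have h2 : Continuous fun v : D → ℝ => ((Real.probChar (L v a) : Circle) : ℂ) :=
            continuous_subtype_val.comp (Real.continuous_probChar.comp h1)
          exact (h2.comp (continuous_testValues D)).aestronglyMeasurable
      simp_rw [heq]
      exact tendsto_finsetSum _ fun a _ => (hchar _).const_mul _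
  -- Inside a large ball an open set of signed measures is the preimage of an open set of `D → ℝ`;
  -- passing between the two costs `ε / 2` for the limit and `ε / 2` for the sequence.
  refine tendsto_of_forall_isOpen_le_liminf' fun U hU => ?_
  refine ENNReal.le_of_forall_pos_le_add fun ε hε _ => ?_
  have hε2 : (0 : ℝ≥0∞) < ε / 2 := ENNReal.half_pos (by exact_mod_cast hε.ne')
  obtain ⟨n₁, hn₁⟩ := htight _ hε2
  -- Tightness is assumed along the sequence only; for the limit law it follows since the balls
  -- exhaust the space.
  have hlim : Tendsto (fun n => (μ₀ : Measure _) (vagueBall 𝓧 n)ᶜ) atTop (𝓝 0) := by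
    have := tendsto_measure_iInter_atTop (μ := (μ₀ : Measure (SignedMeasure 𝓧)))
      (s := fun n => (vagueBall 𝓧 n)ᶜ)
      (fun n => (isClosed_vagueBall n).measurableSet.compl.nullMeasurableSet)
      (fun m n h => Set.compl_subset_compl.2 (vagueBall_mono h)) ⟨0, measure_ne_top _ _⟩
    rwa [← Set.compl_iUnion, Set.iUnion_eq_univ_iff.2 exists_mem_vagueBall, Set.compl_univ,
      measure_empty] at this
  obtain ⟨n, hn, hnn⟩ := ((hlim.eventually (Iic_mem_nhds hε2)).and (eventually_ge_atTop n₁)).exists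
  have hn' : ∀ p, (μ p : Measure _) (vagueBall 𝓧 n)ᶜ ≤ ε / 2 := fun p =>
    (measure_mono (Set.compl_subset_compl.2 (vagueBall_mono hnn))).trans (hn₁ p)
  obtain ⟨V, hV, hUV⟩ := exists_isOpen_inter_vagueBall hD n hU
  have hportm := ProbabilityMeasure.le_liminf_measure_open_of_tendsto hconv hV
  have hmap : ∀ m : ProbabilityMeasure (SignedMeasure 𝓧),
      (ρ m : Measure (D → ℝ)) V = (m : Measure _) (testValues D ⁻¹' V) := fun m =>
    Measure.map_apply hΨ hV.measurableSet
  simp_rw [hmap] at hportm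
  have h1 : (μ₀ : Measure _) U ≤ (μ₀ : Measure _) (testValues D ⁻¹' V) + ε / 2 := by
    calc (μ₀ : Measure _) U ≤ (μ₀ : Measure _) (U ∩ vagueBall 𝓧 n ∪ (vagueBall 𝓧 n)ᶜ) :=
          measure_mono fun ν hν => by
            by_cases hB : ν ∈ vagueBall 𝓧 n
            · exact Or.inl ⟨hν, hB⟩
            · exact Or.inr hB
      _ ≤ _ := (measure_union_le _ _).trans (by
        rw [hUV]
        exact add_le_add (measure_mono Set.inter_subset_left) hn)
  have h2 : ∀ p, (μ p : Measure _) (testValues D ⁻¹' V) ≤ (μ p : Measure _) U + ε / 2 := by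
    intro p
    calc (μ p : Measure _) (testValues D ⁻¹' V)
        ≤ (μ p : Measure _) (testValues D ⁻¹' V ∩ vagueBall 𝓧 n ∪ (vagueBall 𝓧 n)ᶜ) :=
          measure_mono fun ν hν => by
            by_cases hB : ν ∈ vagueBall 𝓧 n
            · exact Or.inl ⟨hν, hB⟩
            · exact Or.inr hB
      _ ≤ _ := (measure_union_le _ _).trans (by
        rw [← hUV]
        exact add_le_add (measure_mono Set.inter_subset_left) (hn' p))
  have h3 : liminf (fun p => (μ p : Measure _) (testValues D ⁻¹' V)) atTop ≤
      liminf (fun p => (μ p : Measure _) U) atTop + ε / 2 := by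
    refine (liminf_le_liminf (Eventually.of_forall h2)).trans ?_
    exact (liminf_add_const _ _ _ (by isBoundedDefault) (by isBoundedDefault)).le
  calc (μ₀ : Measure _) U ≤ _ := h1
    _ ≤ liminf (fun p => (μ p : Measure _) U) atTop + ε / 2 + ε / 2 := by
      gcongr
      exact hportm.trans h3
    _ = _ := by rw [add_assoc, ENNReal.add_halves]

end Vague

/-! ### The law of the Pólya urn -/

section UrnLaw

variable {𝓧 : Type u}

/-- The sequence `x` extended by the point `z`. -/
def snocPoint {k : ℕ} (x : Fin k → 𝓧) (z : 𝓧) : Fin (k + 1) → 𝓧 :=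
  Fin.snoc (α := fun _ => 𝓧) x z

@[simp] lemma snocPoint_castSucc {k : ℕ} (x : Fin k → 𝓧) (z : 𝓧) (i : Fin k) :
    snocPoint x z i.castSucc = x i := by simp [snocPoint]

@[simp] lemma snocPoint_last {k : ℕ} (x : Fin k → 𝓧) (z : 𝓧) :
    snocPoint x z (Fin.last k) = z := by simp [snocPoint]

lemma snocPoint_comp_swap_last {k : ℕ} (x : Fin k → 𝓧) (a b : 𝓧) :
    snocPoint (snocPoint x a) b ∘
      Equiv.swap (Fin.last k).castSucc (Fin.last k).succ = snocPoint (snocPoint x b) a := by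
  ext j
  refine Fin.lastCases ?_ (fun j => ?_) j
  · rw [Function.comp_apply, Fin.succ_last, Equiv.swap_apply_right]
    simp
  · refine Fin.lastCases ?_ (fun j => ?_) j
    · rw [Function.comp_apply, Equiv.swap_apply_left, Fin.succ_last]
      simp
    · rw [Function.comp_apply, Equiv.swap_apply_of_ne_of_ne]
      · simp
      · simp [Fin.ext_iff, j.2.ne]
      · simp only [Fin.succ_last, ne_eq, Fin.ext_iff, Fin.val_castSucc, Fin.val_last]
        omega

lemma snocPoint_comp_swap_castSucc {k : ℕ} (i : Fin k) (x : Fin (k + 1) → 𝓧) (z : 𝓧) :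
    snocPoint x z ∘ Equiv.swap i.castSucc.castSucc i.castSucc.succ =
      snocPoint (x ∘ Equiv.swap i.castSucc i.succ) z := by
  ext j
  refine Fin.lastCases ?_ (fun j => ?_) j
  · rw [Function.comp_apply, Equiv.swap_apply_of_ne_of_ne]
    · simp
    · exact (Fin.castSucc_lt_last _).ne'
    · rw [Fin.succ_castSucc]
      exact (Fin.castSucc_lt_last _).ne'
  · rw [Function.comp_apply, Fin.succ_castSucc, snocPoint_castSucc, Function.comp_apply,
      (Fin.castSucc_injective (k + 1)).swap_apply, snocPoint_castSucc]

variable [MeasurableSpace 𝓧]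

lemma measurable_snocPoint {k : ℕ} :
    Measurable fun p : (Fin k → 𝓧) × 𝓧 => snocPoint p.1 p.2 := by
  refine measurable_pi_iff.2 fun j => ?_
  refine Fin.lastCases ?_ (fun j => ?_) j
  · simpa using measurable_snd
  · simp only [snocPoint_castSucc]
    exact (measurable_pi_apply j).comp measurable_fst

@[fun_prop]
lemma Measurable.snocPoint {Ω : Type*} [MeasurableSpace Ω] {k : ℕ} {f : Ω → Fin k → 𝓧}
    {g : Ω → 𝓧} (hf : Measurable f) (hg : Measurable g) :
    Measurable fun ω => _root_.snocPoint (f ω) (g ω) :=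
  measurable_snocPoint.comp (hf.prodMk hg)

/-- The law of the first `k` points of a Pólya urn sequence with base distribution `α F`. -/
noncomputable def urnLaw (α : ℝ) (F : Measure 𝓧) : (k : ℕ) → Measure (Fin k → 𝓧)
  | 0 => Measure.dirac fun i => i.elim0
  | k + 1 => (ENNReal.ofReal (α + k))⁻¹ • (ENNReal.ofReal α •
      ((urnLaw α F k).prod F).map (fun p => snocPoint p.1 p.2) +
      ∑ i, (urnLaw α F k).map (fun x => snocPoint x (x i)))

variable {α : ℝ} {F : Measure 𝓧} [IsProbabilityMeasure F]

instance sFinite_urnLaw (k : ℕ) : SFinite (urnLaw α F k) := by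
  induction k with
  | zero => rw [urnLaw]; infer_instance
  | succ k ih =>
    have : SFinite (∑ i, (urnLaw α F k).map fun x => snocPoint x (x i)) :=
      Finset.sum_induction _ SFinite (fun _ _ _ _ => inferInstance) inferInstance
        fun _ _ => inferInstance
    rw [urnLaw]
    infer_instance

lemma lintegral_urnLaw_succ (k : ℕ) {φ : (Fin (k + 1) → 𝓧) → ℝ≥0∞} (hφ : Measurable φ) :
    ∫⁻ x, φ x ∂urnLaw α F (k + 1) = (ENNReal.ofReal (α + k))⁻¹ * (ENNReal.ofReal α *
      ∫⁻ x, ∫⁻ z, φ (snocPoint x z) ∂F ∂urnLaw α F k +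
      ∑ i, ∫⁻ x, φ (snocPoint x (x i)) ∂urnLaw α F k) := by
  rw [urnLaw, lintegral_smul_measure, lintegral_add_measure, lintegral_smul_measure,
    lintegral_map hφ measurable_snocPoint, lintegral_finsetSum_measure, lintegral_prod]
  · simp only [smul_eq_mul]
    congr 3 with i
    rw [lintegral_map hφ (by fun_prop)]
  · exact (hφ.comp measurable_snocPoint).aemeasurable

lemma isProbabilityMeasure_urnLaw (hα : 0 < α) (k : ℕ) : IsProbabilityMeasure (urnLaw α F k) := by
  induction k with
  | zero => rw [urnLaw]; infer_instance
  | succ k ih =>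
    refine ⟨?_⟩
    rw [← lintegral_one, lintegral_urnLaw_succ k measurable_const]
    simp only [lintegral_const, measure_univ, mul_one, Finset.sum_const, Finset.card_univ,
      Fintype.card_fin, nsmul_eq_mul]
    rw [ENNReal.ofReal_add hα.le k.cast_nonneg, ENNReal.ofReal_natCast]
    refine ENNReal.inv_mul_cancel ?_ ?_
    · simp [hα]
    · finiteness

lemma integral_urnLaw_succ (hα : 0 < α) (k : ℕ) {φ : (Fin (k + 1) → 𝓧) → ℝ} (hφ : Measurable φ)
    {c : ℝ} (hc : ∀ x, |φ x| ≤ c) :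
    (α + k) * ∫ x, φ x ∂urnLaw α F (k + 1) =
      α * ∫ x, ∫ z, φ (snocPoint x z) ∂F ∂urnLaw α F k +
      ∑ i, ∫ x, φ (snocPoint x (x i)) ∂urnLaw α F k := by
  have := isProbabilityMeasure_urnLaw (F := F) hα k
  have hint : ∀ (μ : Measure (Fin (k + 1) → 𝓧)) [IsFiniteMeasure μ], Integrable φ μ :=
    fun μ _ => Integrable.of_bound hφ.aestronglyMeasurable c (ae_of_all _ hc)
  have hpos : 0 < α + k := by positivity
  have h1 : IsFiniteMeasure (((urnLaw α F k).prod F).map fun p => snocPoint p.1 p.2) :=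
    Measure.isFiniteMeasure_map _ _
  have h2 : ∀ i, IsFiniteMeasure ((urnLaw α F k).map fun x => snocPoint x (x i)) :=
    fun i => Measure.isFiniteMeasure_map _ _
  rw [urnLaw, integral_smul_measure, integral_add_measure, integral_smul_measure,
    integral_finsetSum_measure, integral_map measurable_snocPoint.aemeasurable
      hφ.aestronglyMeasurable, integral_prod]
  · rw [ENNReal.toReal_inv, ENNReal.toReal_ofReal hpos.le, ENNReal.toReal_ofReal hα.le,
      smul_eq_mul, smul_eq_mul, mul_inv_cancel_left₀ hpos.ne']
    congr 2 with i
    rw [integral_map (by fun_prop) hφ.aestronglyMeasurable]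
  · exact Integrable.of_bound (hφ.comp measurable_snocPoint).aestronglyMeasurable c
      (ae_of_all _ fun _ => hc _)
  · exact fun i _ => hint _
  · exact (hint _).smul_measure ENNReal.ofReal_ne_top
  · exact integrable_finsetSum_measure.2 fun i _ => hint _

/-- The urn rule treats the earlier points symmetrically: permuting them leaves the fresh draw alone
and only reindexes the copies. -/
lemma lintegral_urnLaw_comp_of_snoc {k : ℕ} {σ : Equiv.Perm (Fin (k + 1))}
    {τ : Equiv.Perm (Fin k)}
    (hστ : ∀ (x : Fin k → 𝓧) z, snocPoint x z ∘ σ = snocPoint (x ∘ τ) z)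
    (hτ : ∀ φ : (Fin k → 𝓧) → ℝ≥0∞, Measurable φ →
      ∫⁻ x, φ (x ∘ τ) ∂urnLaw α F k = ∫⁻ x, φ x ∂urnLaw α F k)
    {φ : (Fin (k + 1) → 𝓧) → ℝ≥0∞} (hφ : Measurable φ) :
    ∫⁻ x, φ (x ∘ σ) ∂urnLaw α F (k + 1) = ∫⁻ x, φ x ∂urnLaw α F (k + 1) := by
  have hcomp : Measurable fun x : Fin (k + 1) → 𝓧 => φ (x ∘ σ) :=
    hφ.comp (measurable_pi_iff.2 fun j => measurable_pi_apply _)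
  rw [lintegral_urnLaw_succ k hφ, lintegral_urnLaw_succ k hcomp]
  simp_rw [hστ]
  congr 2
  · congr 1
    refine hτ (fun x => ∫⁻ z, φ (snocPoint x z) ∂F) ?_
    exact (hφ.comp measurable_snocPoint).lintegral_prod_right'
  · rw [← Equiv.sum_comp τ]
    refine Finset.sum_congr rfl fun i _ => ?_
    exact hτ (fun x => φ (snocPoint x (x i))) (by fun_prop)

/-- The expansion of the last two draws is grouped by origin: both fresh; one fresh and one copied
from the prefix; both copied from the prefix; the second a copy of the first. The swap acts by
Fubini on the first group, exchanges the two sums of the second and the indices of the third, and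
fixes the last. -/
lemma lintegral_urnLaw_comp_swap_last (k : ℕ) {φ : (Fin (k + 2) → 𝓧) → ℝ≥0∞}
    (hφ : Measurable φ) :
    ∫⁻ x, φ (x ∘ Equiv.swap (Fin.last k).castSucc (Fin.last k).succ) ∂urnLaw α F (k + 2) =
      ∫⁻ x, φ x ∂urnLaw α F (k + 2) := by
  have expand : ∀ ψ : (Fin (k + 2) → 𝓧) → ℝ≥0∞, Measurable ψ →
      ∫⁻ x, ψ x ∂urnLaw α F (k + 2) =
        (ENNReal.ofReal (α + (k + 1 : ℕ)))⁻¹ * ((ENNReal.ofReal (α + k))⁻¹ * (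
          ENNReal.ofReal α * (ENNReal.ofReal α *
            ∫⁻ x, ∫⁻ z, ∫⁻ w, ψ (snocPoint (snocPoint x z) w) ∂F ∂F ∂urnLaw α F k) +
          ENNReal.ofReal α * ((∑ i, ∫⁻ x, ∫⁻ w, ψ (snocPoint (snocPoint x (x i)) w) ∂F
              ∂urnLaw α F k) +
            ∑ i, ∫⁻ x, ∫⁻ z, ψ (snocPoint (snocPoint x z) (x i)) ∂F ∂urnLaw α F k) +
          (∑ i, ∑ j, ∫⁻ x, ψ (snocPoint (snocPoint x (x j)) (x i)) ∂urnLaw α F k) +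
          (ENNReal.ofReal α * (∫⁻ x, ∫⁻ z, ψ (snocPoint (snocPoint x z) z) ∂F ∂urnLaw α F k) +
            ∑ j, ∫⁻ x, ψ (snocPoint (snocPoint x (x j)) (x j)) ∂urnLaw α F k))) := by
    intro ψ hψ
    have hm : Measurable fun y : Fin (k + 1) → 𝓧 => ∫⁻ z, ψ (snocPoint y z) ∂F :=
      (hψ.comp measurable_snocPoint).lintegral_prod_right'
    rw [lintegral_urnLaw_succ (k + 1) hψ, lintegral_urnLaw_succ k hm]
    congr 1
    have : ∀ i : Fin (k + 1), ∫⁻ x, ψ (snocPoint x (x i)) ∂urnLaw α F (k + 1) = _ :=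
      fun i => lintegral_urnLaw_succ k (φ := fun x => ψ (snocPoint x (x i))) (by fun_prop)
    simp_rw [this]
    rw [Fin.sum_univ_castSucc]
    simp only [snocPoint_castSucc, snocPoint_last]
    rw [← Finset.mul_sum, Finset.sum_add_distrib, ← Finset.mul_sum]
    ring
  have hcomp : Measurable fun x : Fin (k + 2) → 𝓧 =>
      φ (x ∘ Equiv.swap (Fin.last k).castSucc (Fin.last k).succ) :=
    hφ.comp (measurable_pi_iff.2 fun j => measurable_pi_apply _)
  rw [expand _ hφ, expand _ hcomp]
  simp_rw [snocPoint_comp_swap_last]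
  congr 4
  · congr 1
    swap
    · rw [add_comm]
    congr 3 with x
    rw [lintegral_lintegral_swap]
    have : Measurable fun p : 𝓧 × 𝓧 => φ (snocPoint (snocPoint x p.2) p.1) := by fun_prop
    exact this.aemeasurable
  · exact Finset.sum_comm

/-- The law of the Pólya urn is exchangeable. -/
theorem lintegral_urnLaw_comp_perm (n : ℕ) (σ : Equiv.Perm (Fin n)) {φ : (Fin n → 𝓧) → ℝ≥0∞}
    (hφ : Measurable φ) :
    ∫⁻ x, φ (x ∘ σ) ∂urnLaw α F n = ∫⁻ x, φ x ∂urnLaw α F n := by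
  induction n with
  | zero => simp [Subsingleton.elim σ 1]
  | succ n ih =>
    let S : Submonoid (Equiv.Perm (Fin (n + 1))) :=
      { carrier := {σ | ∀ φ : (Fin (n + 1) → 𝓧) → ℝ≥0∞, Measurable φ →
          ∫⁻ x, φ (x ∘ σ) ∂urnLaw α F (n + 1) = ∫⁻ x, φ x ∂urnLaw α F (n + 1)}
        one_mem' := fun φ _ => rfl
        mul_mem' := fun {σ τ} hσ hτ φ hφ => by
          rw [← hτ φ hφ, ← hσ (fun x => φ (x ∘ τ))]
          · rfl
          · exact hφ.comp (measurable_pi_iff.2 fun j => measurable_pi_apply _) }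
    have hS : S = ⊤ := by
      rw [eq_top_iff, ← Equiv.Perm.mclosure_swap_castSucc_succ, Submonoid.closure_le]
      rintro _ ⟨i, rfl⟩ φ hφ
      cases n with
      | zero => exact i.elim0
      | succ m =>
        revert i
        refine Fin.lastCases ?_ fun i => ?_
        · exact lintegral_urnLaw_comp_swap_last m hφ
        · exact lintegral_urnLaw_comp_of_snoc (snocPoint_comp_swap_castSucc i)
            (fun φ hφ => ih _ hφ) hφ
    exact (hS ▸ Submonoid.mem_top σ : σ ∈ S) φ hφ

lemma map_comp_perm_urnLaw (n : ℕ) (σ : Equiv.Perm (Fin n)) :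
    (urnLaw α F n).map (fun x => x ∘ σ) = urnLaw α F n := by
  have hm : Measurable fun x : Fin n → 𝓧 => x ∘ σ :=
    measurable_pi_iff.2 fun j => measurable_pi_apply _
  refine Measure.ext fun s hs => ?_
  rw [Measure.map_apply hm hs, ← lintegral_indicator_one hs, ← lintegral_indicator_one (hm hs),
    ← lintegral_urnLaw_comp_perm n σ (measurable_one.indicator hs)]
  rfl

lemma integral_urnLaw_comp_perm (n : ℕ) (σ : Equiv.Perm (Fin n)) {φ : (Fin n → 𝓧) → ℝ}
    (hφ : Measurable φ) :
    ∫ x, φ (x ∘ σ) ∂urnLaw α F n = ∫ x, φ x ∂urnLaw α F n := by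
  conv_rhs => rw [← map_comp_perm_urnLaw n σ]
  rw [integral_map _ hφ.aestronglyMeasurable]
  exact (measurable_pi_iff.2 fun j => measurable_pi_apply _).aemeasurable

end UrnLaw

/-! ### Product moments of the Pólya urn -/

section UrnMoments

variable {𝓧 : Type u} [MeasurableSpace 𝓧] {α : ℝ} {F : Measure 𝓧} {f : 𝓧 → ℝ}

/-- The product moment `E[f(X₁) ⋯ f(X_k)]`. -/
noncomputable def urnMoment (α : ℝ) (F : Measure 𝓧) (f : 𝓧 → ℝ) (k : ℕ) : ℝ :=
  ∫ x, ∏ i, f (x i) ∂urnLaw α F k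

/-- The coefficient of `z ^ k` in `(1 - z) ^ (-α)`. -/
noncomputable def negBinomCoeff (α : ℝ) (k : ℕ) : ℝ := (∏ i ∈ Finset.range k, (α + i)) / k.factorial

lemma negBinomCoeff_pos (hα : 0 < α) (k : ℕ) : 0 < negBinomCoeff α k :=
  div_pos (Finset.prod_pos fun i _ => by positivity) (by positivity)

lemma succ_mul_negBinomCoeff (α : ℝ) (k : ℕ) :
    ((k : ℝ) + 1) * negBinomCoeff α (k + 1) = (α + k) * negBinomCoeff α k := by
  simp only [negBinomCoeff, Finset.prod_range_succ, Nat.factorial_succ, Nat.cast_mul, Nat.cast_add,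
    Nat.cast_one]
  field_simp

lemma prod_mem_Icc {ι : Type*} (s : Finset ι) {f : ι → ℝ} (hf : ∀ i, f i ∈ Set.Icc (0 : ℝ) 1) :
    ∏ i ∈ s, f i ∈ Set.Icc (0 : ℝ) 1 :=
  ⟨Finset.prod_nonneg fun i _ => (hf i).1,
    Finset.prod_le_one (fun i _ => (hf i).1) fun i _ => (hf i).2⟩

lemma integral_mem_Icc {Ω : Type*} [MeasurableSpace Ω] (μ : Measure Ω) [IsProbabilityMeasure μ]
    {f : Ω → ℝ} (hf : ∀ x, f x ∈ Set.Icc (0 : ℝ) 1) : ∫ x, f x ∂μ ∈ Set.Icc (0 : ℝ) 1 := by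
  refine ⟨integral_nonneg fun x => (hf x).1, ?_⟩
  have := norm_integral_le_of_norm_le_const (μ := μ) (f := f) (C := 1)
    (ae_of_all _ fun x => by rw [Real.norm_of_nonneg (hf x).1]; exact (hf x).2)
  rw [probReal_univ, mul_one] at this
  exact (le_abs_self _).trans this

lemma urnMoment_zero : urnMoment α F f 0 = 1 := by
  simp [urnMoment, urnLaw]

/-- The product moment with the last factor raised to the power `j`. -/
noncomputable def urnMomentPow (α : ℝ) (F : Measure 𝓧) (f : 𝓧 → ℝ) (k j : ℕ) : ℝ :=
  ∫ x, (∏ i : Fin k, f (x i.castSucc)) * f (x (Fin.last k)) ^ j ∂urnLaw α F (k + 1)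

lemma urnMoment_succ (k : ℕ) : urnMoment α F f (k + 1) = urnMomentPow α F f k 1 := by
  simp [urnMoment, urnMomentPow, Fin.prod_univ_castSucc]

variable [IsProbabilityMeasure F]

lemma urnMoment_mem_Icc (hα : 0 < α) (hf : ∀ x, f x ∈ Set.Icc (0 : ℝ) 1) (k : ℕ) :
    urnMoment α F f k ∈ Set.Icc (0 : ℝ) 1 := by
  have := isProbabilityMeasure_urnLaw (F := F) hα k
  exact integral_mem_Icc _ fun x => prod_mem_Icc _ fun i => hf _

/-- Conditionally on the first `k` points, a fresh last draw contributes `∫ f ^ j dF`, while a copy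
of point `i` adds `j` to the exponent of `f (x i)`. -/
lemma urnMomentPow_recursion (hα : 0 < α) (hfm : Measurable f)
    (hf : ∀ x, f x ∈ Set.Icc (0 : ℝ) 1) (k j : ℕ) :
    (α + k) * urnMomentPow α F f k j = α * (∫ z, f z ^ j ∂F) * urnMoment α F f k +
      ∑ i : Fin k, ∫ x, (∏ l, f (x l)) * f (x i) ^ j ∂urnLaw α F k := by
  rw [urnMomentPow, integral_urnLaw_succ hα k (c := 1)]
  · simp only [snocPoint_castSucc, snocPoint_last]
    congr 1
    simp_rw [integral_const_mul]
    rw [integral_mul_const, urnMoment]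
    ring
  · fun_prop
  · intro x
    have h1 := prod_mem_Icc (Finset.univ : Finset (Fin k)) fun i => hf (x i.castSucc)
    have h2 := hf (x (Fin.last k))
    rw [abs_of_nonneg (mul_nonneg h1.1 (pow_nonneg h2.1 _))]
    exact mul_le_one₀ h1.2 (pow_nonneg h2.1 _) (pow_le_one₀ h2.1 h2.2)

/-- By exchangeability the copied index may be moved to the last place, so all `k + 1` copies
contribute equally. Keeping track of one exponent is therefore enough to close the recursion. -/
lemma urnMomentPow_succ (hα : 0 < α) (hfm : Measurable f)
    (hf : ∀ x, f x ∈ Set.Icc (0 : ℝ) 1) (k j : ℕ) :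
    (α + (k + 1 : ℕ)) * urnMomentPow α F f (k + 1) j =
      α * (∫ z, f z ^ j ∂F) * urnMoment α F f (k + 1) +
      (k + 1 : ℕ) * urnMomentPow α F f k (j + 1) := by
  rw [urnMomentPow_recursion hα hfm hf]
  congr 1
  have hconst : ((k + 1 : ℕ) : ℝ) * urnMomentPow α F f k (j + 1) =
      ∑ _i : Fin (k + 1), urnMomentPow α F f k (j + 1) := by simp
  rw [hconst]
  refine Finset.sum_congr rfl fun i _ => ?_
  rw [← integral_urnLaw_comp_perm (k + 1) (Equiv.swap i (Fin.last k)) (by fun_prop), urnMomentPow]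
  refine integral_congr_ae (ae_of_all _ fun x => ?_)
  simp only [Function.comp_apply, Equiv.swap_apply_left]
  rw [Equiv.prod_comp (Equiv.swap i (Fin.last k)) (fun l => f (x l)), Fin.prod_univ_castSucc]
  ring

/-- Unrolling trades points for exponent; the relation `(k + 1) c_{k+1} = (α + k) c_k` between the
binomial weights absorbs the prefactors. -/
lemma urnMomentPow_eq_sum (hα : 0 < α) (hfm : Measurable f)
    (hf : ∀ x, f x ∈ Set.Icc (0 : ℝ) 1) (k j : ℕ) :
    (α + k) * negBinomCoeff α k * urnMomentPow α F f k j =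
      ∑ q ∈ Finset.HasAntidiagonal.antidiagonal k,
        α * (∫ z, f z ^ (j + q.1) ∂F) * (negBinomCoeff α q.2 * urnMoment α F f q.2) := by
  induction k generalizing j with
  | zero =>
    have := urnMomentPow_recursion (F := F) hα hfm hf 0 j
    simp only [Nat.cast_zero, add_zero, Finset.univ_eq_empty, Finset.sum_empty] at this
    simp only [Nat.cast_zero, add_zero, Finset.Nat.antidiagonal_zero, Finset.sum_singleton]
    linear_combination negBinomCoeff α 0 * this
  | succ k ih =>
    rw [Finset.Nat.sum_antidiagonal_succ]
    have h1 := urnMomentPow_succ (F := F) hα hfm hf k j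
    have h2 := ih (j + 1)
    have h3 := succ_mul_negBinomCoeff α k
    simp only [add_zero]
    have h4 : ∑ q ∈ Finset.HasAntidiagonal.antidiagonal k,
        α * (∫ z, f z ^ (j + (q.1 + 1)) ∂F) * (negBinomCoeff α q.2 * urnMoment α F f q.2) =
        ∑ q ∈ Finset.HasAntidiagonal.antidiagonal k,
        α * (∫ z, f z ^ (j + 1 + q.1) ∂F) * (negBinomCoeff α q.2 * urnMoment α F f q.2) := by
      refine Finset.sum_congr rfl fun q _ => ?_
      rw [add_right_comm, add_assoc]
    rw [h4, ← h2, ← h3]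
    push_cast at h1 ⊢
    linear_combination negBinomCoeff α (k + 1) * h1

/-- This is `H' = α B' H` read coefficientwise, for the generating function `H` of the weighted
product moments and `B = ∑ s ^ k / k ∫ f ^ k dF`. -/
lemma succ_mul_urnMoment (hα : 0 < α) (hfm : Measurable f)
    (hf : ∀ x, f x ∈ Set.Icc (0 : ℝ) 1) (k : ℕ) :
    ((k : ℝ) + 1) * (negBinomCoeff α (k + 1) * urnMoment α F f (k + 1)) =
      ∑ q ∈ Finset.HasAntidiagonal.antidiagonal k,
        α * (∫ z, f z ^ (q.1 + 1) ∂F) * (negBinomCoeff α q.2 * urnMoment α F f q.2) := by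
  rw [← mul_assoc, succ_mul_negBinomCoeff, urnMoment_succ, urnMomentPow_eq_sum hα hfm hf]
  simp_rw [add_comm 1]

/-! ### The generating function of the product moments -/

lemma tendsto_add_div_add (a b : ℝ) :
    Tendsto (fun k : ℕ => (a + k) / ((k : ℝ) + b)) atTop (𝓝 1) := by
  have h : Tendsto (fun k : ℕ => (a - b) / ((k : ℝ) + b) + 1) atTop (𝓝 (0 + 1)) := by
    refine Tendsto.add_const _ ?_
    exact tendsto_const_nhds.div_atTop
      (tendsto_atTop_add_const_right _ _ tendsto_natCast_atTop_atTop)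
  rw [zero_add] at h
  refine h.congr' ?_
  filter_upwards [(tendsto_natCast_atTop_atTop (R := ℝ)).eventually_gt_atTop (-b)] with k hk
  have : (k : ℝ) + b ≠ 0 := by linarith
  field_simp
  ring

lemma summable_negBinomCoeff_mul_pow (hα : 0 < α) {s : ℝ} (hs : 0 < s) (hs1 : s < 1) :
    Summable fun k => negBinomCoeff α k * s ^ k := by
  refine summable_of_ratio_test_tendsto_lt_one (l := s) hs1 (Eventually.of_forall fun k => ?_) ?_
  · exact (mul_pos (negBinomCoeff_pos hα k) (pow_pos hs k)).ne'
  · have := (tendsto_add_div_add α 1).mul_const s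
    rw [one_mul] at this
    refine this.congr fun k => ?_
    have h1 := succ_mul_negBinomCoeff α k
    have h2 := negBinomCoeff_pos hα k
    rw [Real.norm_of_nonneg (mul_pos (negBinomCoeff_pos hα _) (pow_pos hs _)).le,
      Real.norm_of_nonneg (mul_pos h2 (pow_pos hs _)).le]
    have h3 : negBinomCoeff α (k + 1) = (α + k) / ((k : ℝ) + 1) * negBinomCoeff α k := by
      field_simp
      linarith
    rw [h3, pow_succ]
    field_simp

lemma summable_succ_mul_negBinomCoeff_mul_pow (hα : 0 < α) {s : ℝ} (hs : 0 < s) (hs1 : s < 1) :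
    Summable fun k : ℕ => ((k : ℝ) + 1) * negBinomCoeff α (k + 1) * s ^ k := by
  refine summable_of_ratio_test_tendsto_lt_one (l := s) hs1 (Eventually.of_forall fun k => ?_) ?_
  · have := negBinomCoeff_pos hα (k + 1)
    positivity
  · have := (tendsto_add_div_add (α + 1) 1).mul_const s
    rw [one_mul] at this
    refine this.congr fun k => ?_
    have h1 := succ_mul_negBinomCoeff α (k + 1)
    have h2 := negBinomCoeff_pos hα (k + 1)
    have h4 := negBinomCoeff_pos hα (k + 1 + 1)
    rw [h1, Real.norm_of_nonneg (by positivity), Real.norm_of_nonneg (by positivity), pow_succ]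
    push_cast
    field_simp
    ring

lemma summable_norm_mul_pow_of_le {a b : ℕ → ℝ} (hab : ∀ k, |a k| ≤ b k) {s ρ : ℝ}
    (hs : |s| ≤ ρ) (hb : Summable fun k => b k * ρ ^ k) : Summable fun k => ‖a k * s ^ k‖ := by
  refine Summable.of_nonneg_of_le (fun k => norm_nonneg _) (fun k => ?_) hb
  rw [norm_mul, norm_pow]
  exact mul_le_mul (hab k) (pow_le_pow_left₀ (norm_nonneg _) hs k) (by positivity)
    ((abs_nonneg _).trans (hab k))

lemma hasDerivAt_tsum_mul_pow {a b : ℕ → ℝ} {ρ : ℝ}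
    (hab : ∀ k : ℕ, |((k : ℝ) + 1) * a (k + 1)| ≤ b k)
    (hb : Summable fun k : ℕ => b k * ρ ^ k) (ha : Summable fun k => a k * (0 : ℝ) ^ k) {s : ℝ}
    (hs : |s| < ρ) :
    HasDerivAt (fun s => ∑' k, a k * s ^ k) (∑' k : ℕ, ((k : ℝ) + 1) * a (k + 1) * s ^ k) s := by
  have hg : ∀ (n : ℕ) (y : ℝ), HasDerivAt (fun s => a n * s ^ n) (a n * (n * y ^ (n - 1))) y :=
    fun n y => (hasDerivAt_pow n y).const_mul (a n)
  -- The derivative of the constant term is 0, and that of the term of index `k + 1` is dominated by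
  -- `b k * ρ ^ k`; hence the shift.
  set u : ℕ → ℝ := fun n => Nat.casesOn n 0 fun k => b k * ρ ^ k with hu
  have hus : Summable u := (summable_nat_add_iff 1).1 hb
  have hbound : ∀ (n : ℕ) (y : ℝ), y ∈ Set.Ioo (-ρ) ρ → ‖a n * (n * y ^ (n - 1))‖ ≤ u n := by
    intro n y hy
    cases n with
    | zero => simp [hu]
    | succ k =>
      have hy' : |y| ≤ ρ := (abs_lt.2 hy).le
      simp only [hu, Nat.add_sub_cancel]
      have : a (k + 1) * (((k + 1 : ℕ) : ℝ) * y ^ k) = ((k : ℝ) + 1) * a (k + 1) * y ^ k := by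
        push_cast; ring
      rw [this, norm_mul, norm_pow]
      exact mul_le_mul (hab k) (pow_le_pow_left₀ (norm_nonneg _) hy' k) (by positivity)
        ((abs_nonneg _).trans (hab k))
  have hρ : 0 < ρ := (abs_nonneg s).trans_lt hs
  have h := hasDerivAt_tsum_of_isPreconnected hus isOpen_Ioo isPreconnected_Ioo
    (fun n y _ => hg n y) hbound (y₀ := 0) ⟨by linarith, hρ⟩ ha (abs_lt.1 hs)
  convert! h using 1
  have hsum : Summable fun n => a n * (n * s ^ (n - 1)) :=
    Summable.of_norm_bounded hus fun n => hbound n s (abs_lt.1 hs)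
  rw [hsum.tsum_eq_zero_add]
  simp only [Nat.cast_zero, zero_mul, mul_zero, zero_add, Nat.add_sub_cancel]
  exact tsum_congr fun k => by push_cast; ring

/-- The generating function of the product moments of a Pólya urn sequence. -/
theorem hasSum_urnMoment (hα : 0 < α) (hfm : Measurable f) (hf : ∀ x, f x ∈ Set.Icc (0 : ℝ) 1)
    {s : ℝ} (hs0 : 0 ≤ s) (hs1 : s < 1) :
    HasSum (fun k => negBinomCoeff α k * urnMoment α F f k * s ^ k)
      (Real.exp (-(α * ∫ x, Real.log (1 - s * f x) ∂F))) := by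
  -- An intermediate radius gives majorants for the series and their derivatives on an open interval
  -- containing `[0, s]`.
  obtain ⟨ρ, hsρ, hρ1⟩ := exists_between hs1
  have hρ0 : 0 < ρ := hs0.trans_lt hsρ
  set h : ℕ → ℝ := fun k => negBinomCoeff α k * urnMoment α F f k with hh
  set m : ℕ → ℝ := fun i => ∫ z, f z ^ i ∂F with hm
  have hm01 : ∀ i, m i ∈ Set.Icc (0 : ℝ) 1 := fun i =>
    integral_mem_Icc _ fun x => ⟨pow_nonneg (hf x).1 _, pow_le_one₀ (hf x).1 (hf x).2⟩
  have hM := urnMoment_mem_Icc (F := F) hα hf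
  have hhle : ∀ k, |h k| ≤ negBinomCoeff α k := fun k => by
    rw [hh, abs_mul, abs_of_pos (negBinomCoeff_pos hα k), abs_of_nonneg (hM k).1]
    exact mul_le_of_le_one_right (negBinomCoeff_pos hα k).le (hM k).2
  have hh' : ∀ k : ℕ, |((k : ℝ) + 1) * h (k + 1)| ≤ ((k : ℝ) + 1) * negBinomCoeff α (k + 1) :=
    fun k => by
      rw [abs_mul, abs_of_nonneg (by positivity : (0 : ℝ) ≤ (k : ℝ) + 1)]
      exact mul_le_mul_of_nonneg_left (hhle _) (by positivity)
  have hsum0 : ∀ a : ℕ → ℝ, Summable fun k => a k * (0 : ℝ) ^ k := fun a =>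
    summable_of_ne_finset_zero (s := {0}) fun k hk => by
      rw [Finset.mem_singleton] at hk
      simp [hk]
  -- Coefficients of `-∫ log (1 - s f) dF`: the moments divided by their index, without constant
  -- term.
  set e : ℕ → ℝ := fun i => Nat.casesOn i 0 fun k => m (k + 1) / ((k : ℝ) + 1) with he
  have he' : ∀ k : ℕ, ((k : ℝ) + 1) * e (k + 1) = m (k + 1) := fun k => by
    simp only [he]
    field_simp
  have hm' : ∀ k : ℕ, |m (k + 1)| ≤ 1 := fun k => by
    rw [abs_of_nonneg (hm01 _).1]
    exact (hm01 _).2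
  have hgeom : Summable fun k : ℕ => (1 : ℝ) * ρ ^ k := by
    simpa using summable_geometric_of_lt_one hρ0.le hρ1
  set H : ℝ → ℝ := fun s => ∑' k, h k * s ^ k with hH
  set B : ℝ → ℝ := fun s => ∑' k, e k * s ^ k with hB
  have hB' : ∀ t, |t| < ρ → HasDerivAt B (∑' k, m (k + 1) * t ^ k) t := by
    intro t ht
    have := hasDerivAt_tsum_mul_pow (a := e) (b := fun _ => 1) (fun k => by rw [he']; exact hm' k)
      hgeom (hsum0 e) ht
    simpa only [he'] using this
  have hH' : ∀ t, |t| < ρ → HasDerivAt H (α * (∑' k, m (k + 1) * t ^ k) * H t) t := by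
    intro t ht
    have h1 := hasDerivAt_tsum_mul_pow hh' (summable_succ_mul_negBinomCoeff_mul_pow hα hρ0 hρ1)
      (hsum0 h) ht
    convert! h1 using 1
    rw [hH, mul_assoc, tsum_mul_tsum_eq_tsum_sum_antidiagonal_of_summable_norm
      (summable_norm_mul_pow_of_le hm' ht.le hgeom)
      (summable_norm_mul_pow_of_le hhle ht.le (summable_negBinomCoeff_mul_pow hα hρ0 hρ1)),
      ← tsum_mul_left]
    refine tsum_congr fun k => ?_
    rw [succ_mul_urnMoment hα hfm hf k, Finset.mul_sum, Finset.sum_mul]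
    refine Finset.sum_congr rfl fun q hq => ?_
    rw [← Finset.HasAntidiagonal.mem_antidiagonal.1 hq, pow_add]
    simp only [hm, hh]
    ring
  -- Since `H' = α B' H`, the function `H exp (-α B)` has zero derivative.
  have hconst : H s * Real.exp (-(α * B s)) = H 0 * Real.exp (-(α * B 0)) := by
    have hd : ∀ t ∈ Set.Icc 0 s, HasDerivAt (fun t => H t * Real.exp (-(α * B t))) 0 t := by
      intro t ht
      have ht' : |t| < ρ := by
        rw [abs_of_nonneg ht.1]
        exact ht.2.trans_lt hsρ
      have := (hH' t ht').mul (((hB' t ht').const_mul α).neg.exp)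
      convert! this using 1
      generalize (∑' k : ℕ, m (k + 1) * t ^ k) = A
      ring
    exact constant_of_has_deriv_right_zero
      (fun t ht => (hd t ht).continuousAt.continuousWithinAt)
      (fun t ht => (hd t ⟨ht.1, ht.2.le⟩).hasDerivWithinAt) s ⟨hs0, le_rfl⟩
  have hH0 : H 0 = 1 := by
    rw [hH]
    simp only
    rw [tsum_eq_single 0 fun k hk => by simp [hk]]
    simp [hh, negBinomCoeff, urnMoment_zero]
  have hB0 : B 0 = 0 := by
    rw [hB]
    simp only
    rw [tsum_eq_single 0 fun k hk => by simp [hk]]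
    simp [he]
  have hsf : ∀ x, |s * f x| ≤ s := fun x => by
    rw [abs_of_nonneg (mul_nonneg hs0 (hf x).1)]
    exact mul_le_of_le_one_right hs0 (hf x).2
  have hBs : B s = -∫ x, Real.log (1 - s * f x) ∂F := by
    have h1 : ∀ x, HasSum (fun n : ℕ => (s * f x) ^ (n + 1) / ((n : ℝ) + 1))
        (-Real.log (1 - s * f x)) := fun x =>
      Real.hasSum_pow_div_log_of_abs_lt_one ((hsf x).trans_lt hs1)
    have hle : ∀ (n : ℕ) x, ‖(s * f x) ^ (n + 1) / ((n : ℝ) + 1)‖ ≤ s ^ n := by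
      intro n x
      rw [norm_div, norm_pow, Real.norm_eq_abs, Real.norm_of_nonneg (by positivity)]
      refine (div_le_self (by positivity) (by linarith [n.cast_nonneg (α := ℝ)])).trans ?_
      refine (pow_le_pow_left₀ (abs_nonneg _) (hsf x) _).trans ?_
      rw [pow_succ]
      exact mul_le_of_le_one_right (by positivity) hs1.le
    have hint : ∀ n : ℕ, Integrable (fun x => (s * f x) ^ (n + 1) / ((n : ℝ) + 1)) F := fun n =>
      Integrable.of_bound (by fun_prop) (s ^ n) (ae_of_all _ (hle n))
    have h2 := hasSum_integral_of_summable_integral_norm hint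
      (Summable.of_nonneg_of_le (fun n => integral_nonneg fun x => norm_nonneg _)
        (fun n => by
          have := norm_integral_le_of_norm_le_const (μ := F)
            (f := fun x => ‖(s * f x) ^ (n + 1) / ((n : ℝ) + 1)‖) (C := s ^ n)
            (ae_of_all _ fun x => by rw [norm_norm]; exact hle n x)
          rw [probReal_univ, mul_one] at this
          exact (le_abs_self _).trans this)
        (summable_geometric_of_lt_one hs0 hs1))
    have h3 : ∀ x, ∑' n : ℕ, (s * f x) ^ (n + 1) / ((n : ℝ) + 1) = -Real.log (1 - s * f x) :=
      fun x => (h1 x).tsum_eq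
    simp_rw [h3] at h2
    rw [integral_neg] at h2
    rw [← h2.tsum_eq, hB]
    have hes : Summable fun k => e k * s ^ k := by
      refine (summable_norm_mul_pow_of_le (b := fun _ => 1) (fun k => ?_)
        (by rw [abs_of_nonneg hs0]; exact hsρ.le) hgeom).of_norm
      cases k with
      | zero => simp [he]
      | succ k =>
        simp only [he]
        rw [abs_div, abs_of_nonneg (by positivity : (0 : ℝ) ≤ (k : ℝ) + 1)]
        exact (div_le_self (abs_nonneg _) (by linarith [k.cast_nonneg (α := ℝ)])).trans (hm' k)
    simp only
    rw [hes.tsum_eq_zero_add]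
    have he0 : e 0 = 0 := rfl
    rw [he0, zero_mul, zero_add]
    refine tsum_congr fun n => ?_
    simp_rw [mul_pow, mul_div_assoc]
    rw [integral_const_mul, integral_div]
    ring
  have hHs : H s = Real.exp (α * B s) := by
    rw [hH0, hB0, mul_zero, neg_zero, Real.exp_zero, mul_one] at hconst
    have : H s = H s * Real.exp (-(α * B s)) * Real.exp (α * B s) := by
      rw [mul_assoc, ← Real.exp_add]; simp
    rw [this, hconst, one_mul]
  have hsumH : Summable fun k => h k * s ^ k :=
    (summable_norm_mul_pow_of_le hhle (by rw [abs_of_nonneg hs0]; exact hsρ.le)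
      (summable_negBinomCoeff_mul_pow hα hρ0 hρ1)).of_norm
  have := hsumH.hasSum
  change HasSum _ (H s) at this
  rw [hHs, hBs, mul_neg] at this
  exact this

/-- The binomial series is the urn identity on a one-point space, where `f = 1` and all product
moments are 1. -/
lemma hasSum_negBinomCoeff_mul_pow (hα : 0 < α) {z : ℝ} (hz0 : 0 ≤ z) (hz1 : z < 1) :
    HasSum (fun k => negBinomCoeff α k * z ^ k) ((1 - z) ^ (-α)) := by
  have h := hasSum_urnMoment (F := Measure.dirac ()) (f := fun _ => 1) hα measurable_const
    (fun _ => ⟨zero_le_one, le_rfl⟩) hz0 hz1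
  have h1 : ∀ k, urnMoment α (Measure.dirac ()) (fun _ => 1) k = 1 := fun k => by
    have := isProbabilityMeasure_urnLaw (F := Measure.dirac ()) hα k
    simp [urnMoment]
  simp only [h1, mul_one, integral_const, probReal_univ, smul_eq_mul, one_mul] at h
  rwa [Real.rpow_def_of_pos (by linarith), mul_neg, mul_comm]

end UrnMoments

section UrnMeans

variable {𝓧 : Type u} {f : 𝓧 → ℝ}

/-! ### Moments of empirical means -/

/-- The mean of `f` over the points `x`. -/
noncomputable def sampleMean (f : 𝓧 → ℝ) {p : ℕ} (x : Fin p → 𝓧) : ℝ := (∑ i, f (x i)) / p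

lemma sampleMean_mem_Icc (hf : ∀ x, f x ∈ Set.Icc (0 : ℝ) 1) {p : ℕ} (x : Fin p → 𝓧) :
    sampleMean f x ∈ Set.Icc (0 : ℝ) 1 := by
  refine ⟨div_nonneg (Finset.sum_nonneg fun i _ => (hf _).1) p.cast_nonneg, ?_⟩
  refine div_le_one_of_le₀ ?_ p.cast_nonneg
  calc ∑ i, f (x i) ≤ ∑ _i : Fin p, (1 : ℝ) := Finset.sum_le_sum fun i _ => (hf _).2
    _ = p := by simp

variable [MeasurableSpace 𝓧] {α : ℝ} {F : Measure 𝓧}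

@[fun_prop]
lemma measurable_sampleMean (hf : Measurable f) {p : ℕ} :
    Measurable (sampleMean f : (Fin p → 𝓧) → ℝ) := by
  unfold sampleMean
  fun_prop

variable [IsProbabilityMeasure F]

lemma integral_urnLaw_comp_castSucc (hα : 0 < α) (k : ℕ) {φ : (Fin k → 𝓧) → ℝ} (hφ : Measurable φ)
    {c : ℝ} (hc : ∀ x, |φ x| ≤ c) :
    ∫ x, φ (fun i => x i.castSucc) ∂urnLaw α F (k + 1) = ∫ x, φ x ∂urnLaw α F k := by
  have h := integral_urnLaw_succ (F := F) hα k (φ := fun x => φ fun i => x i.castSucc)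
    (hφ.comp (measurable_pi_iff.2 fun j => measurable_pi_apply _)) (fun x => hc _)
  simp only [snocPoint_castSucc, integral_const, probReal_univ, smul_eq_mul, one_mul,
    Finset.sum_const, Finset.card_univ, Fintype.card_fin, nsmul_eq_mul, ← add_mul] at h
  exact mul_left_cancel₀ (by positivity) h

lemma integral_prod_comp_castLE (hα : 0 < α) (hfm : Measurable f)
    (hf : ∀ x, f x ∈ Set.Icc (0 : ℝ) 1) {k p : ℕ} (hkp : k ≤ p) :
    ∫ x, ∏ j : Fin k, f (x (Fin.castLE hkp j)) ∂urnLaw α F p = urnMoment α F f k := by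
  induction p, hkp using Nat.le_induction with
  | base => rfl
  | succ p hkp ih =>
    rw [← ih, ← integral_urnLaw_comp_castSucc hα p (by fun_prop) (c := 1)]
    · rfl
    · intro x
      have := prod_mem_Icc (Finset.univ : Finset (Fin k)) fun j => hf (x (Fin.castLE hkp j))
      rw [abs_of_nonneg this.1]
      exact this.2

/-- A permutation of `Fin p` extending `castLE j ↦ g j` moves the chosen points to the front. -/
lemma integral_prod_comp_injective (hα : 0 < α) (hfm : Measurable f)
    (hf : ∀ x, f x ∈ Set.Icc (0 : ℝ) 1) {k p : ℕ} {g : Fin k → Fin p}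
    (hg : Function.Injective g) :
    ∫ x, ∏ j, f (x (g j)) ∂urnLaw α F p = urnMoment α F f k := by
  classical
  have hkp : k ≤ p := by simpa using Fintype.card_le_of_injective g hg
  let e : Set.range (Fin.castLE hkp) ≃ Set.range g :=
    (Equiv.ofInjective _ (Fin.castLE_injective hkp)).symm.trans (Equiv.ofInjective g hg)
  let σ : Equiv.Perm (Fin p) := Equiv.extendSubtype e
  have hσ : ∀ j, σ (Fin.castLE hkp j) = g j := by
    intro j
    have h1 := Equiv.extendSubtype_apply_of_mem e (Fin.castLE hkp j) ⟨j, rfl⟩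
    rw [h1]
    have : (⟨Fin.castLE hkp j, ⟨j, rfl⟩⟩ : Set.range (Fin.castLE hkp)) =
      Equiv.ofInjective _ (Fin.castLE_injective hkp) j := rfl
    simp only [e, Equiv.trans_apply]
    rw [this, Equiv.symm_apply_apply]
    rfl
  rw [← integral_prod_comp_castLE hα hfm hf hkp,
    ← integral_urnLaw_comp_perm p σ (φ := fun x => ∏ j : Fin k, f (x (Fin.castLE hkp j)))
      (by fun_prop)]
  simp [hσ]

lemma tendsto_descFactorial_div_pow (k : ℕ) :
    Tendsto (fun p : ℕ => (p.descFactorial k : ℝ) / (p : ℝ) ^ k) atTop (𝓝 1) := by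
  have h1 : Tendsto (fun p : ℕ => (1 - (k : ℝ) / p) ^ k) atTop (𝓝 1) := by
    have : Tendsto (fun p : ℕ => (1 - (k : ℝ) / p)) atTop (𝓝 (1 - 0)) :=
      tendsto_const_nhds.sub (tendsto_const_nhds.div_atTop tendsto_natCast_atTop_atTop)
    simpa using this.pow k
  refine tendsto_of_tendsto_of_tendsto_of_le_of_le' h1 tendsto_const_nhds ?_ ?_
  · filter_upwards [eventually_ge_atTop (k + 1)] with p hp
    have hp0 : (0 : ℝ) < p := by exact_mod_cast (by omega : 0 < p)
    rw [le_div_iff₀ (by positivity), ← mul_pow]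
    have h2 : (1 - (k : ℝ) / p) * p = ((p - k : ℕ) : ℝ) := by
      rw [Nat.cast_sub (by omega)]
      field_simp
    rw [h2]
    have h3 := Nat.pow_sub_le_descFactorial p k
    calc ((p - k : ℕ) : ℝ) ^ k ≤ ((p + 1 - k : ℕ) : ℝ) ^ k := by
          gcongr
          omega
      _ ≤ _ := by exact_mod_cast h3
  · filter_upwards [eventually_gt_atTop 0] with p hp
    refine div_le_one_of_le₀ ?_ (by positivity)
    exact_mod_cast Nat.descFactorial_le_pow p k

/-- The `k`-th power of the mean expands over all maps `Fin k → Fin p`. Injective ones contribute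
exactly the product moment; each other one errs by at most 1, and the right side is their
proportion. -/
lemma abs_pow_mul_integral_sampleMean_pow_sub_le (hα : 0 < α) (hfm : Measurable f)
    (hf : ∀ x, f x ∈ Set.Icc (0 : ℝ) 1) (k p : ℕ) (hp : 0 < p) :
    |∫ x, sampleMean f x ^ k ∂urnLaw α F p - urnMoment α F f k| ≤
      1 - (p.descFactorial k : ℝ) / (p : ℝ) ^ k := by
  classical
  have hpr := isProbabilityMeasure_urnLaw (F := F) hα p
  have hp0 : (0 : ℝ) < (p : ℝ) ^ k := by positivity
  set I : (Fin k → Fin p) → ℝ := fun g => ∫ x, ∏ j, f (x (g j)) ∂urnLaw α F p with hI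
  have hM := urnMoment_mem_Icc (F := F) hα hf k
  have hI01 : ∀ g, I g ∈ Set.Icc (0 : ℝ) 1 := fun g =>
    integral_mem_Icc _ fun x => prod_mem_Icc _ fun j => hf _
  have hpow : (p : ℝ) ^ k * ∫ x, sampleMean f x ^ k ∂urnLaw α F p = ∑ g, I g := by
    rw [← integral_const_mul, ← integral_finsetSum]
    · refine integral_congr_ae (ae_of_all _ fun x => ?_)
      simp only [sampleMean]
      rw [← Fintype.sum_pow (fun i => f (x i)) k, div_pow, mul_div_cancel₀ _ hp0.ne']
    · intro g _
      have hm : Measurable fun x : Fin p → 𝓧 => ∏ j, f (x (g j)) := by fun_prop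
      refine Integrable.of_bound hm.aestronglyMeasurable 1 (ae_of_all _ fun x => ?_)
      have := prod_mem_Icc (Finset.univ : Finset (Fin k)) fun j => hf (x (g j))
      rw [Real.norm_of_nonneg this.1]
      exact this.2
  have hcard : ((Finset.univ.filter fun g : Fin k → Fin p => Function.Injective g).card : ℝ) =
      p.descFactorial k := by
    have : Fintype.card (Fin k ↪ Fin p) = p.descFactorial k := by simp
    rw [← this, ← Fintype.card_congr (Equiv.subtypeInjectiveEquivEmbedding (Fin k) (Fin p)),
      Fintype.card_subtype]
  have hcard' : ((Finset.univ.filter fun g : Fin k → Fin p => ¬ Function.Injective g).card : ℝ) =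
      (p : ℝ) ^ k - p.descFactorial k := by
    rw [← hcard, eq_sub_iff_add_eq']
    have := Finset.card_filter_add_card_filter_not (s := (Finset.univ : Finset (Fin k → Fin p)))
      (fun g => Function.Injective g)
    rw [← Nat.cast_add, this]
    simp
  have hdiff : ∑ g, I g - (p : ℝ) ^ k * urnMoment α F f k =
      ∑ g ∈ Finset.univ.filter fun g : Fin k → Fin p => ¬ Function.Injective g,
        (I g - urnMoment α F f k) := by
    have h1 : (p : ℝ) ^ k * urnMoment α F f k =
        ∑ _g : Fin k → Fin p, urnMoment α F f k := by simp
    rw [h1, ← Finset.sum_sub_distrib, ← Finset.sum_filter_add_sum_filter_not Finset.univ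
      (fun g : Fin k → Fin p => Function.Injective g), add_eq_right]
    refine Finset.sum_eq_zero fun g hg => ?_
    rw [Finset.mem_filter] at hg
    rw [hI, sub_eq_zero]
    exact integral_prod_comp_injective hα hfm hf hg.2
  have hle : |∑ g, I g - (p : ℝ) ^ k * urnMoment α F f k| ≤
      (p : ℝ) ^ k - p.descFactorial k := by
    rw [hdiff, ← hcard']
    refine (Finset.abs_sum_le_sum_abs _ _).trans ?_
    rw [← nsmul_one, ← Finset.sum_const]
    refine Finset.sum_le_sum fun g _ => ?_
    have := hI01 g
    rw [abs_le]
    constructor <;> linarith [this.1, this.2, hM.1, hM.2]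
  rw [← hpow, ← mul_sub, abs_mul, abs_of_pos hp0, ← le_div_iff₀' hp0, sub_div, div_self hp0.ne']
    at hle
  exact hle

lemma tendsto_integral_sampleMean_pow (hα : 0 < α) (hfm : Measurable f)
    (hf : ∀ x, f x ∈ Set.Icc (0 : ℝ) 1) (k : ℕ) :
    Tendsto (fun p => ∫ x, sampleMean f x ^ k ∂urnLaw α F p) atTop (𝓝 (urnMoment α F f k)) := by
  rw [tendsto_iff_norm_sub_tendsto_zero]
  have h := (tendsto_descFactorial_div_pow k).const_sub 1
  rw [sub_self] at h
  refine squeeze_zero' (Eventually.of_forall fun _ => norm_nonneg _) ?_ h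
  filter_upwards [eventually_gt_atTop 0] with p hp
  exact abs_pow_mul_integral_sampleMean_pow_sub_le hα hfm hf k p hp

/-- Expanding by the binomial series leaves the moments of the mean, which converge one by one; they
lie in `[0, 1]`, so the binomial series itself dominates. -/
lemma tendsto_integral_one_sub_rpow (hα : 0 < α) (hfm : Measurable f)
    (hf : ∀ x, f x ∈ Set.Icc (0 : ℝ) 1) {s : ℝ} (hs0 : 0 < s) (hs1 : s < 1) :
    Tendsto (fun p => ∫ x, (1 - s * sampleMean f x) ^ (-α) ∂urnLaw α F p) atTop
      (𝓝 (Real.exp (-(α * ∫ x, Real.log (1 - s * f x) ∂F)))) := by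
  have hsum := summable_negBinomCoeff_mul_pow hα hs0 hs1
  have hZ : ∀ (p : ℕ) (x : Fin p → 𝓧) (k : ℕ), sampleMean f x ^ k ∈ Set.Icc (0 : ℝ) 1 :=
    fun p x k => ⟨pow_nonneg (sampleMean_mem_Icc hf x).1 _,
      pow_le_one₀ (sampleMean_mem_Icc hf x).1 (sampleMean_mem_Icc hf x).2⟩
  have hexp : ∀ p, ∫ x, (1 - s * sampleMean f x) ^ (-α) ∂urnLaw α F p =
      ∑' k, negBinomCoeff α k * (∫ x, sampleMean f x ^ k ∂urnLaw α F p) * s ^ k := by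
    intro p
    have hpr := isProbabilityMeasure_urnLaw (F := F) hα p
    have hle : ∀ (k : ℕ) (x : Fin p → 𝓧),
        ‖negBinomCoeff α k * (s * sampleMean f x) ^ k‖ ≤ negBinomCoeff α k * s ^ k := by
      intro k x
      have h1 := negBinomCoeff_pos hα k
      rw [mul_pow, Real.norm_of_nonneg
        (mul_nonneg h1.le (mul_nonneg (pow_nonneg hs0.le _) (hZ p x k).1))]
      gcongr
      exact mul_le_of_le_one_right (by positivity) (hZ p x k).2
    have h := hasSum_integral_of_summable_integral_norm (μ := urnLaw α F p)
      (F := fun k x => negBinomCoeff α k * (s * sampleMean f x) ^ k)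
      (fun k => Integrable.of_bound (by fun_prop) _ (ae_of_all _ (hle k)))
      (Summable.of_nonneg_of_le (fun n => integral_nonneg fun x => norm_nonneg _)
        (fun k => by
          have := norm_integral_le_of_norm_le_const (μ := urnLaw α F p)
            (f := fun x => ‖negBinomCoeff α k * (s * sampleMean f x) ^ k‖)
            (ae_of_all _ fun x => by rw [norm_norm]; exact hle k x)
          rw [probReal_univ, mul_one] at this
          exact (le_abs_self _).trans this) hsum)
    have h3 : ∀ x : Fin p → 𝓧, ∑' k, negBinomCoeff α k * (s * sampleMean f x) ^ k =
        (1 - s * sampleMean f x) ^ (-α) := fun x =>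
      (hasSum_negBinomCoeff_mul_pow hα (mul_nonneg hs0.le (sampleMean_mem_Icc hf x).1)
        ((mul_le_of_le_one_right hs0.le (sampleMean_mem_Icc hf x).2).trans_lt hs1)).tsum_eq
    simp_rw [h3] at h
    rw [← h.tsum_eq]
    refine tsum_congr fun k => ?_
    simp_rw [mul_pow]
    rw [integral_const_mul, integral_const_mul]
    ring
  simp_rw [hexp]
  rw [← (hasSum_urnMoment (F := F) hα hfm hf hs0.le hs1).tsum_eq]
  refine tendsto_tsum_of_dominated_convergence hsum
    (fun k => ((tendsto_integral_sampleMean_pow hα hfm hf k).const_mul _).mul_const _)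
    (Eventually.of_forall fun p k => ?_)
  have hpr := isProbabilityMeasure_urnLaw (F := F) hα p
  have h1 := negBinomCoeff_pos hα k
  have h2 := integral_mem_Icc (urnLaw α F p) fun x => hZ p x k
  rw [Real.norm_of_nonneg (mul_nonneg (mul_nonneg h1.le h2.1) (pow_nonneg hs0.le _))]
  gcongr
  exact mul_le_of_le_one_right h1.le h2.2

/-- The Markov–Krein identity in the limit of a Pólya urn sequence. -/
theorem tendsto_integral_one_add_sampleMean_rpow (hα : 0 < α) {η : ℝ} (hη : 0 < η) {g : 𝓧 → ℝ}
    (hgm : Measurable g) {c : ℝ} (hg : ∀ x, g x ∈ Set.Icc 0 c) :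
    Tendsto (fun p => ∫ x, (1 + sampleMean g x / η) ^ (-α) ∂urnLaw α F p) atTop
      (𝓝 (Real.exp (-(α * ∫ x, Real.log (1 + g x / η) ∂F)))) := by
  -- The affine change `f = (C - g) / C` takes values in `[0, 1]` and satisfies `1 - s f = κ (1 + g
  -- / η)` with `s < 1`, so the previous limit applies. The factor `κ ^ (-α)` is removed by
  -- multiplying with `κ ^ α`.
  set C : ℝ := |c| + 1 with hC
  have hC0 : 0 < C := by positivity
  have hgC : ∀ x, g x ≤ C := fun x => (hg x).2.trans (by linarith [le_abs_self c])
  set f : 𝓧 → ℝ := fun x => (C - g x) / C with hf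
  have hf01 : ∀ x, f x ∈ Set.Icc (0 : ℝ) 1 := fun x =>
    ⟨div_nonneg (by linarith [hgC x]) hC0.le,
      div_le_one_of_le₀ (by linarith [(hg x).1]) hC0.le⟩
  set s : ℝ := C / (η + C) with hs
  have hs0 : 0 < s := by positivity
  have hs1 : s < 1 := by rw [hs, div_lt_one (by positivity)]; linarith
  set κ : ℝ := η / (η + C) with hκ
  have hκ0 : 0 < κ := by positivity
  have h1 : ∀ x, 1 - s * f x = κ * (1 + g x / η) := fun x => by
    simp only [hs, hf, hκ]
    field_simp
    ring
  -- The mean of an empty sample is 0 for both `f` and `g`, so the affine relation fails at `p = 0`.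
  have h2 : ∀ p : ℕ, 0 < p → ∀ x : Fin p → 𝓧,
      1 - s * sampleMean f x = κ * (1 + sampleMean g x / η) := by
    intro p hp x
    have hp0 : (0 : ℝ) < p := by exact_mod_cast hp
    have h3 : sampleMean f x = (C - sampleMean g x) / C := by
      simp only [sampleMean, hf]
      rw [← Finset.sum_div, Finset.sum_sub_distrib]
      simp only [Finset.sum_const, Finset.card_univ, Fintype.card_fin, nsmul_eq_mul]
      field_simp
    rw [h3]
    simp only [hs, hκ]
    field_simp
    ring
  have hgpos : ∀ x, 0 < 1 + g x / η := fun x =>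
    add_pos_of_pos_of_nonneg one_pos (div_nonneg (hg x).1 hη.le)
  have hmean0 : ∀ (p : ℕ) (x : Fin p → 𝓧), 0 ≤ sampleMean g x := fun p x =>
    div_nonneg (Finset.sum_nonneg fun i _ => (hg _).1) p.cast_nonneg
  have hlim := (tendsto_integral_one_sub_rpow (F := F) hα (by fun_prop) hf01 hs0 hs1).const_mul
    (κ ^ α)
  have hval : κ ^ α * Real.exp (-(α * ∫ x, Real.log (1 - s * f x) ∂F)) =
      Real.exp (-(α * ∫ x, Real.log (1 + g x / η) ∂F)) := by
    simp_rw [h1]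
    have : ∀ x, Real.log (κ * (1 + g x / η)) = Real.log κ + Real.log (1 + g x / η) := fun x =>
      Real.log_mul hκ0.ne' (hgpos x).ne'
    simp_rw [this]
    rw [integral_add (integrable_const _)]
    · rw [integral_const, probReal_univ, one_smul, Real.rpow_def_of_pos hκ0, ← Real.exp_add]
      congr 1
      ring
    · have hm : Measurable fun x => Real.log (1 + g x / η) := by fun_prop
      refine Integrable.of_bound hm.aestronglyMeasurable (Real.log (1 + C / η)) (ae_of_all _ fun x => ?_)
      rw [Real.norm_of_nonneg (Real.log_nonneg (by
        linarith [div_nonneg (hg x).1 hη.le]))]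
      refine Real.log_le_log (hgpos x) ?_
      have := hgC x
      gcongr
  rw [hval] at hlim
  refine hlim.congr' ?_
  filter_upwards [eventually_gt_atTop 0] with p hp
  rw [← integral_const_mul]
  refine integral_congr_ae (ae_of_all _ fun x => ?_)
  simp only [h2 p hp]
  rw [Real.mul_rpow hκ0.le (by
    have := div_nonneg (hmean0 p x) hη.le
    linarith), ← mul_assoc, ← Real.rpow_add hκ0]
  simp

end UrnMeans

/-! ### A Pólya urn sequence has the law `urnLaw` -/

section UrnIdentification

variable {𝓧 : Type u} [MeasurableSpace 𝓧] {α : ℝ} {F : Measure 𝓧} [IsProbabilityMeasure F]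
  {Ω : Type v} [MeasurableSpace Ω] {P : Measure Ω} [IsProbabilityMeasure P] {p : ℕ}
  {X : Fin p → Ω → 𝓧}

lemma urnMeasure_real_apply (hα : 0 < α) (x : Fin p → 𝓧) (k : Fin p) {A : Set 𝓧}
    (hA : MeasurableSet A) :
    (urnMeasure α F x k).real A =
      α * F.real A + ∑ i ∈ Finset.Iio k, A.indicator (fun _ => (1 : ℝ)) (x i) := by
  have h1 : (ENNReal.ofReal α • F) A ≠ ∞ := by
    rw [Measure.smul_apply, smul_eq_mul]
    finiteness
  have h2 : (∑ i ∈ Finset.Iio k, Measure.dirac (x i)) A ≠ ∞ := by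
    rw [Measure.finsetSum_apply]
    exact ENNReal.sum_ne_top.2 fun i _ => measure_ne_top _ _
  rw [urnMeasure, measureReal_add_apply h1 h2, measureReal_ennreal_smul_apply,
    ENNReal.toReal_ofReal hα.le]
  congr 1
  rw [measureReal_def, Measure.finsetSum_apply, ENNReal.toReal_sum]
  · refine Finset.sum_congr rfl fun i _ => ?_
    rw [Measure.dirac_apply' _ hA]
    by_cases h : x i ∈ A <;> simp [h]
  · intro i _
    finiteness

lemma sum_Iio_eq_sum_castLE {k : ℕ} (hk : k < p) (φ : Fin p → ℝ) :
    ∑ i ∈ Finset.Iio (⟨k, hk⟩ : Fin p), φ i = ∑ j : Fin k, φ (Fin.castLE hk.le j) := by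
  symm
  refine Finset.sum_bij (fun j _ => Fin.castLE hk.le j) ?_ ?_ ?_ ?_
  · intro j _
    simp [Fin.lt_def]
  · intro a _ b _ h
    exact Fin.castLE_injective _ h
  · intro i hi
    rw [Finset.mem_Iio, Fin.lt_def] at hi
    exact ⟨⟨i, hi⟩, Finset.mem_univ _, rfl⟩
  · intro _ _
    rfl

/-- The σ-algebra generated by the points before time `k`. -/
abbrev urnPast (X : Fin p → Ω → 𝓧) (k : Fin p) : MeasurableSpace Ω :=
  ⨆ i : Set.Iio k, MeasurableSpace.comap (X i) inferInstance

/-- Integrate the conditional probability over the event that the prefix lies in `B`, which belongs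
to the past; the normalizing mass is the constant `α + k`. -/
lemma IsPolyaUrn.measureReal_inter (hX : IsPolyaUrn X α F P) (hα : 0 < α) {k : ℕ} (hk : k < p)
    {B : Set (Fin k → 𝓧)} (hB : MeasurableSet B) {A : Set 𝓧} (hA : MeasurableSet A) :
    (α + k) * P.real ((fun ω (j : Fin k) => X (Fin.castLE hk.le j) ω) ⁻¹' B ∩ X ⟨k, hk⟩ ⁻¹' A) =
      α * (P.real ((fun ω (j : Fin k) => X (Fin.castLE hk.le j) ω) ⁻¹' B) * F.real A) +
      ∑ i : Fin k, P.real ((fun ω (j : Fin k) => X (Fin.castLE hk.le j) ω) ⁻¹' B ∩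
        X (Fin.castLE hk.le i) ⁻¹' A) := by
  set Y : Ω → Fin k → 𝓧 := fun ω j => X (Fin.castLE hk.le j) ω with hY
  have hYm : Measurable Y := measurable_pi_iff.2 fun j => hX.measurable _
  have hmle : urnPast X ⟨k, hk⟩ ≤ ‹MeasurableSpace Ω› :=
    iSup_le fun i => (hX.measurable i).comap_le
  have hYB : MeasurableSet[urnPast X ⟨k, hk⟩] (Y ⁻¹' B) := by
    have hYm' : Measurable[urnPast X ⟨k, hk⟩] Y := by
      refine @measurable_pi_lambda _ _ _ (urnPast X ⟨k, hk⟩) _ _ fun j => ?_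
      have h1 : MeasurableSpace.comap (X (Fin.castLE hk.le j)) inferInstance ≤ urnPast X ⟨k, hk⟩ :=
        le_iSup (fun i : Set.Iio (⟨k, hk⟩ : Fin p) => MeasurableSpace.comap (X i) inferInstance)
          ⟨Fin.castLE hk.le j, by simp [Fin.lt_def]⟩
      exact fun s hs => h1 _ ⟨s, hs, rfl⟩
    exact hYm' hB
  have hpos : 0 < α + k := by positivity
  have hint : Integrable ((X ⟨k, hk⟩ ⁻¹' A).indicator fun _ => (1 : ℝ)) P :=
    (integrable_const 1).indicator (hX.measurable _ hA)
  have h1 := setIntegral_condExp hmle hint hYB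
  rw [setIntegral_indicator (hX.measurable _ hA), setIntegral_const, smul_eq_mul, mul_one] at h1
  rw [← h1, setIntegral_congr_ae (hmle _ hYB)
    ((hX.condProb ⟨k, hk⟩ A hA).mono fun ω hω _ => hω)]
  simp_rw [urnMeasure_real_apply hα _ _ hA, urnMeasure_real_apply hα _ _ MeasurableSet.univ]
  simp only [Set.indicator_univ, Finset.sum_const, probReal_univ, mul_one, Finset.card_univ,
    Fintype.card_fin, nsmul_eq_mul, sum_Iio_eq_sum_castLE hk]
  rw [integral_div, mul_div_cancel₀ _ hpos.ne', integral_add (integrable_const _),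
    integral_finsetSum]
  · rw [setIntegral_const, smul_eq_mul]
    congr 1
    · ring
    · refine Finset.sum_congr rfl fun i _ => ?_
      change ∫ ω in Y ⁻¹' B, (X (Fin.castLE hk.le i) ⁻¹' A).indicator (fun _ => (1 : ℝ)) ω ∂P = _
      rw [setIntegral_indicator (hX.measurable _ hA), setIntegral_const, smul_eq_mul, mul_one]
  · intro i _
    exact ((integrable_const (1 : ℝ)).indicator (hX.measurable (Fin.castLE hk.le i) hA)).integrableOn
  · exact integrable_finsetSum _ fun i _ =>
      ((integrable_const (1 : ℝ)).indicator (hX.measurable (Fin.castLE hk.le i) hA)).integrableOn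

lemma IsPolyaUrn.map_prefix_eq (hX : IsPolyaUrn X α F P) (hα : 0 < α) {k : ℕ} (hk : k ≤ p) :
    P.map (fun ω (j : Fin k) => X (Fin.castLE hk j) ω) = urnLaw α F k := by
  induction k with
  | zero =>
    rw [urnLaw]
    have : (fun ω (j : Fin 0) => X (Fin.castLE hk j) ω) = fun _ => fun i => i.elim0 := by
      ext ω j
      exact j.elim0
    rw [this, Measure.map_const, measure_univ, one_smul]
  | succ k ih =>
    have hk' : k < p := hk
    have ih := ih hk'.le
    have hpr := isProbabilityMeasure_urnLaw (F := F) hα k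
    set Y : Ω → Fin k → 𝓧 := fun ω j => X (Fin.castLE hk'.le j) ω with hY
    have hYm : Measurable Y := measurable_pi_iff.2 fun j => hX.measurable _
    have hZm := hX.measurable ⟨k, hk'⟩
    have hpos : 0 < α + k := by positivity
    -- Finite measures on a product are determined by rectangles, where the conditional rule was
    -- just integrated.
    have hjoint : P.map (fun ω => (Y ω, X ⟨k, hk'⟩ ω)) = (ENNReal.ofReal (α + k))⁻¹ •
        (ENNReal.ofReal α • (urnLaw α F k).prod F +
          ∑ i, (urnLaw α F k).map (fun x => (x, x i))) := by
      have hf1 : ∀ i, IsFiniteMeasure ((urnLaw α F k).map (fun x => (x, x i))) :=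
        fun i => Measure.isFiniteMeasure_map _ _
      have hf2 : IsFiniteMeasure (P.map (fun ω => (Y ω, X ⟨k, hk'⟩ ω))) :=
        Measure.isFiniteMeasure_map _ _
      refine Measure.ext_prod fun {B A} hB hA => ?_
      have h1 := hX.measureReal_inter hα hk' hB hA
      have hleft : (P.map (fun ω => (Y ω, X ⟨k, hk'⟩ ω))) (B ×ˢ A) =
          P (Y ⁻¹' B ∩ X ⟨k, hk'⟩ ⁻¹' A) := Measure.map_apply (hYm.prodMk hZm) (hB.prod hA)
      have hB' : urnLaw α F k B = P (Y ⁻¹' B) := by rw [← ih, Measure.map_apply hYm hB]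
      have hi : ∀ i, (urnLaw α F k).map (fun x => (x, x i)) (B ×ˢ A) =
          P (Y ⁻¹' B ∩ X (Fin.castLE hk'.le i) ⁻¹' A) := by
        intro i
        have hm : Measurable fun x : Fin k → 𝓧 => (x, x i) := by fun_prop
        rw [← ih, Measure.map_map hm hYm, Measure.map_apply (hm.comp hYm) (hB.prod hA)]
        rfl
      rw [hleft, Measure.smul_apply, Measure.add_apply, Measure.smul_apply, Measure.prod_prod,
        Measure.finsetSum_apply, hB', smul_eq_mul, smul_eq_mul]
      simp_rw [hi]
      have h2 : ENNReal.ofReal (α + k) * P (Y ⁻¹' B ∩ X ⟨k, hk'⟩ ⁻¹' A) =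
          ENNReal.ofReal α * (P (Y ⁻¹' B) * F A) +
          ∑ i : Fin k, P (Y ⁻¹' B ∩ X (Fin.castLE hk'.le i) ⁻¹' A) := by
        have hs : ∑ i : Fin k, P (Y ⁻¹' B ∩ X (Fin.castLE hk'.le i) ⁻¹' A) ≠ ∞ :=
          ENNReal.sum_ne_top.2 fun i _ => measure_ne_top _ _
        have hs' : ENNReal.ofReal α * (P (Y ⁻¹' B) * F A) ≠ ∞ := by finiteness
        rw [← ENNReal.toReal_eq_toReal_iff' (by finiteness) (ENNReal.add_ne_top.2 ⟨hs', hs⟩),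
          ENNReal.toReal_mul, ENNReal.toReal_add hs' hs, ENNReal.toReal_mul,
          ENNReal.toReal_mul, ENNReal.toReal_ofReal hpos.le, ENNReal.toReal_ofReal hα.le,
          ENNReal.toReal_sum fun i _ => by finiteness]
        exact h1
      rw [← h2, ← mul_assoc, ENNReal.inv_mul_cancel (by simpa using hpos) (by finiteness), one_mul]
    have hcomp : (fun ω (j : Fin (k + 1)) => X (Fin.castLE hk j) ω) =
        (fun q : (Fin k → 𝓧) × 𝓧 => snocPoint q.1 q.2) ∘ fun ω => (Y ω, X ⟨k, hk'⟩ ω) := by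
      ext ω j
      refine Fin.lastCases ?_ (fun j => ?_) j
      · simp only [Function.comp_apply, snocPoint_last]
        rfl
      · simp only [Function.comp_apply, snocPoint_castSucc]
        rfl
    rw [hcomp, ← Measure.map_map measurable_snocPoint (hYm.prodMk hZm), hjoint, Measure.map_smul,
      Measure.map_add _ _ measurable_snocPoint, Measure.map_smul, urnLaw,
      ← Measure.mapₗ_apply_of_measurable measurable_snocPoint (∑ i, _), map_sum]
    simp_rw [Measure.mapₗ_apply_of_measurable measurable_snocPoint]
    congr 3 with i
    rw [Measure.map_map measurable_snocPoint (by fun_prop)]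
    rfl

/-- The law of a Pólya urn sequence is `urnLaw`. -/
theorem IsPolyaUrn.map_eq (hX : IsPolyaUrn X α F P) (hα : 0 < α) :
    P.map (fun ω i => X i ω) = urnLaw α F p :=
  hX.map_prefix_eq hα le_rfl

end UrnIdentification

/-! ### Moments of the symmetric Gamma distribution -/

section SymmetricGammaMoments

variable {Ω : Type v} [MeasurableSpace Ω] {P : Measure Ω} [IsProbabilityMeasure P] {Z : Ω → ℝ}

lemma HasSymmetricGammaLaw.map_neg_eq {a b : ℝ} (hZ : HasSymmetricGammaLaw Z a b P) :
    P.map (fun ω => -Z ω) = P.map Z := by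
  have := Measure.isProbabilityMeasure_map hZ.aemeasurable
  have hneg : P.map (fun ω => -Z ω) = (P.map Z).map (fun x => -x) :=
    (AEMeasurable.map_map_of_aemeasurable measurable_neg.aemeasurable hZ.aemeasurable).symm
  have := Measure.isProbabilityMeasure_map (μ := P.map Z) measurable_neg.aemeasurable
  rw [hneg]
  refine Measure.ext_of_charFun (funext fun t => ?_)
  have h1 := charFun_map_mul (μ := P.map Z) (-1) t
  have h2 : (fun x : ℝ => -1 * x) = fun x => -x := by ext x; ring
  rw [h2] at h1
  rw [h1, hZ.charFun_eq, hZ.charFun_eq]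
  simp

lemma HasSymmetricGammaLaw.integral_eq_zero {a b : ℝ} (hZ : HasSymmetricGammaLaw Z a b P) :
    ∫ ω, Z ω ∂P = 0 := by
  have h1 : ∫ x, x ∂(P.map fun ω => -Z ω) = ∫ ω, -Z ω ∂P :=
    integral_map hZ.aemeasurable.neg aestronglyMeasurable_id
  have h2 : ∫ x, x ∂(P.map Z) = ∫ ω, Z ω ∂P := integral_map hZ.aemeasurable aestronglyMeasurable_id
  rw [hZ.map_neg_eq, h2, integral_neg] at h1
  linarith

lemma HasSymmetricGammaLaw.integral_cos (hZ : HasSymmetricGammaLaw Z 1 1 P) (t : ℝ) :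
    ∫ x, Real.cos (t * x) ∂(P.map Z) = 1 / (1 + t ^ 2) := by
  have := Measure.isProbabilityMeasure_map hZ.aemeasurable
  have h := hZ.charFun_eq t
  rw [charFun_apply_real] at h
  have h1 := congrArg Complex.re h
  rw [Complex.ofReal_re] at h1
  have hint : Integrable (fun x : ℝ => Complex.exp (t * x * Complex.I)) (P.map Z) := by
    refine Integrable.of_bound (by fun_prop) 1 (ae_of_all _ fun x => ?_)
    rw [← Complex.ofReal_mul, Complex.norm_exp_ofReal_mul_I]
  have h2 := integral_re hint
  simp only [RCLike.re_to_complex] at h2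
  rw [← h2] at h1
  have h3 : ∀ x : ℝ, (Complex.exp (t * x * Complex.I)).re = Real.cos (t * x) := fun x => by
    rw [← Complex.ofReal_mul, Complex.exp_ofReal_mul_I_re]
  simp_rw [h3] at h1
  rw [h1, Real.rpow_neg_one]
  simp

/-- Fatou's lemma for `2 (1 - cos (t x)) / t² → x²` as `t → 0`: by the characteristic function the
left side has integral `2 / (1 + t²) ≤ 2`. No density is needed. -/
lemma HasSymmetricGammaLaw.lintegral_sq_le (hZ : HasSymmetricGammaLaw Z 1 1 P) :
    ∫⁻ x, ENNReal.ofReal (x ^ 2) ∂(P.map Z) ≤ 2 := by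
  have := Measure.isProbabilityMeasure_map hZ.aemeasurable
  set t : ℕ → ℝ := fun n => 1 / ((n : ℝ) + 1) with ht
  have ht0 : ∀ n, 0 < t n := fun n => by positivity
  have htlim : Tendsto t atTop (𝓝[≠] 0) :=
    tendsto_nhdsWithin_iff.2 ⟨tendsto_one_div_add_atTop_nhds_zero_nat,
      Eventually.of_forall fun n => (ht0 n).ne'⟩
  have hlim : ∀ x : ℝ, Tendsto (fun n => 2 * (1 - Real.cos (t n * x)) / t n ^ 2) atTop
      (𝓝 (x ^ 2)) := by
    intro x
    -- By the half-angle formula the quotient is the square of the slope at 0 of `u ↦ 2 sin (u x /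
    -- 2)`.
    have hd : HasDerivAt (fun u : ℝ => 2 * Real.sin (u * x / 2)) x 0 := by
      have h1 : HasDerivAt (fun u : ℝ => u * x / 2) (x / 2) 0 := by
        simpa using ((hasDerivAt_id (0 : ℝ)).mul_const x).div_const 2
      have h2 := (h1.sin).const_mul 2
      convert! h2 using 1
      simp
      ring
    have h3 := (hd.tendsto_slope_zero.comp htlim).pow 2
    refine h3.congr fun n => ?_
    have h4 : Real.cos (t n * x) = 1 - 2 * Real.sin (t n * x / 2) ^ 2 := by
      have h5 := Real.cos_two_mul (t n * x / 2)
      have h6 := Real.sin_sq (t n * x / 2)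
      rw [show 2 * (t n * x / 2) = t n * x by ring] at h5
      linarith
    simp only [Function.comp_apply, zero_add, zero_mul, zero_div, Real.sin_zero, mul_zero,
      sub_zero, smul_eq_mul]
    rw [h4]
    have := (ht0 n).ne'
    field_simp
    ring
  calc ∫⁻ x, ENNReal.ofReal (x ^ 2) ∂(P.map Z)
      = ∫⁻ x, liminf (fun n => ENNReal.ofReal (2 * (1 - Real.cos (t n * x)) / t n ^ 2)) atTop
          ∂(P.map Z) := by
        refine lintegral_congr fun x => ?_
        exact ((ENNReal.tendsto_ofReal (hlim x)).liminf_eq).symm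
    _ ≤ liminf (fun n => ∫⁻ x, ENNReal.ofReal (2 * (1 - Real.cos (t n * x)) / t n ^ 2)
          ∂(P.map Z)) atTop := lintegral_liminf_le fun n => by fun_prop
    _ ≤ liminf (fun _ : ℕ => (2 : ℝ≥0∞)) atTop := by
        refine liminf_le_liminf (Eventually.of_forall fun n => ?_)
        have hcos : Integrable (fun x => Real.cos (t n * x)) (P.map Z) :=
          Integrable.of_bound (by fun_prop) 1 (ae_of_all _ fun x => Real.abs_cos_le_one _)
        rw [← ofReal_integral_eq_lintegral_ofReal]
        · rw [integral_div, integral_const_mul, integral_sub (integrable_const _) hcos,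
            hZ.integral_cos, integral_const, probReal_univ, one_smul,
            show (2 : ℝ≥0∞) = ENNReal.ofReal 2 by simp]
          refine ENNReal.ofReal_le_ofReal ?_
          have h1 : (0 : ℝ) < 1 + t n ^ 2 := by positivity
          rw [div_le_iff₀ (pow_pos (ht0 n) 2)]
          have : 1 - 1 / (1 + t n ^ 2) = t n ^ 2 / (1 + t n ^ 2) := by
            field_simp
            ring
          rw [this]
          have : t n ^ 2 / (1 + t n ^ 2) ≤ t n ^ 2 :=
            div_le_self (by positivity) (by nlinarith [sq_nonneg (t n)])
          linarith
        · exact (((integrable_const (1 : ℝ)).sub hcos).const_mul 2).div_const _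
        · refine ae_of_all _ fun x => ?_
          have := Real.cos_le_one (t n * x)
          exact div_nonneg (by linarith) (by positivity)
    _ = 2 := liminf_const _

lemma HasSymmetricGammaLaw.memLp_two (hZ : HasSymmetricGammaLaw Z 1 1 P) : MemLp Z 2 P := by
  refine (memLp_two_iff_integrable_sq hZ.aemeasurable.aestronglyMeasurable).2
    ⟨(hZ.aemeasurable.pow_const 2).aestronglyMeasurable, ?_⟩
  rw [hasFiniteIntegral_iff_ofReal (ae_of_all _ fun ω => sq_nonneg _)]
  have h := hZ.lintegral_sq_le
  rw [lintegral_map' (by fun_prop) hZ.aemeasurable] at h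
  exact h.trans_lt (by simp)

lemma HasSymmetricGammaLaw.integral_sq_le (hZ : HasSymmetricGammaLaw Z 1 1 P) :
    ∫ ω, Z ω ^ 2 ∂P ≤ 2 := by
  rw [integral_eq_lintegral_of_nonneg_ae (ae_of_all _ fun ω => sq_nonneg _)
    (hZ.aemeasurable.pow_const 2).aestronglyMeasurable]
  have h := hZ.lintegral_sq_le
  rw [lintegral_map' (by fun_prop) hZ.aemeasurable] at h
  exact ENNReal.toReal_le_of_le_ofReal (by norm_num) (by simpa using h)

lemma integral_abs_sum_le {ι : Type*} [Fintype ι] {J : ι → Ω → ℝ}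
    (hJ : ∀ i, HasSymmetricGammaLaw (J i) 1 1 P) (hind : iIndepFun J P) (s : Finset ι) :
    ∫ ω, |∑ i ∈ s, J i ω| ∂P ≤ √(2 * s.card) := by
  have hmem : MemLp (fun ω => ∑ i ∈ s, J i ω) 2 P := memLp_finsetSum _ fun i _ => (hJ i).memLp_two
  have hvar : Var[fun ω => ∑ i ∈ s, J i ω; P] ≤ 2 * s.card := by
    have h1 := IndepFun.variance_sum (μ := P) (X := J) (s := s) (fun i _ => (hJ i).memLp_two)
      (fun i _ j _ hij => hind.indepFun hij)
    have h2 : (∑ i ∈ s, J i) = fun ω => ∑ i ∈ s, J i ω := by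
      ext ω
      simp
    rw [h2] at h1
    rw [h1]
    calc ∑ i ∈ s, Var[J i; P] ≤ ∑ _i ∈ s, (2 : ℝ) := by
          refine Finset.sum_le_sum fun i _ => ?_
          rw [variance_eq_sub (hJ i).memLp_two, (hJ i).integral_eq_zero]
          simpa using (hJ i).integral_sq_le
      _ = _ := by simp [mul_comm]
  have hmean : ∫ ω, ∑ i ∈ s, J i ω ∂P = 0 := by
    rw [integral_finsetSum _ fun i _ => (hJ i).memLp_two.integrable (by norm_num)]
    exact Finset.sum_eq_zero fun i _ => (hJ i).integral_eq_zero
  have hsq : ∫ ω, (∑ i ∈ s, J i ω) ^ 2 ∂P ≤ 2 * s.card := by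
    rw [variance_eq_sub hmem, hmean] at hvar
    simpa using hvar
  have habs : MemLp (fun ω => |∑ i ∈ s, J i ω|) 2 P := hmem.norm
  -- Nonnegativity of the variance of `|S|` is Cauchy–Schwarz, `(E |S|)² ≤ E S²`.
  have h3 := variance_nonneg (fun ω => |∑ i ∈ s, J i ω|) P
  rw [variance_eq_sub habs] at h3
  simp only [Pi.pow_apply, sq_abs] at h3
  exact Real.le_sqrt_of_sq_le (by linarith)

end SymmetricGammaMoments

/-! ### Multiplicities in the Pólya urn -/

section Multiplicity

variable {𝓧 : Type u}

open scoped Classical in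
/-- The number of indices `j` with `x j = z`. -/
noncomputable def multiplicityAt {k : ℕ} (x : Fin k → 𝓧) (z : 𝓧) : ℕ := ∑ j, if x j = z then 1 else 0

/-- The sum of the inverse square roots of the multiplicities of the points of `x`. -/
noncomputable def invSqrtMultiplicity {k : ℕ} (x : Fin k → 𝓧) : ℝ :=
  ∑ i, 1 / √(multiplicityAt x (x i))

lemma multiplicityAt_pos {k : ℕ} (x : Fin k → 𝓧) (i : Fin k) : 0 < multiplicityAt x (x i) := by
  classical
  unfold multiplicityAt
  refine Finset.sum_pos' (fun j _ => Nat.zero_le _) ⟨i, Finset.mem_univ _, by simp⟩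

open scoped Classical in
lemma multiplicityAt_snocPoint {k : ℕ} (x : Fin k → 𝓧) (z y : 𝓧) :
    multiplicityAt (snocPoint x z) y = multiplicityAt x y + if z = y then 1 else 0 := by
  unfold multiplicityAt
  rw [Fin.sum_univ_castSucc]
  simp_rw [snocPoint_castSucc, snocPoint_last]

/-- A point of multiplicity `m` is counted `m` times with weight `1 / √m`, so the quantity is the
sum of `√m` over distinct points; adding `z` changes only the term of `z`. For `m = 0` the
convention `1 / √0 = 0` fits. -/
lemma invSqrtMultiplicity_snocPoint {k : ℕ} (x : Fin k → 𝓧) (z : 𝓧) :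
    invSqrtMultiplicity (snocPoint x z) = invSqrtMultiplicity x +
      (√(multiplicityAt x z + 1) - √(multiplicityAt x z)) := by
  classical
  set m : ℕ := multiplicityAt x z with hm
  have h1 : ∀ i, 1 / √(multiplicityAt (snocPoint x z) (x i) : ℝ) =
      1 / √(multiplicityAt x (x i)) + (if x i = z then 1 else 0) * (1 / √(m + 1) - 1 / √m) := by
    intro i
    rw [multiplicityAt_snocPoint]
    by_cases h : x i = z
    · simp [h, hm]
    · have h' : z ≠ x i := fun e => h e.symm
      simp [h, h']
  have h2 : ∑ i, (if x i = z then (1 : ℝ) else 0) = m := by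
    rw [hm, multiplicityAt]
    push_cast
    rfl
  rw [invSqrtMultiplicity, Fin.sum_univ_castSucc]
  simp_rw [snocPoint_castSucc, snocPoint_last, h1]
  rw [Finset.sum_add_distrib, ← Finset.sum_mul, h2, multiplicityAt_snocPoint, ← hm,
    ← invSqrtMultiplicity]
  have h3 : (m : ℝ) * (1 / √m) = √m := by rw [mul_one_div, Real.div_sqrt]
  have h4 : ((m : ℝ) + 1) * (1 / √(m + 1)) = √(m + 1) := by rw [mul_one_div, Real.div_sqrt]
  simp only [if_true, Nat.cast_add, Nat.cast_one]
  linear_combination h4 - h3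

lemma sqrt_add_one_sub_sqrt_le_one {m : ℝ} (hm : 0 ≤ m) : √(m + 1) - √m ≤ 1 := by
  have := Real.sqrt_nonneg m
  have h : √(m + 1) ≤ √m + 1 := by
    refine Real.sqrt_le_iff.2 ⟨by positivity, ?_⟩
    nlinarith [Real.sq_sqrt hm]
  linarith

lemma sqrt_add_one_sub_sqrt_le {m : ℝ} (hm : 0 < m) : √(m + 1) - √m ≤ 1 / √m / 2 := by
  have h0 := Real.sqrt_pos.2 hm
  have h : √(m + 1) ≤ √m + 1 / √m / 2 := by
    refine Real.sqrt_le_iff.2 ⟨by positivity, ?_⟩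
    have h1 : (√m + 1 / √m / 2) ^ 2 = √m ^ 2 + 1 + (1 / √m / 2) ^ 2 := by
      field_simp
      ring
    rw [h1, Real.sq_sqrt hm.le]
    nlinarith [sq_nonneg (1 / √m / 2)]
  linarith

lemma invSqrtMultiplicity_nonneg {k : ℕ} (x : Fin k → 𝓧) : 0 ≤ invSqrtMultiplicity x :=
  Finset.sum_nonneg fun _ _ => by positivity

lemma invSqrtMultiplicity_le {k : ℕ} (x : Fin k → 𝓧) : invSqrtMultiplicity x ≤ k := by
  calc invSqrtMultiplicity x ≤ ∑ _i : Fin k, (1 : ℝ) := by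
        refine Finset.sum_le_sum fun i _ => ?_
        have h : (1 : ℝ) ≤ √(multiplicityAt x (x i)) :=
          Real.one_le_sqrt.2 (by exact_mod_cast multiplicityAt_pos x i)
        rw [div_le_one (by linarith)]
        exact h
    _ = k := by simp

lemma abs_invSqrtMultiplicity_le {k : ℕ} (x : Fin k → 𝓧) : |invSqrtMultiplicity x| ≤ k := by
  rw [abs_of_nonneg (invSqrtMultiplicity_nonneg x)]
  exact invSqrtMultiplicity_le x

variable [MeasurableSpace 𝓧] [MeasurableEq 𝓧]

lemma measurable_multiplicityAt {k : ℕ} {Ω : Type*} [MeasurableSpace Ω] {x : Ω → Fin k → 𝓧}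
    {z : Ω → 𝓧} (hx : Measurable x) (hz : Measurable z) :
    Measurable fun ω => multiplicityAt (x ω) (z ω) := by
  classical
  unfold multiplicityAt
  refine Finset.measurable_sum _ fun j _ => ?_
  exact Measurable.ite (measurableSet_eq_fun (by fun_prop) hz) measurable_const measurable_const

lemma measurable_invSqrtMultiplicity {k : ℕ} :
    Measurable fun x : Fin k → 𝓧 => invSqrtMultiplicity x := by
  unfold invSqrtMultiplicity
  refine Finset.measurable_fun_sum _ fun i _ => ?_
  have := measurable_multiplicityAt (k := k) (measurable_id) (measurable_pi_apply (X := fun _ => 𝓧) i)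
  have h2 : Measurable fun x : Fin k → 𝓧 => (multiplicityAt x (x i) : ℝ) :=
    measurable_from_nat.comp this
  fun_prop

variable {α : ℝ} {F : Measure 𝓧} [IsProbabilityMeasure F]

lemma integrable_invSqrtMultiplicity (hα : 0 < α) (k : ℕ) :
    Integrable (fun x => invSqrtMultiplicity x) (urnLaw α F k) := by
  have := isProbabilityMeasure_urnLaw (F := F) hα k
  exact Integrable.of_bound measurable_invSqrtMultiplicity.aestronglyMeasurable k
    (ae_of_all _ abs_invSqrtMultiplicity_le)

/-- A fresh draw adds at most 1. Copying point `i` of multiplicity `m` adds at most `1 / (2 √m)`,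
and these increments sum to half of the current value. -/
lemma integral_invSqrtMultiplicity_succ_le (hα : 0 < α) (k : ℕ) :
    (α + k) * ∫ x, invSqrtMultiplicity x ∂urnLaw α F (k + 1) ≤
      (α + k) * ∫ x, invSqrtMultiplicity x ∂urnLaw α F k + α +
        (∫ x, invSqrtMultiplicity x ∂urnLaw α F k) / 2 := by
  have := isProbabilityMeasure_urnLaw (F := F) hα k
  have hint := integrable_invSqrtMultiplicity (F := F) hα k
  have hbd : ∀ g : (Fin k → 𝓧) → 𝓧, Measurable g →
      Integrable (fun x => invSqrtMultiplicity (snocPoint x (g x))) (urnLaw α F k) := fun g hg =>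
    Integrable.of_bound (measurable_invSqrtMultiplicity.comp
      (measurable_id.snocPoint hg)).aestronglyMeasurable _
      (ae_of_all _ fun x => abs_invSqrtMultiplicity_le _)
  have hmeas : Measurable fun q : (Fin k → 𝓧) × 𝓧 => invSqrtMultiplicity (snocPoint q.1 q.2) :=
    measurable_invSqrtMultiplicity.comp measurable_snocPoint
  rw [integral_urnLaw_succ hα k measurable_invSqrtMultiplicity abs_invSqrtMultiplicity_le]
  have h1 : ∫ x, ∫ z, invSqrtMultiplicity (snocPoint x z) ∂F ∂urnLaw α F k ≤
      ∫ x, (invSqrtMultiplicity x + 1) ∂urnLaw α F k := by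
    refine integral_mono_of_nonneg (ae_of_all _ fun x =>
      integral_nonneg fun z => invSqrtMultiplicity_nonneg _) (hint.add (integrable_const _))
      (ae_of_all _ fun x => ?_)
    have h : ∫ z, invSqrtMultiplicity (snocPoint x z) ∂F ≤
        ∫ _z, (invSqrtMultiplicity x + 1) ∂F := by
      refine integral_mono_of_nonneg (ae_of_all _ fun z => invSqrtMultiplicity_nonneg _)
        (integrable_const _) (ae_of_all _ fun z => ?_)
      dsimp only
      rw [invSqrtMultiplicity_snocPoint]
      linarith [sqrt_add_one_sub_sqrt_le_one (m := (multiplicityAt x z : ℝ)) (by positivity)]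
    simpa using h
  have h2 : ∑ i, ∫ x, invSqrtMultiplicity (snocPoint x (x i)) ∂urnLaw α F k ≤
      ∫ x, (k * invSqrtMultiplicity x + invSqrtMultiplicity x / 2) ∂urnLaw α F k := by
    rw [← integral_finsetSum _ fun i _ => hbd _ (measurable_pi_apply i)]
    refine integral_mono (integrable_finsetSum _ fun i _ => hbd _ (measurable_pi_apply i))
      ((hint.const_mul _).add (hint.div_const _)) fun x => ?_
    dsimp only
    simp_rw [invSqrtMultiplicity_snocPoint]
    rw [Finset.sum_add_distrib]
    simp only [Finset.sum_const, Finset.card_univ, Fintype.card_fin, nsmul_eq_mul]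
    rw [invSqrtMultiplicity, Finset.sum_div]
    gcongr with i
    exact sqrt_add_one_sub_sqrt_le (by exact_mod_cast multiplicityAt_pos x i)
  rw [integral_add hint (integrable_const _)] at h1
  rw [integral_add (hint.const_mul _) (hint.div_const _), integral_const_mul, integral_div] at h2
  simp only [integral_const, probReal_univ, smul_eq_mul, mul_one] at h1
  nlinarith [mul_le_mul_of_nonneg_left h1 hα.le]

lemma sqrt_add_one_ge {x : ℝ} (hx : 1 ≤ x) :
    √x + 1 / (2 * √x) - 1 / (8 * √x ^ 3) ≤ √(x + 1) := by
  have h0 : 1 ≤ √x := Real.one_le_sqrt.2 hx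
  refine Real.le_sqrt_of_sq_le ?_
  set r := √x
  have hr : x = r ^ 2 := (Real.sq_sqrt (by linarith)).symm
  have hr0 : r ≠ 0 := by positivity
  have h1 : (r + 1 / (2 * r) - 1 / (8 * r ^ 3)) ^ 2 =
      r ^ 2 + 1 - (8 * r ^ 2 - 1) / (64 * r ^ 6) := by
    field_simp
    ring
  rw [h1, hr]
  have h2 : 0 ≤ (8 * r ^ 2 - 1) / (64 * r ^ 6) := by
    apply div_nonneg
    · nlinarith
    · positivity
  linarith

/-- The recursion multiplies the mean by `1 + 1 / (2 (α + k))` and adds `α / (α + k)`, which is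
growth of order `√(α + k)`. The induction carries the extra term `-(8 α + 1)`, whose share in the
growth factor absorbs both the source term and the second-order error of the square root. -/
lemma integral_invSqrtMultiplicity_le (hα : 0 < α) (k : ℕ) :
    ∫ x, invSqrtMultiplicity x ∂urnLaw α F k ≤ (16 * α + 2) * √(α + k) := by
  have key : ∀ k : ℕ, ∫ x, invSqrtMultiplicity x ∂urnLaw α F (k + 1) ≤
      (16 * α + 2) * √(α + (k + 1 : ℕ)) - (8 * α + 1) := by
    intro k
    induction k with
    | zero =>
      have := isProbabilityMeasure_urnLaw (F := F) hα 1
      have h1 : ∫ x, invSqrtMultiplicity x ∂urnLaw α F 1 ≤ ∫ _x, (1 : ℝ) ∂urnLaw α F 1 :=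
        integral_mono (integrable_invSqrtMultiplicity hα 1) (integrable_const _) fun x => by
          simpa using invSqrtMultiplicity_le x
      have h2 : (1 : ℝ) ≤ √(α + (0 + 1 : ℕ)) := Real.one_le_sqrt.2 (by push_cast; linarith)
      simp only [integral_const, probReal_univ, smul_eq_mul, mul_one] at h1
      simp only [zero_add] at h2 ⊢
      nlinarith
    | succ k ih =>
      have h := integral_invSqrtMultiplicity_succ_le (F := F) hα (k + 1)
      set x : ℝ := α + (k + 1 : ℕ) with hx
      have hx1 : 1 ≤ x := by rw [hx]; push_cast; linarith [k.cast_nonneg (α := ℝ)]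
      have h1 := sqrt_add_one_ge hx1
      have hr1 : 1 ≤ √x := Real.one_le_sqrt.2 hx1
      have hxr : x = √x ^ 2 := (Real.sq_sqrt (by linarith)).symm
      have hx2 : α + ((k + 1 + 1 : ℕ) : ℝ) = x + 1 := by rw [hx]; push_cast; ring
      rw [hx2]
      set r := √x
      set E := ∫ x, invSqrtMultiplicity x ∂urnLaw α F (k + 1)
      set E' := ∫ x, invSqrtMultiplicity x ∂urnLaw α F (k + 1 + 1)
      have hr0 : 0 < r := by linarith
      have h3 : E' ≤ ((16 * α + 2) * r - (8 * α + 1)) * (1 + 1 / (2 * r ^ 2)) + α / r ^ 2 := by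
        have h4 : E' ≤ E * (1 + 1 / (2 * r ^ 2)) + α / r ^ 2 := by
          have h5 : E * (1 + 1 / (2 * r ^ 2)) + α / r ^ 2 = (r ^ 2 * E + α + E / 2) / r ^ 2 := by
            field_simp
            ring
          rw [h5, le_div_iff₀ (by positivity), ← hxr]
          linarith
        have h6 : 0 ≤ 1 + 1 / (2 * r ^ 2) := by positivity
        nlinarith
      refine h3.trans ?_
      have h7 : (16 * α + 2) * (r + 1 / (2 * r) - 1 / (8 * r ^ 3)) ≤ (16 * α + 2) * √(x + 1) := by
        gcongr
      refine le_trans ?_ (sub_le_sub_right h7 _)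
      -- The slack of the induction step, nonnegative because `r ≥ 1`.
      have h8 : (16 * α + 2) * (r + 1 / (2 * r) - 1 / (8 * r ^ 3)) - (8 * α + 1) -
          (((16 * α + 2) * r - (8 * α + 1)) * (1 + 1 / (2 * r ^ 2)) + α / r ^ 2) =
          ((12 * α + 2) * r - (8 * α + 1)) / (4 * r ^ 3) := by
        field_simp
        ring
      have h9 : 0 ≤ ((12 * α + 2) * r - (8 * α + 1)) / (4 * r ^ 3) := by
        apply div_nonneg
        · nlinarith
        · positivity
      linarith
  cases k with
  | zero => simp [invSqrtMultiplicity]; positivity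
  | succ k => exact (key k).trans (by linarith)

end Multiplicity

/-! ### The total variation of a sum of weighted point masses -/

section AtomicTotal

variable {𝓧 : Type u}

open scoped Classical in
/-- The total variation of `∑ j, w j • δ_{x j}`. -/
noncomputable def atomicTotal {k : ℕ} (w : Fin k → ℝ) (x : Fin k → 𝓧) : ℝ :=
  ∑ i, |∑ j, if x j = x i then w j else 0| / multiplicityAt x (x i)

/-- Spread each term evenly over the indices sharing its point; collecting by index then gives the
total weight at each point before absolute values are taken, which keeps the cancellation between
jumps. -/
lemma abs_sum_mul_le_atomicTotal {k : ℕ} (w : Fin k → ℝ) (x : Fin k → 𝓧) {f : 𝓧 → ℝ} {c : ℝ}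
    (hf : ∀ z, |f z| ≤ c) : |∑ j, w j * f (x j)| ≤ c * atomicTotal w x := by
  classical
  have h1 : ∀ j, w j * f (x j) =
      ∑ i, (if x j = x i then w j else 0) * (f (x i) / multiplicityAt x (x i)) := by
    intro j
    have h2 : ∀ i, (if x j = x i then w j else 0) * (f (x i) / multiplicityAt x (x i)) =
        w j * (f (x j) / multiplicityAt x (x j)) * (if x i = x j then 1 else 0) := by
      intro i
      by_cases h : x j = x i
      · simp [h]
      · have h' : x i ≠ x j := fun e => h e.symm
        simp [h, h']
    have h3 : ∑ i, (if x i = x j then (1 : ℝ) else 0) = multiplicityAt x (x j) := by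
      rw [multiplicityAt]
      push_cast
      rfl
    have h4 : (multiplicityAt x (x j) : ℝ) ≠ 0 := by exact_mod_cast (multiplicityAt_pos x j).ne'
    simp_rw [h2]
    rw [← Finset.mul_sum, h3]
    field_simp
  simp_rw [h1]
  rw [Finset.sum_comm, atomicTotal, Finset.mul_sum]
  refine (Finset.abs_sum_le_sum_abs _ _).trans (Finset.sum_le_sum fun i _ => ?_)
  rw [← Finset.sum_mul, abs_mul, abs_div, Nat.abs_cast]
  have := hf (x i)
  rw [mul_div_assoc', mul_div_assoc', mul_comm c]
  gcongr

lemma atomicTotal_nonneg {k : ℕ} (w : Fin k → ℝ) (x : Fin k → 𝓧) : 0 ≤ atomicTotal w x :=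
  Finset.sum_nonneg fun _ _ => by positivity

lemma measurable_atomicTotal [MeasurableSpace 𝓧] [MeasurableEq 𝓧] {k : ℕ} :
    Measurable fun q : (Fin k → ℝ) × (Fin k → 𝓧) => atomicTotal q.1 q.2 := by
  classical
  unfold atomicTotal
  refine Finset.measurable_fun_sum _ fun i _ => ?_
  have h1 : Measurable fun q : (Fin k → ℝ) × (Fin k → 𝓧) => multiplicityAt q.2 (q.2 i) :=
    measurable_multiplicityAt (by fun_prop) (by fun_prop)
  have h2 : Measurable fun q : (Fin k → ℝ) × (Fin k → 𝓧) => (multiplicityAt q.2 (q.2 i) : ℝ) :=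
    measurable_from_nat.comp h1
  refine Measurable.div ?_ h2
  refine Measurable.abs (Finset.measurable_fun_sum _ fun j _ => ?_)
  exact Measurable.ite (measurableSet_eq_fun (by fun_prop) (by fun_prop)) (by fun_prop)
    measurable_const

/-- A group of `m` jumps has mean absolute sum at most `√(2m)`; dividing by `m` leaves `√2 / √m` per
index. -/
lemma integral_atomicTotal_le {Ω : Type v} [MeasurableSpace Ω] {P : Measure Ω}
    [IsProbabilityMeasure P] {k : ℕ} {J : Fin k → Ω → ℝ}
    (hJ : ∀ i, HasSymmetricGammaLaw (J i) 1 1 P) (hind : iIndepFun J P) (x : Fin k → 𝓧) :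
    ∫⁻ ω, ENNReal.ofReal (atomicTotal (fun i => J i ω) x) ∂P ≤
      ENNReal.ofReal (√2 * invSqrtMultiplicity x) := by
  classical
  have hint : ∀ i, Integrable (fun ω => |∑ j, if x j = x i then J j ω else 0| /
      (multiplicityAt x (x i) : ℝ)) P := by
    intro i
    refine Integrable.div_const (Integrable.abs (integrable_finsetSum _ fun j _ => ?_)) _
    split_ifs
    · exact (hJ j).memLp_two.integrable (by norm_num)
    · exact integrable_zero _ _ _
  have hint' : Integrable (fun ω => atomicTotal (fun i => J i ω) x) P :=
    integrable_finsetSum _ fun i _ => hint i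
  rw [← ofReal_integral_eq_lintegral_ofReal hint' (ae_of_all _ fun ω => atomicTotal_nonneg _ _)]
  refine ENNReal.ofReal_le_ofReal ?_
  unfold atomicTotal invSqrtMultiplicity
  rw [integral_finsetSum _ fun i _ => hint i, Finset.mul_sum]
  refine Finset.sum_le_sum fun i _ => ?_
  rw [integral_div]
  have h1 : ∀ ω, (∑ j, if x j = x i then J j ω else 0) =
      ∑ j ∈ Finset.univ.filter (fun j => x j = x i), J j ω := fun ω => by
    rw [Finset.sum_filter]
  have h2 : (Finset.univ.filter (fun j => x j = x i)).card = multiplicityAt x (x i) := by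
    rw [multiplicityAt, Finset.card_filter]
  simp_rw [h1]
  have h3 := integral_abs_sum_le hJ hind (Finset.univ.filter (fun j => x j = x i))
  rw [h2, Real.sqrt_mul (by norm_num)] at h3
  have hm : (0 : ℝ) < multiplicityAt x (x i) := by exact_mod_cast multiplicityAt_pos x i
  rw [div_le_iff₀ hm]
  refine h3.trans (le_of_eq ?_)
  have h4 : (multiplicityAt x (x i) : ℝ) = √(multiplicityAt x (x i)) ^ 2 :=
    (Real.sq_sqrt hm.le).symm
  have h5 := Real.sqrt_pos.2 hm
  conv_rhs => rw [h4, Real.sqrt_sq h5.le]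
  field_simp

end AtomicTotal

/-! ### The Gamma distribution -/

section GammaLaplace

lemma ae_nonneg_gammaMeasure (α η : ℝ) : ∀ᵐ t ∂gammaMeasure α η, 0 ≤ t := by
  have hm : Measurable (gammaPDF α η) := (measurable_gammaPDFReal α η).ennreal_ofReal
  rw [gammaMeasure, ae_withDensity_iff hm]
  refine ae_of_all _ fun t ht => ?_
  by_contra h
  exact ht (gammaPDF_of_neg (not_le.1 h))

lemma integral_exp_neg_mul_gammaMeasure {α η z : ℝ} (hα : 0 < α) (hη : 0 < η) (hz : 0 ≤ z) :
    ∫ t, Real.exp (-(t * z)) ∂gammaMeasure α η = (1 + z / η) ^ (-α) := by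
  have h1 : ∫ t, Real.exp (-(t * z)) ∂gammaMeasure α η =
      ∫ t, gammaPDFReal α η t * Real.exp (-(t * z)) := by
    have hm : Measurable (gammaPDF α η) := (measurable_gammaPDFReal α η).ennreal_ofReal
    rw [gammaMeasure, integral_withDensity_eq_integral_toReal_smul hm
      (ae_of_all _ fun t => ENNReal.ofReal_lt_top)]
    refine integral_congr_ae (ae_of_all _ fun t => ?_)
    simp only [gammaPDF, smul_eq_mul]
    rw [ENNReal.toReal_ofReal (gammaPDFReal_nonneg hα hη t)]
  have h2 : ∫ t, gammaPDFReal α η t * Real.exp (-(t * z)) =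
      ∫ t in Set.Ioi 0, η ^ α / Real.Gamma α *
        (t ^ (α - 1) * Real.exp (-((η + z) * t))) := by
    rw [← integral_Ici_eq_integral_Ioi, ← integral_indicator measurableSet_Ici]
    refine integral_congr_ae (ae_of_all _ fun t => ?_)
    by_cases ht : 0 ≤ t
    · simp only [gammaPDFReal, ht, if_true, Set.indicator_of_mem (Set.mem_Ici.2 ht)]
      rw [show -((η + z) * t) = -(η * t) + -(t * z) by ring, Real.exp_add]
      ring
    · rw [Set.indicator_of_notMem (by simpa using ht)]
      simp [gammaPDFReal, ht]
  have hηz : 0 < η + z := by positivity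
  have hG := (Real.Gamma_pos_of_pos hα).ne'
  rw [h1, h2, integral_const_mul, Real.integral_rpow_mul_exp_neg_mul_Ioi hα hηz,
    show 1 + z / η = (η + z) / η by field_simp, Real.rpow_neg (by positivity),
    Real.div_rpow hηz.le hη.le, Real.div_rpow zero_le_one hηz.le, Real.one_rpow]
  have := (Real.rpow_pos_of_pos hη α).ne'
  have := (Real.rpow_pos_of_pos hηz α).ne'
  field_simp

end GammaLaplace

/-! ### Products and exponentials -/

lemma inv_one_add_sub_exp_neg_mem {a : ℝ} (ha : 0 ≤ a) :
    Real.exp (-a) ≤ (1 + a)⁻¹ ∧ (1 + a)⁻¹ ≤ Real.exp (-a) + a ^ 2 := by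
  constructor
  · rw [Real.exp_neg]
    exact inv_anti₀ (by positivity) (by linarith [Real.add_one_le_exp a])
  · have h1 : 1 - a ≤ Real.exp (-a) := by linarith [Real.add_one_le_exp (-a)]
    have h2 : (1 + a)⁻¹ ≤ 1 - a + a ^ 2 := by
      rw [inv_le_iff_one_le_mul₀ (by positivity)]
      nlinarith [pow_nonneg ha 3]
    linarith

/-- Replacing one factor at a time costs `a i ^ 2` because all factors lie in `[0, 1]`. The cap at 1
later permits dominated convergence in `T` without moment estimates. -/
lemma abs_prod_inv_one_add_sub_exp_le {ι : Type*} (s : Finset ι) {a : ι → ℝ} (ha : ∀ i, 0 ≤ a i) :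
    |∏ i ∈ s, (1 + a i)⁻¹ - Real.exp (-∑ i ∈ s, a i)| ≤ min 1 (∑ i ∈ s, a i ^ 2) := by
  classical
  have hle1 : ∀ s : Finset ι, ∏ i ∈ s, (1 + a i)⁻¹ ≤ 1 := fun s =>
    Finset.prod_le_one (fun i _ => by have := ha i; positivity)
      (fun i _ => inv_le_one_of_one_le₀ (by linarith [ha i]))
  have hexp : ∀ s : Finset ι, Real.exp (-∑ i ∈ s, a i) = ∏ i ∈ s, Real.exp (-a i) := fun s => by
    rw [← Real.exp_sum, Finset.sum_neg_distrib]
  have h1 : Real.exp (-∑ i ∈ s, a i) ≤ ∏ i ∈ s, (1 + a i)⁻¹ := by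
    rw [hexp]
    exact Finset.prod_le_prod (fun i _ => (Real.exp_pos _).le)
      fun i _ => (inv_one_add_sub_exp_neg_mem (ha i)).1
  have h2 : ∏ i ∈ s, (1 + a i)⁻¹ ≤ Real.exp (-∑ i ∈ s, a i) + ∑ i ∈ s, a i ^ 2 := by
    clear h1
    induction s using Finset.induction_on with
    | empty => simp
    | insert j s hj ih =>
      rw [Finset.prod_insert hj, Finset.sum_insert hj, Finset.sum_insert hj, neg_add, Real.exp_add]
      have h3 := (inv_one_add_sub_exp_neg_mem (ha j)).2
      have h4 : Real.exp (-a j) ≤ 1 := Real.exp_le_one_iff.2 (by linarith [ha j])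
      have h5 : 0 ≤ ∏ i ∈ s, (1 + a i)⁻¹ :=
        Finset.prod_nonneg fun i _ => by have := ha i; positivity
      have h6 := Real.exp_pos (-a j)
      have h7 : 0 ≤ ∑ i ∈ s, a i ^ 2 := Finset.sum_nonneg fun i _ => sq_nonneg _
      nlinarith [mul_le_mul_of_nonneg_right h3 h5, mul_le_mul_of_nonneg_left ih h6.le,
        hle1 s, sq_nonneg (a j), mul_le_mul_of_nonneg_left (hle1 s) (sq_nonneg (a j)),
        mul_le_mul_of_nonneg_right h4 h7]
  rw [abs_of_nonneg (by linarith)]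
  exact le_min (by linarith [hle1 s, Real.exp_pos (-∑ i ∈ s, a i)]) (by linarith)

/-- With `a i = t f(x_i)² / p`, the sum of squares is at most `t² c⁴ / p` and the exponential
integrates to the Gamma Laplace transform. The bound does not depend on `x`, so it survives
integration over the urn. -/
lemma abs_integral_prod_sub_le {𝓧 : Type u} {α η : ℝ} (hα : 0 < α) (hη : 0 < η) {f : 𝓧 → ℝ} {c : ℝ}
    (hc : ∀ x, |f x| ≤ c) (p : ℕ) (x : Fin p → 𝓧) :
    |∫ t, ∏ i, (1 + (√(t / p) * f (x i)) ^ 2)⁻¹ ∂gammaMeasure α η -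
      (1 + sampleMean (fun y => f y ^ 2) x / η) ^ (-α)| ≤
      ∫ t, min 1 (t ^ 2 * c ^ 4 / p) ∂gammaMeasure α η := by
  have := isProbabilityMeasure_gammaMeasure hα hη
  have hs0 : 0 ≤ sampleMean (fun y => f y ^ 2) x := by
    unfold sampleMean
    exact div_nonneg (Finset.sum_nonneg fun i _ => sq_nonneg _) p.cast_nonneg
  rw [← integral_exp_neg_mul_gammaMeasure hα hη hs0, ← integral_sub]
  · refine (abs_integral_le_integral_abs).trans (integral_mono_of_nonneg
      (ae_of_all _ fun t => abs_nonneg _) ?_ ?_)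
    · refine Integrable.of_bound (Measurable.aestronglyMeasurable (by fun_prop)) 1
        (ae_of_all _ fun t => ?_)
      rw [Real.norm_eq_abs, abs_of_nonneg (le_min zero_le_one (by positivity))]
      exact min_le_left _ _
    · filter_upwards [ae_nonneg_gammaMeasure α η] with t ht
      have h1 : ∀ i, (√(t / p) * f (x i)) ^ 2 = t * f (x i) ^ 2 / p := fun i => by
        rw [mul_pow, Real.sq_sqrt (by positivity)]
        ring
      have h2 : t * sampleMean (fun y => f y ^ 2) x = ∑ i, t * f (x i) ^ 2 / p := by
        unfold sampleMean
        rw [← Finset.sum_div, ← Finset.mul_sum]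
        ring
      simp_rw [h1, h2]
      refine (abs_prod_inv_one_add_sub_exp_le _ fun i => by positivity).trans
        (min_le_min_left _ ?_)
      have h3 : ∀ i, (t * f (x i) ^ 2 / p) ^ 2 ≤ t ^ 2 * c ^ 4 / p ^ 2 := fun i => by
        have h4 : f (x i) ^ 2 ≤ c ^ 2 := sq_le_sq' (by linarith [(abs_le.1 (hc (x i))).1])
          (abs_le.1 (hc (x i))).2
        have h5 : (f (x i) ^ 2) ^ 2 ≤ (c ^ 2) ^ 2 := by gcongr
        rw [div_pow, mul_pow]
        gcongr
        calc (f (x i) ^ 2) ^ 2 ≤ (c ^ 2) ^ 2 := h5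
          _ = c ^ 4 := by ring
      refine (Finset.sum_le_sum fun i _ => h3 i).trans (le_of_eq ?_)
      rcases Nat.eq_zero_or_pos p with rfl | hp
      · simp
      · have : (p : ℝ) ≠ 0 := by positivity
        simp only [Finset.sum_const, Finset.card_univ, Fintype.card_fin, nsmul_eq_mul]
        field_simp
  · refine Integrable.of_bound (Measurable.aestronglyMeasurable (by fun_prop)) 1
      (ae_of_all _ fun t => ?_)
    rw [Real.norm_eq_abs, abs_of_nonneg (Finset.prod_nonneg fun i _ => by positivity)]
    exact Finset.prod_le_one (fun i _ => by positivity) fun i _ =>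
      inv_le_one_of_one_le₀ (by linarith [sq_nonneg (√(t / p) * f (x i))])
  · refine Integrable.of_bound (Measurable.aestronglyMeasurable (by fun_prop)) 1 ?_
    filter_upwards [ae_nonneg_gammaMeasure α η] with t ht
    rw [Real.norm_eq_abs, abs_of_nonneg (Real.exp_pos _).le]
    exact Real.exp_le_one_iff.2 (by nlinarith)

/-! ### The canonical particle measure -/

section CanonicalParticle

variable {𝓧 : Type u} [MeasurableSpace 𝓧]

/-- The particle measure as a function of `T`, `J` and `X`. -/
noncomputable abbrev canonicalParticle (𝓧 : Type u) [MeasurableSpace 𝓧] (p : ℕ) :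
    (ℝ × (Fin p → ℝ)) × (Fin p → 𝓧) → SignedMeasure 𝓧 :=
  particleMeasure p (fun q => q.1.1) (fun i q => q.1.2 i) (fun i q => q.2 i)

/-- The joint law of `T`, `J` and `X`, where the `J i` are independent with law `κ`. -/
noncomputable def canonicalLaw (α η : ℝ) (F : Measure 𝓧) (κ : Measure ℝ) (p : ℕ) :
    Measure ((ℝ × (Fin p → ℝ)) × (Fin p → 𝓧)) :=
  ((gammaMeasure α η).prod (Measure.pi fun _ => κ)).prod (urnLaw α F p)

variable {α η : ℝ} {F : Measure 𝓧} [IsProbabilityMeasure F] {κ : Measure ℝ} [IsProbabilityMeasure κ]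

lemma integral_exp_sum_pi (hκ : ∀ t, charFun κ t = (((1 + t ^ 2)⁻¹ : ℝ) : ℂ)) {p : ℕ} (r : ℝ)
    (v : Fin p → ℝ) :
    ∫ w, Complex.exp (((r * ∑ i, w i * v i : ℝ) : ℂ) * Complex.I) ∂(Measure.pi fun _ => κ) =
      ((∏ i, (1 + (r * v i) ^ 2)⁻¹ : ℝ) : ℂ) := by
  have h1 : ∀ w : Fin p → ℝ, Complex.exp (((r * ∑ i, w i * v i : ℝ) : ℂ) * Complex.I) =
      ∏ i, Complex.exp ((r * v i : ℝ) * w i * Complex.I) := by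
    intro w
    rw [← Complex.exp_sum, Finset.mul_sum]
    push_cast
    rw [Finset.sum_mul]
    refine congrArg _ (Finset.sum_congr rfl fun i _ => by ring)
  simp_rw [h1]
  rw [integral_fintype_prod_eq_prod (𝕜 := ℂ) fun i (y : ℝ) =>
    Complex.exp ((r * v i : ℝ) * y * Complex.I)]
  push_cast
  refine Finset.prod_congr rfl fun i _ => ?_
  have := hκ (r * v i)
  rw [charFun_apply_real] at this
  push_cast at this ⊢
  exact this

variable [MeasurableSingletonClass 𝓧]

lemma signedIntegral_particleMeasure {Ω : Type v} {p : ℕ} (T : Ω → ℝ)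
    (J : Fin p → Ω → ℝ) (X : Fin p → Ω → 𝓧) (ω : Ω) {f : 𝓧 → ℝ} (hf : Measurable f)
    {c : ℝ} (hc : ∀ x, |f x| ≤ c) :
    signedIntegral (particleMeasure p T J X ω) f = √(T ω / p) * ∑ i, J i ω * f (X i ω) := by
  unfold signedIntegral particleMeasure
  rw [VectorMeasure.integral_smul_vectorMeasure, VectorMeasure.integral_finsetSum_vectorMeasure]
  · simp_rw [VectorMeasure.integral_smul_vectorMeasure, VectorMeasure.integral_dirac]
    simp
  · exact fun i _ => integrable_signed_of_bounded _ hf hc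

lemma integral_exp_canonicalLaw (hα : 0 < α) (hη : 0 < η)
    (hκ : ∀ t, charFun κ t = (((1 + t ^ 2)⁻¹ : ℝ) : ℂ)) {f : 𝓧 → ℝ} (hf : Measurable f) {c : ℝ}
    (hc : ∀ x, |f x| ≤ c) (p : ℕ) :
    ∫ q, Complex.exp ((signedIntegral (canonicalParticle 𝓧 p q) f : ℝ) * Complex.I)
      ∂canonicalLaw α η F κ p =
    ((∫ x, ∫ t, ∏ i, (1 + (√(t / p) * f (x i)) ^ 2)⁻¹ ∂gammaMeasure α η ∂urnLaw α F p : ℝ) : ℂ) := by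
  have := isProbabilityMeasure_urnLaw (F := F) hα p
  have := isProbabilityMeasure_gammaMeasure hα hη
  have hexp : ∀ q, Complex.exp ((signedIntegral (canonicalParticle 𝓧 p q) f : ℝ) * Complex.I) =
      Complex.exp (((√(q.1.1 / p) * ∑ i, q.1.2 i * f (q.2 i) : ℝ) : ℂ) * Complex.I) := fun q => by
    rw [signedIntegral_particleMeasure _ _ _ _ hf hc]
  simp_rw [hexp]
  have hm : Measurable fun q : (ℝ × (Fin p → ℝ)) × (Fin p → 𝓧) =>
      Complex.exp (((√(q.1.1 / p) * ∑ i, q.1.2 i * f (q.2 i) : ℝ) : ℂ) * Complex.I) := by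
    fun_prop
  rw [canonicalLaw, integral_prod_symm]
  · rw [← integral_complex_ofReal]
    refine integral_congr_ae (ae_of_all _ fun x => ?_)
    dsimp only
    rw [integral_prod, ← integral_complex_ofReal]
    · refine integral_congr_ae (ae_of_all _ fun t => ?_)
      exact integral_exp_sum_pi hκ (√(t / p)) fun i => f (x i)
    · refine Integrable.of_bound (Measurable.aestronglyMeasurable (by fun_prop)) 1
        (ae_of_all _ fun q => ?_)
      rw [Complex.norm_exp_ofReal_mul_I]
  · refine Integrable.of_bound hm.aestronglyMeasurable 1 (ae_of_all _ fun q => ?_)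
    rw [Complex.norm_exp_ofReal_mul_I]

/-- The uniform error vanishes by dominated convergence in `T`, and what remains is the Markov–Krein
limit for `g = f²`. -/
lemma tendsto_integral_exp_canonicalLaw (hα : 0 < α) (hη : 0 < η)
    (hκ : ∀ t, charFun κ t = (((1 + t ^ 2)⁻¹ : ℝ) : ℂ)) {f : 𝓧 → ℝ} (hf : Measurable f) {c : ℝ}
    (hc : ∀ x, |f x| ≤ c) :
    Tendsto (fun p => ∫ q, Complex.exp ((signedIntegral (canonicalParticle 𝓧 p q) f : ℝ) *
      Complex.I) ∂canonicalLaw α η F κ p) atTop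
      (𝓝 ((Real.exp (-(α * ∫ x, Real.log (1 + f x ^ 2 / η) ∂F)) : ℝ) : ℂ)) := by
  have := isProbabilityMeasure_gammaMeasure hα hη
  simp_rw [integral_exp_canonicalLaw hα hη hκ hf hc]
  refine (Complex.continuous_ofReal.tendsto _).comp ?_
  have h1 := tendsto_integral_one_add_sampleMean_rpow (F := F) hα hη (g := fun x => f x ^ 2)
    (c := c ^ 2) (by fun_prop) fun x => ⟨sq_nonneg _, sq_le_sq' (by linarith [(abs_le.1 (hc x)).1])
      (abs_le.1 (hc x)).2⟩
  have h2 : Tendsto (fun p : ℕ => ∫ t, min 1 (t ^ 2 * c ^ 4 / p) ∂gammaMeasure α η) atTop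
      (𝓝 0) := by
    have h3 := tendsto_integral_of_dominated_convergence (μ := gammaMeasure α η)
      (F := fun (p : ℕ) t => min 1 (t ^ 2 * c ^ 4 / p)) (f := fun _ => (0 : ℝ)) (fun _ => 1)
      (fun p => Measurable.aestronglyMeasurable (by fun_prop)) (integrable_const _)
      (fun p => ae_of_all _ fun t => by
        rw [Real.norm_eq_abs, abs_of_nonneg (le_min zero_le_one (by positivity))]
        exact min_le_left _ _)
      (ae_of_all _ fun t => by
        have h4 : Tendsto (fun p : ℕ => t ^ 2 * c ^ 4 / (p : ℝ)) atTop (𝓝 0) :=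
          tendsto_const_nhds.div_atTop tendsto_natCast_atTop_atTop
        simpa using (tendsto_const_nhds (x := (1 : ℝ))).min h4)
    simpa using h3
  have h5 : Tendsto (fun p => ∫ x, ∫ t, ∏ i, (1 + (√(t / p) * f (x i)) ^ 2)⁻¹ ∂gammaMeasure α η
      ∂urnLaw α F p - ∫ x, (1 + sampleMean (fun y => f y ^ 2) x / η) ^ (-α) ∂urnLaw α F p) atTop
      (𝓝 0) := by
    refine squeeze_zero_norm (fun p => ?_) h2
    have := isProbabilityMeasure_urnLaw (F := F) hα p
    have hm1 : Measurable fun x : Fin p → 𝓧 =>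
        ∫ t, ∏ i, (1 + (√(t / p) * f (x i)) ^ 2)⁻¹ ∂gammaMeasure α η := by
      refine (StronglyMeasurable.integral_prod_right' (f := fun q : (Fin p → 𝓧) × ℝ =>
        ∏ i, (1 + (√(q.2 / p) * f (q.1 i)) ^ 2)⁻¹) ?_).measurable
      exact Measurable.stronglyMeasurable (by fun_prop)
    have hs0 : ∀ x : Fin p → 𝓧, 0 ≤ sampleMean (fun y => f y ^ 2) x := fun x =>
      div_nonneg (Finset.sum_nonneg fun i _ => sq_nonneg _) p.cast_nonneg
    rw [← integral_sub]
    · refine (norm_integral_le_of_norm_le_const (ae_of_all _ fun x =>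
        abs_integral_prod_sub_le hα hη hc p x)).trans (by simp)
    · refine Integrable.of_bound hm1.aestronglyMeasurable 1 (ae_of_all _ fun x => ?_)
      refine (norm_integral_le_of_norm_le_const (C := 1) (ae_of_all _ fun t => ?_)).trans (by simp)
      rw [Real.norm_eq_abs, abs_of_nonneg (Finset.prod_nonneg fun i _ => by positivity)]
      exact Finset.prod_le_one (fun i _ => by positivity) fun i _ =>
        inv_le_one_of_one_le₀ (by linarith [sq_nonneg (√(t / p) * f (x i))])
    · have hms : Measurable fun x : Fin p → 𝓧 => sampleMean (fun y => f y ^ 2) x :=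
        measurable_sampleMean (by fun_prop)
      refine Integrable.of_bound (Measurable.aestronglyMeasurable (by fun_prop)) 1
        (ae_of_all _ fun x => ?_)
      have h6 : 0 ≤ sampleMean (fun y => f y ^ 2) x / η := div_nonneg (hs0 x) hη.le
      rw [Real.norm_eq_abs, abs_of_nonneg (Real.rpow_nonneg (by linarith) _)]
      exact Real.rpow_le_one_of_one_le_of_nonpos (by linarith) (by linarith)
  simpa using h5.add h1

end CanonicalParticle

/-! ### Tightness of the particle measures -/

section Tightness

lemma exists_measure_Ioi_le (γ : Measure ℝ) [IsFiniteMeasure γ] {ε : ℝ≥0∞} (hε : 0 < ε) :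
    ∃ K : ℝ, 0 ≤ K ∧ γ (Set.Ioi K) ≤ ε := by
  have h := tendsto_measure_iInter_atTop (μ := γ) (s := fun n : ℕ => Set.Ioi (n : ℝ))
    (fun n => measurableSet_Ioi.nullMeasurableSet)
    (fun m n hmn => Set.Ioi_subset_Ioi (by exact_mod_cast hmn)) ⟨0, measure_ne_top _ _⟩
  have h0 : ⋂ n : ℕ, Set.Ioi (n : ℝ) = ∅ := by
    ext x
    obtain ⟨n, hn⟩ := exists_nat_ge x
    simp only [Set.mem_iInter, Set.mem_Ioi, Set.mem_empty_iff_false, iff_false, not_forall, not_lt]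
    exact ⟨n, hn⟩
  rw [h0, measure_empty] at h
  obtain ⟨n, hn⟩ := ((ENNReal.tendsto_nhds_zero.1 h) ε hε).exists
  exact ⟨n, n.cast_nonneg, hn⟩

variable {𝓧 : Type u} [TopologicalSpace 𝓧] [PolishSpace 𝓧] [MeasurableSpace 𝓧] [BorelSpace 𝓧]
  {α η : ℝ} {F : Measure 𝓧} [IsProbabilityMeasure F] {κ : Measure ℝ} [IsProbabilityMeasure κ]

lemma measurable_canonicalParticle (p : ℕ) : Measurable (canonicalParticle 𝓧 p) := by
  refine measurable_of_measurable_signedIntegral fun f => ?_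
  obtain ⟨c, -, hc⟩ := exists_abs_le_of_compactlySupported f
  have hf : Measurable f := f.continuous.measurable
  simp_rw [signedIntegral_particleMeasure _ _ _ _ hf hc]
  fun_prop

lemma lintegral_atomicTotal_canonicalLaw_le (hα : 0 < α) (hη : 0 < η)
    (hκ : ∀ t, charFun κ t = (((1 + t ^ 2)⁻¹ : ℝ) : ℂ)) (p : ℕ) :
    ∫⁻ q, ENNReal.ofReal (atomicTotal q.1.2 q.2) ∂canonicalLaw α η F κ p ≤
      ENNReal.ofReal (√2 * ((16 * α + 2) * √(α + p))) := by
  have := isProbabilityMeasure_urnLaw (F := F) hα p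
  have := isProbabilityMeasure_gammaMeasure hα hη
  have hJ : ∀ i : Fin p, HasSymmetricGammaLaw (fun w : Fin p → ℝ => w i) 1 1
      (Measure.pi fun _ => κ) := fun i => by
    refine ⟨(measurable_pi_apply i).aemeasurable, fun t => ?_⟩
    have h1 := (measurePreserving_eval (fun _ : Fin p => κ) i).map_eq
    have h2 : Measure.map (fun w : Fin p → ℝ => w i) (Measure.pi fun _ => κ) = κ := h1
    rw [h2, hκ, Real.rpow_neg_one]
    simp
  have hind : iIndepFun (fun (i : Fin p) (w : Fin p → ℝ) => w i) (Measure.pi fun _ => κ) :=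
    iIndepFun_pi (μ := fun _ : Fin p => κ) (X := fun _ y => y) fun i => aemeasurable_id
  have hm := measurable_atomicTotal (𝓧 := 𝓧) (k := p)
  have hm1 : Measurable fun q : (ℝ × (Fin p → ℝ)) × (Fin p → 𝓧) =>
      ENNReal.ofReal (atomicTotal q.1.2 q.2) :=
    (hm.comp ((measurable_snd.comp measurable_fst).prodMk measurable_snd)).ennreal_ofReal
  rw [canonicalLaw, lintegral_prod_symm' _ hm1]
  calc ∫⁻ x, ∫⁻ q, ENNReal.ofReal (atomicTotal q.2 x) ∂(gammaMeasure α η).prod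
        (Measure.pi fun _ => κ) ∂urnLaw α F p
      ≤ ∫⁻ x, ENNReal.ofReal (√2 * invSqrtMultiplicity x) ∂urnLaw α F p := by
        refine lintegral_mono fun x => ?_
        have hm2 : Measurable fun q : ℝ × (Fin p → ℝ) => ENNReal.ofReal (atomicTotal q.2 x) :=
          (hm.comp (measurable_snd.prodMk measurable_const)).ennreal_ofReal
        rw [lintegral_prod _ hm2.aemeasurable]
        dsimp only
        rw [lintegral_const, measure_univ, mul_one]
        exact integral_atomicTotal_le hJ hind x
    _ = ENNReal.ofReal (∫ x, √2 * invSqrtMultiplicity x ∂urnLaw α F p) :=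
        (ofReal_integral_eq_lintegral_ofReal ((integrable_invSqrtMultiplicity hα p).const_mul _)
          (ae_of_all _ fun x => mul_nonneg (Real.sqrt_nonneg _)
            (invSqrtMultiplicity_nonneg x))).symm
    _ ≤ _ := by
        refine ENNReal.ofReal_le_ofReal ?_
        rw [integral_const_mul]
        gcongr
        exact integral_invSqrtMultiplicity_le hα p

/-- For `p ≥ 1`, `(α + p) / p ≤ α + 1`; for `p = 0` the left side is 0 because `K / 0 = 0`. -/
lemma sqrt_div_mul_sqrt_add_le {K α : ℝ} (hK : 0 ≤ K) (hα : 0 < α) (p : ℕ) :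
    √(K / p) * √(α + p) ≤ √(K * (α + 1)) := by
  rw [← Real.sqrt_mul (by positivity)]
  refine Real.sqrt_le_sqrt ?_
  rcases Nat.eq_zero_or_pos p with rfl | hp
  · simp
    positivity
  · have hp' : (1 : ℝ) ≤ p := by exact_mod_cast hp
    rw [div_mul_eq_mul_div, div_le_iff₀ (by positivity), mul_assoc]
    gcongr
    nlinarith

/-- The laws of the particle measures are concentrated on vague balls, uniformly in `p`. -/
lemma exists_canonicalLaw_compl_vagueBall_le (hα : 0 < α) (hη : 0 < η)
    (hκ : ∀ t, charFun κ t = (((1 + t ^ 2)⁻¹ : ℝ) : ℂ)) {ε : ℝ≥0∞} (hε : 0 < ε) :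
    ∃ n, ∀ p, canonicalLaw α η F κ p (canonicalParticle 𝓧 p ⁻¹' (vagueBall 𝓧 n)ᶜ) ≤ ε := by
  have := isProbabilityMeasure_gammaMeasure hα hη
  have hε2 : 0 < ε / 2 := ENNReal.half_pos hε.ne'
  -- The level `K` truncates `T`, and `B` bounds the mean total variation on `T ≤ K` for all `p`.
  obtain ⟨K, hK0, hK⟩ := exists_measure_Ioi_le (gammaMeasure α η) hε2
  set B : ℝ := √2 * (16 * α + 2) * √(K * (α + 1)) with hB
  obtain ⟨n, hn⟩ : ∃ n : ℕ, 0 < n ∧ ENNReal.ofReal B / n ≤ ε / 2 := by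
    have h1 : Tendsto (fun n : ℕ => ENNReal.ofReal B / n) atTop (𝓝 0) := by
      simpa using ENNReal.Tendsto.const_div ENNReal.tendsto_nat_nhds_top (Or.inr ENNReal.ofReal_ne_top)
    obtain ⟨n, hn⟩ := ((eventually_gt_atTop 0).and ((ENNReal.tendsto_nhds_zero.1 h1) _ hε2)).exists
    exact ⟨n, hn⟩
  refine ⟨n, fun p => ?_⟩
  have := isProbabilityMeasure_urnLaw (F := F) hα p
  -- Outside the ball either `T > K` or the total variation with `T` replaced by `K` is at least
  -- `n`; the latter is handled by Markov's inequality.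
  have hsub : canonicalParticle 𝓧 p ⁻¹' (vagueBall 𝓧 n)ᶜ ⊆
      (Set.Ioi K ×ˢ (Set.univ : Set (Fin p → ℝ))) ×ˢ (Set.univ : Set (Fin p → 𝓧)) ∪
      {q | (n : ℝ≥0∞) ≤ ENNReal.ofReal (√(K / p)) * ENNReal.ofReal (atomicTotal q.1.2 q.2)} := by
    intro q hq
    by_cases hT : K < q.1.1
    · left
      simpa using hT
    right
    by_contra h
    refine hq fun f c hc0 hc => ?_
    rw [Set.mem_ofPred_eq, not_le, ← ENNReal.ofReal_mul (Real.sqrt_nonneg _),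
      ← ENNReal.ofReal_natCast, ENNReal.ofReal_lt_ofReal_iff (by exact_mod_cast hn.1)] at h
    have hf : Measurable f := f.continuous.measurable
    rw [signedIntegral_particleMeasure _ _ _ _ hf hc, abs_mul, abs_of_nonneg (Real.sqrt_nonneg _)]
    have h1 := abs_sum_mul_le_atomicTotal q.1.2 q.2 hc
    have h2 : √(q.1.1 / p) ≤ √(K / p) := by
      refine Real.sqrt_le_sqrt ?_
      gcongr
      exact not_lt.1 hT
    have h3 := atomicTotal_nonneg q.1.2 q.2
    calc √(q.1.1 / p) * |∑ i, q.1.2 i * f (q.2 i)|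
        ≤ √(K / p) * (c * atomicTotal q.1.2 q.2) := by gcongr
      _ = c * (√(K / p) * atomicTotal q.1.2 q.2) := by ring
      _ ≤ c * n := by gcongr
      _ = n * c := by ring
  refine (measure_mono hsub).trans ((measure_union_le _ _).trans ?_)
  rw [← ENNReal.add_halves ε]
  refine add_le_add ?_ ?_
  · rw [canonicalLaw, Measure.prod_prod, Measure.prod_prod, measure_univ, measure_univ, mul_one,
      mul_one]
    exact hK
  · have hm1 : Measurable fun q : (ℝ × (Fin p → ℝ)) × (Fin p → 𝓧) =>
        ENNReal.ofReal (atomicTotal q.1.2 q.2) :=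
      (measurable_atomicTotal.comp
        ((measurable_snd.comp measurable_fst).prodMk measurable_snd)).ennreal_ofReal
    refine (meas_ge_le_lintegral_div (hm1.const_mul _).aemeasurable
      (by exact_mod_cast hn.1.ne') (ENNReal.natCast_ne_top n)).trans
      (le_trans (ENNReal.div_le_div_right ?_ _) hn.2)
    rw [lintegral_const_mul _ hm1]
    refine (mul_le_mul_right (lintegral_atomicTotal_canonicalLaw_le hα hη hκ p) _).trans ?_
    rw [← ENNReal.ofReal_mul (Real.sqrt_nonneg _)]
    refine ENNReal.ofReal_le_ofReal ?_
    have h1 := sqrt_div_mul_sqrt_add_le hK0 hα p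
    calc √(K / p) * (√2 * ((16 * α + 2) * √(α + p)))
        = √2 * (16 * α + 2) * (√(K / p) * √(α + p)) := by ring
      _ ≤ B := by rw [hB]; gcongr

end Tightness

/-! ### The characteristic functional of a symmetric Gamma random measure -/

section SimpleApproximation

variable {𝓧 : Type u} [MeasurableSpace 𝓧]

lemma exists_simpleFunc_tendsto {h : 𝓧 → ℝ} (hh : Measurable h) {c : ℝ} (hc : ∀ x, |h x| ≤ c)
    (hc0 : 0 ≤ c) : ∃ g : ℕ → SimpleFunc 𝓧 ℝ, (∀ n x, |g n x| ≤ c) ∧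
      ∀ x, Tendsto (fun n => g n x) atTop (𝓝 (h x)) := by
  have h0 : (0 : ℝ) ∈ Set.Icc (-c) c := ⟨by linarith, hc0⟩
  refine ⟨SimpleFunc.approxOn h hh (Set.Icc (-c) c) 0 h0, fun n x => ?_, fun x => ?_⟩
  · exact abs_le.2 (SimpleFunc.approxOn_mem hh h0 n x)
  · exact SimpleFunc.tendsto_approxOn hh h0 (subset_closure (abs_le.1 (hc x)))

lemma tendsto_signedIntegral (μ : SignedMeasure 𝓧) {g : ℕ → SimpleFunc 𝓧 ℝ} {h : 𝓧 → ℝ} {c : ℝ}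
    (hg : ∀ n x, |g n x| ≤ c) (hlim : ∀ x, Tendsto (fun n => g n x) atTop (𝓝 (h x))) :
    Tendsto (fun n => signedIntegral μ (g n)) atTop (𝓝 (signedIntegral μ h)) :=
  VectorMeasure.tendsto_integral_filter_of_norm_le_const
    (Eventually.of_forall fun n => (g n).measurable.aestronglyMeasurable)
    ⟨c, Eventually.of_forall fun n => ae_of_all _ (hg n)⟩ (ae_of_all _ hlim)

lemma tendsto_exp_neg_integral_log {F : Measure 𝓧} [IsFiniteMeasure F] (α : ℝ) {b : ℝ}
    {g : ℕ → SimpleFunc 𝓧 ℝ} {h : 𝓧 → ℝ} {c : ℝ}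
    (hg : ∀ n x, |g n x| ≤ c) (hlim : ∀ x, Tendsto (fun n => g n x) atTop (𝓝 (h x))) :
    Tendsto (fun n => Real.exp (-(α * ∫ x, Real.log (1 + g n x ^ 2 / b ^ 2) ∂F))) atTop
      (𝓝 (Real.exp (-(α * ∫ x, Real.log (1 + h x ^ 2 / b ^ 2) ∂F)))) := by
  refine (Real.continuous_exp.tendsto _).comp (((tendsto_integral_of_dominated_convergence
    (fun _ => c ^ 2 / b ^ 2) (fun n => ?_) (integrable_const _) (fun n => ae_of_all _ fun x => ?_)
    (ae_of_all _ fun x => ?_)).const_mul α).neg)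
  · exact Measurable.aestronglyMeasurable (by have := (g n).measurable; fun_prop)
  · have h1 : 0 ≤ g n x ^ 2 / b ^ 2 := by positivity
    rw [Real.norm_eq_abs, abs_of_nonneg (Real.log_nonneg (by linarith))]
    refine (Real.log_le_sub_one_of_pos (by linarith)).trans ?_
    have h2 : g n x ^ 2 ≤ c ^ 2 := by
      rw [← sq_abs]
      gcongr
      exact hg n x
    rw [add_sub_cancel_left]
    gcongr
  · have h1 : 1 + h x ^ 2 / b ^ 2 ≠ 0 := by positivity
    exact ((((hlim x).pow 2).div_const _).const_add 1).log h1

end SimpleApproximation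

namespace IsSymmetricGammaRandomMeasure

variable {𝓧 : Type u} [MeasurableSpace 𝓧] {Ω : Type v} [MeasurableSpace Ω] {P : Measure Ω}
  {Q : Ω → SignedMeasure 𝓧} {α b : ℝ} {F : Measure 𝓧}

lemma measurable_signedIntegral_simpleFunc (hQ : IsSymmetricGammaRandomMeasure Q α F b P)
    (g : SimpleFunc 𝓧 ℝ) : Measurable fun ω => signedIntegral (Q ω) g := by
  simp_rw [signedIntegral_simpleFunc]
  exact Finset.measurable_fun_sum _ fun y _ =>
    (hQ.measurable_apply _ (g.measurableSet_preimage _)).const_mul y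

lemma measurable_signedIntegral (hQ : IsSymmetricGammaRandomMeasure Q α F b P)
    {h : 𝓧 → ℝ} (hh : Measurable h) {c : ℝ} (hc : ∀ x, |h x| ≤ c) (hc0 : 0 ≤ c) :
    Measurable fun ω => signedIntegral (Q ω) h := by
  obtain ⟨g, hg, hlim⟩ := exists_simpleFunc_tendsto hh hc hc0
  exact measurable_of_tendsto_metrizable
    (fun n => hQ.measurable_signedIntegral_simpleFunc (g n))
    (tendsto_pi_nhds.2 fun ω => tendsto_signedIntegral (Q ω) hg hlim)

variable [IsProbabilityMeasure F]

/-- The level sets of `g` are disjoint, so the values of `Q` on them are independent and the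
expectation factors. -/
lemma integral_exp_simpleFunc (hQ : IsSymmetricGammaRandomMeasure Q α F b P)
    (g : SimpleFunc 𝓧 ℝ) :
    ∫ ω, Complex.exp ((signedIntegral (Q ω) g : ℝ) * Complex.I) ∂P =
      ((Real.exp (-(α * ∫ x, Real.log (1 + g x ^ 2 / b ^ 2) ∂F)) : ℝ) : ℂ) := by
  classical
  set e := g.range.equivFin with he
  set y : Fin g.range.card → ℝ := fun i => (e.symm i : ℝ) with hy
  set A : Fin g.range.card → Set 𝓧 := fun i => g ⁻¹' {y i} with hA
  have hreindex : ∀ (φ : ℝ → ℝ), ∑ z ∈ g.range, φ z = ∑ i, φ (y i) := fun φ => by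
    rw [← Finset.sum_coe_sort, ← Equiv.sum_comp e.symm]
  have hm : ∀ i, MeasurableSet (A i) := fun i => g.measurableSet_preimage _
  have hdisj : Pairwise fun i j => Disjoint (A i) (A j) := by
    intro i j hij
    refine Disjoint.preimage _ (Set.disjoint_singleton.2 fun h => hij ?_)
    exact e.symm.injective (Subtype.ext h)
  have hind := hQ.iIndepFun_apply _ A hm hdisj
  have h1 : ∀ ω, Complex.exp ((signedIntegral (Q ω) g : ℝ) * Complex.I) =
      ∏ i, Complex.exp (y i * (Q ω (A i) : ℝ) * Complex.I) := fun ω => by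
    rw [signedIntegral_simpleFunc, hreindex fun z => z * Q ω (g ⁻¹' {z}), ← Complex.exp_sum]
    push_cast
    rw [Finset.sum_mul]
  have h2 : ∫ x, Real.log (1 + g x ^ 2 / b ^ 2) ∂F =
      ∑ i, F.real (A i) * Real.log (1 + y i ^ 2 / b ^ 2) := by
    have h3 := SimpleFunc.map_integral (μ := F) g (fun z => Real.log (1 + z ^ 2 / b ^ 2))
      (SimpleFunc.integrable_of_isFiniteMeasure g) (by simp)
    rw [SimpleFunc.integral_eq_integral _ (SimpleFunc.integrable_of_isFiniteMeasure _)] at h3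
    simp only [smul_eq_mul] at h3
    rw [hreindex fun z => F.real (g ⁻¹' {z}) * Real.log (1 + z ^ 2 / b ^ 2)] at h3
    exact h3
  simp_rw [h1]
  rw [hind.integral_fun_prod_comp (fun i => (hQ.measurable_apply _ (hm i)).aemeasurable)
    (f := fun i (z : ℝ) => Complex.exp (y i * z * Complex.I))
    (fun i => Measurable.aestronglyMeasurable (by fun_prop)), h2, Finset.mul_sum,
    ← Finset.sum_neg_distrib, Real.exp_sum]
  push_cast
  refine Finset.prod_congr rfl fun i _ => ?_
  have h4 := (hQ.hasLaw_apply _ (hm i)).charFun_eq (y i)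
  rw [charFun_apply_real, integral_map (hQ.measurable_apply _ (hm i)).aemeasurable
    (Measurable.aestronglyMeasurable (by fun_prop))] at h4
  rw [h4, Real.rpow_def_of_pos (by positivity)]
  push_cast
  congr 1
  ring

lemma integral_exp [IsProbabilityMeasure P] (hQ : IsSymmetricGammaRandomMeasure Q α F b P)
    {h : 𝓧 → ℝ} (hh : Measurable h) {c : ℝ} (hc : ∀ x, |h x| ≤ c) (hc0 : 0 ≤ c) :
    ∫ ω, Complex.exp ((signedIntegral (Q ω) h : ℝ) * Complex.I) ∂P =
      ((Real.exp (-(α * ∫ x, Real.log (1 + h x ^ 2 / b ^ 2) ∂F)) : ℝ) : ℂ) := by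
  obtain ⟨g, hg, hlim⟩ := exists_simpleFunc_tendsto hh hc hc0
  have h1 : Tendsto (fun n => ∫ ω, Complex.exp ((signedIntegral (Q ω) (g n) : ℝ) * Complex.I) ∂P)
      atTop (𝓝 (∫ ω, Complex.exp ((signedIntegral (Q ω) h : ℝ) * Complex.I) ∂P)) := by
    refine tendsto_integral_of_dominated_convergence (fun _ => 1) (fun n => ?_)
      (integrable_const _) (fun n => ae_of_all _ fun ω => ?_) (ae_of_all _ fun ω => ?_)
    · have := hQ.measurable_signedIntegral_simpleFunc (g n)
      exact Measurable.aestronglyMeasurable (by fun_prop)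
    · rw [Complex.norm_exp_ofReal_mul_I]
    · have hcont : Continuous fun z : ℝ => Complex.exp (z * Complex.I) := by fun_prop
      exact (hcont.tendsto _).comp (tendsto_signedIntegral (Q ω) hg hlim)
  simp_rw [hQ.integral_exp_simpleFunc] at h1
  exact tendsto_nhds_unique h1 ((Complex.continuous_ofReal.tendsto _).comp
    (tendsto_exp_neg_integral_log α hg hlim))

end IsSymmetricGammaRandomMeasure

/-! ### Convergence of the particle measures -/

/-- The characteristic function determines the law of each jump, so one `κ` serves every model and
the probability spaces drop out of the argument. -/
lemma map_eq_canonicalLaw {𝓧 : Type u} [MeasurableSpace 𝓧] {α η : ℝ} {F : Measure 𝓧}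
    [IsProbabilityMeasure F] {κ : Measure ℝ} [IsProbabilityMeasure κ]
    (hκ : ∀ t, charFun κ t = (((1 + t ^ 2)⁻¹ : ℝ) : ℂ)) (hα : 0 < α) {Ω : Type v}
    [MeasurableSpace Ω] {P : Measure Ω} [IsProbabilityMeasure P] {p : ℕ} {T : Ω → ℝ}
    {J : Fin p → Ω → ℝ} {X : Fin p → Ω → 𝓧}
    (hT : HasLaw T (gammaMeasure α η) P) (hJ : ∀ i, HasSymmetricGammaLaw (J i) 1 1 P)
    (hX : IsPolyaUrn X α F P) (hJ_indep : iIndepFun J P)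
    (hTJ_indep : IndepFun T (fun ω i => J i ω) P)
    (hTJX_indep : IndepFun (fun ω => (T ω, fun i => J i ω)) (fun ω i => X i ω) P) :
    P.map (fun ω => ((T ω, fun i => J i ω), fun i => X i ω)) = canonicalLaw α η F κ p := by
  have hJm : AEMeasurable (fun ω i => J i ω) P := aemeasurable_pi_lambda _ fun i =>
    (hJ i).aemeasurable
  have hXm : AEMeasurable (fun ω i => X i ω) P :=
    (measurable_pi_lambda _ fun i => hX.measurable i).aemeasurable
  have hJκ : ∀ i, P.map (J i) = κ := fun i => by
    have := Measure.isProbabilityMeasure_map (hJ i).aemeasurable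
    refine Measure.ext_of_charFun (funext fun t => ?_)
    rw [(hJ i).charFun_eq, hκ, Real.rpow_neg_one]
    simp
  rw [(indepFun_iff_map_prod_eq_prod_map_map (hT.aemeasurable.prodMk hJm) hXm).1 hTJX_indep,
    (indepFun_iff_map_prod_eq_prod_map_map hT.aemeasurable hJm).1 hTJ_indep, hT.map_eq,
    hX.map_eq hα, (iIndepFun_iff_map_fun_eq_pi_map fun i => (hJ i).aemeasurable).1 hJ_indep]
  simp_rw [hJκ]
  rfl

section ParticleConvergence

variable {𝓧 : Type u} [TopologicalSpace 𝓧] [PolishSpace 𝓧] [MeasurableSpace 𝓧] [BorelSpace 𝓧]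
  {α η : ℝ} {F : Measure 𝓧}

lemma IsSymmetricGammaRandomMeasure.measurable {Ω : Type v} [MeasurableSpace Ω] {P : Measure Ω}
    {Q : Ω → SignedMeasure 𝓧} {b : ℝ}
    (hQ : IsSymmetricGammaRandomMeasure Q α F b P) : Measurable Q := by
  refine measurable_of_measurable_signedIntegral fun f => ?_
  obtain ⟨c, hc0, hc⟩ := exists_abs_le_of_compactlySupported f
  exact hQ.measurable_signedIntegral f.continuous.measurable hc hc0

variable [IsProbabilityMeasure F]

/-- The particle measures converge in distribution to any symmetric Gamma random measure. -/
theorem tendstoInDistribution_particleMeasure (hα : 0 < α) (hη : 0 < η)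
    {Ω : ℕ → Type v} [∀ p, MeasurableSpace (Ω p)]
    {P : (p : ℕ) → Measure (Ω p)} [∀ p, IsProbabilityMeasure (P p)]
    {T : (p : ℕ) → Ω p → ℝ} {J : (p : ℕ) → Fin p → Ω p → ℝ} {X : (p : ℕ) → Fin p → Ω p → 𝓧}
    (hT : ∀ p, HasLaw (T p) (gammaMeasure α η) (P p))
    (hJ : ∀ p i, HasSymmetricGammaLaw (J p i) 1 1 (P p))
    (hX : ∀ p, IsPolyaUrn (X p) α F (P p))
    (hJ_indep : ∀ p, iIndepFun (J p) (P p))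
    (hTJ_indep : ∀ p, IndepFun (T p) (fun ω i => J p i ω) (P p))
    (hTJX_indep : ∀ p,
      IndepFun (fun ω => (T p ω, fun i => J p i ω)) (fun ω i => X p i ω) (P p))
    {Ω' : Type w} [MeasurableSpace Ω'] {P' : Measure Ω'} [IsProbabilityMeasure P']
    {Q : Ω' → SignedMeasure 𝓧} (hQ : IsSymmetricGammaRandomMeasure Q α F (√η) P') :
    TendstoInDistribution (fun p => particleMeasure p (T p) (J p) (X p)) atTop Q P P' := by
  -- The jump in the model `p = 1`, the first to have one, supplies the common jump law.
  set κ : Measure ℝ := (P 1).map (J 1 0)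
  have : IsProbabilityMeasure κ := Measure.isProbabilityMeasure_map (hJ 1 0).aemeasurable
  have hκ : ∀ t, charFun κ t = (((1 + t ^ 2)⁻¹ : ℝ) : ℂ) := fun t => by
    rw [(hJ 1 0).charFun_eq, Real.rpow_neg_one]
    simp
  have hYm : ∀ p, AEMeasurable (fun ω => ((T p ω, fun i => J p i ω), fun i => X p i ω)) (P p) :=
    fun p => ((hT p).aemeasurable.prodMk (aemeasurable_pi_lambda _ fun i =>
      (hJ p i).aemeasurable)).prodMk
      (measurable_pi_lambda _ fun i => (hX p).measurable i).aemeasurable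
  have hYlaw := fun p => map_eq_canonicalLaw hκ hα (hT p) (hJ p) (hX p) (hJ_indep p)
    (hTJ_indep p) (hTJX_indep p)
  have hpm : ∀ p, AEMeasurable (particleMeasure p (T p) (J p) (X p)) (P p) := fun p =>
    (measurable_canonicalParticle p).comp_aemeasurable (hYm p)
  have hlaw : ∀ p, (P p).map (particleMeasure p (T p) (J p) (X p)) =
      (canonicalLaw α η F κ p).map (canonicalParticle 𝓧 p) := fun p => by
    rw [← hYlaw p, AEMeasurable.map_map_of_aemeasurable
      (measurable_canonicalParticle p).aemeasurable (hYm p)]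
    rfl
  refine ⟨hpm, hQ.measurable.aemeasurable, ?_⟩
  refine tendsto_probabilityMeasure_of_charFunctional (fun f => ?_) fun ε hε => ?_
  · obtain ⟨c, hc0, hc⟩ := exists_abs_le_of_compactlySupported f
    have hf : Measurable f := f.continuous.measurable
    have hmeas : Measurable fun ν : SignedMeasure 𝓧 =>
        Complex.exp ((signedIntegral ν f : ℝ) * Complex.I) := by
      have := (continuous_signedIntegral f).measurable
      fun_prop
    simp only [ProbabilityMeasure.coe_mk]
    simp_rw [hlaw]
    rw [integral_map hQ.measurable.aemeasurable hmeas.aestronglyMeasurable,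
      hQ.integral_exp hf hc hc0, Real.sq_sqrt hη.le]
    refine (tendsto_integral_exp_canonicalLaw hα hη hκ hf hc).congr fun p => ?_
    rw [integral_map (measurable_canonicalParticle p).aemeasurable hmeas.aestronglyMeasurable]
  · obtain ⟨n, hn⟩ := exists_canonicalLaw_compl_vagueBall_le (F := F) hα hη hκ hε
    refine ⟨n, fun p => ?_⟩
    simp only [ProbabilityMeasure.coe_mk]
    rw [hlaw, Measure.map_apply (measurable_canonicalParticle p)
      (isClosed_vagueBall n).measurableSet.compl]
    exact hn p

end ParticleConvergence

/-! ### The Laplace functional of the Gamma process -/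

section LogFunctional

variable {𝓧 : Type u} [MeasurableSpace 𝓧]

/-- The characteristic functional `exp (-α ∫ log (1 + (x h)²) dF)` along the ray through `h`. -/
noncomputable def logFunctional (α : ℝ) (F : Measure 𝓧) (h : 𝓧 → ℝ) (x : ℝ) : ℝ :=
  Real.exp (-(α * ∫ y, Real.log (1 + (x * h y) ^ 2) ∂F))

/-- The mean over `F` of the characteristic functions `(1 + (x h)²)⁻¹`. -/
noncomputable def meanCharFun (F : Measure 𝓧) (h : 𝓧 → ℝ) (x : ℝ) : ℝ :=
  ∫ y, (1 + (x * h y) ^ 2)⁻¹ ∂F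

variable {α : ℝ} {F : Measure 𝓧} {h : 𝓧 → ℝ}

lemma meanCharFun_nonneg (x : ℝ) : 0 ≤ meanCharFun F h x :=
  integral_nonneg fun y => by positivity

lemma logFunctional_nonneg (x : ℝ) : 0 ≤ logFunctional α F h x := (Real.exp_pos _).le

lemma logFunctional_le_one (hα : 0 < α) (x : ℝ) : logFunctional α F h x ≤ 1 := by
  refine Real.exp_le_one_iff.2 (neg_nonpos.2 (mul_nonneg hα.le (integral_nonneg fun y => ?_)))
  exact Real.log_nonneg (by nlinarith [sq_nonneg (x * h y)])

lemma logFunctional_zero : logFunctional α F h 0 = 1 := by simp [logFunctional]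

variable [IsProbabilityMeasure F] {c : ℝ}

lemma integrable_inv_one_add_mul_sq (hh : Measurable h) (x : ℝ) :
    Integrable (fun y => (1 + (x * h y) ^ 2)⁻¹) F := by
  refine Integrable.of_bound (Measurable.aestronglyMeasurable (by fun_prop)) 1
    (ae_of_all _ fun y => ?_)
  rw [Real.norm_eq_abs, abs_of_nonneg (by positivity)]
  exact inv_le_one_of_one_le₀ (by nlinarith [sq_nonneg (x * h y)])

lemma meanCharFun_le_one (hh : Measurable h) (x : ℝ) : meanCharFun F h x ≤ 1 := by
  refine (integral_mono (integrable_inv_one_add_mul_sq hh x) (integrable_const (1 : ℝ))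
    fun y => ?_).trans (by simp)
  exact inv_le_one_of_one_le₀ (by nlinarith [sq_nonneg (x * h y)])

lemma measurable_meanCharFun (hh : Measurable h) : Measurable (meanCharFun F h) := by
  refine (StronglyMeasurable.integral_prod_right'
    (f := fun q : ℝ × 𝓧 => (1 + (q.1 * h q.2) ^ 2)⁻¹) ?_).measurable
  exact Measurable.stronglyMeasurable (by fun_prop)

/-- Differentiation under the integral, with `x ∂ₓ log (1 + (x h)²) = 2 (1 - (1 + (x h)²)⁻¹)`.
Multiplying the derivative by `x` avoids a division at 0. -/
lemma hasDerivAt_logFunctional (hh : Measurable h) (hc : ∀ y, |h y| ≤ c) (x : ℝ) :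
    ∃ d, HasDerivAt (logFunctional α F h) d x ∧
      x * d = -(2 * α * (1 - meanCharFun F h x)) * logFunctional α F h x := by
  have h1 := hasDerivAt_integral_of_dominated_loc_of_deriv_le (μ := F) (s := Metric.ball x 1)
    (F := fun x y => Real.log (1 + (x * h y) ^ 2))
    (F' := fun x y => 2 * x * h y ^ 2 / (1 + (x * h y) ^ 2)) (x₀ := x)
    (bound := fun _ => 2 * (|x| + 1) * c ^ 2) (Metric.ball_mem_nhds x one_pos)
    (Eventually.of_forall fun x => Measurable.aestronglyMeasurable (by fun_prop))
    (by
      refine Integrable.of_bound (Measurable.aestronglyMeasurable (by fun_prop)) (x ^ 2 * c ^ 2)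
        (ae_of_all _ fun y => ?_)
      have h2 : 0 ≤ (x * h y) ^ 2 := by positivity
      rw [Real.norm_eq_abs, abs_of_nonneg (Real.log_nonneg (by linarith))]
      refine (Real.log_le_sub_one_of_pos (by linarith)).trans ?_
      have h4 : h y ^ 2 ≤ c ^ 2 := by
        rw [← sq_abs]
        gcongr
        exact hc y
      rw [add_sub_cancel_left, mul_pow]
      gcongr)
    (Measurable.aestronglyMeasurable (by fun_prop))
    (ae_of_all _ fun y z hz => by
      have h2 : 0 ≤ (z * h y) ^ 2 := by positivity
      have h3 : |z| ≤ |x| + 1 := by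
        have := abs_sub_abs_le_abs_sub z x
        rw [Metric.mem_ball, Real.dist_eq] at hz
        linarith
      have h4 : h y ^ 2 ≤ c ^ 2 := by
        rw [← sq_abs]
        gcongr
        exact hc y
      rw [Real.norm_eq_abs, abs_div, abs_of_nonneg (show 0 ≤ 1 + (z * h y) ^ 2 by positivity),
        abs_mul, abs_mul, abs_of_nonneg (sq_nonneg (h y)), abs_two]
      calc 2 * |z| * h y ^ 2 / (1 + (z * h y) ^ 2) ≤ 2 * |z| * h y ^ 2 :=
            div_le_self (by positivity) (by linarith)
        _ ≤ _ := by gcongr)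
    (integrable_const _)
    (ae_of_all _ fun y z _ => by
      have h2 : HasDerivAt (fun x => 1 + (x * h y) ^ 2) (2 * z * h y ^ 2) z := by
        have := ((((hasDerivAt_id z).mul_const (h y)).pow 2).const_add 1)
        convert! this using 1
        simp
        ring
      exact h2.log (by positivity))
  refine ⟨_, ((h1.2.const_mul α).neg).exp, ?_⟩
  have h3 : x * ∫ y, 2 * x * h y ^ 2 / (1 + (x * h y) ^ 2) ∂F = 2 * (1 - meanCharFun F h x) := by
    have h4 : ∀ y, x * (2 * x * h y ^ 2 / (1 + (x * h y) ^ 2)) =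
        2 * (1 - (1 + (x * h y) ^ 2)⁻¹) := fun y => by
      have : 1 + (x * h y) ^ 2 ≠ 0 := by positivity
      field_simp
      ring
    rw [← integral_const_mul]
    simp_rw [h4]
    rw [integral_const_mul, integral_sub (integrable_const _) (integrable_inv_one_add_mul_sq hh x)]
    simp [meanCharFun]
  simp only [Pi.neg_apply, logFunctional]
  linear_combination (-α * Real.exp (-(α * ∫ y, Real.log (1 + (x * h y) ^ 2) ∂F))) * h3

lemma continuous_logFunctional (hh : Measurable h) (hc : ∀ y, |h y| ≤ c) :
    Continuous (logFunctional α F h) := by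
  refine continuous_iff_continuousAt.2 fun x => ?_
  obtain ⟨d, hd, -⟩ := hasDerivAt_logFunctional (α := α) (F := F) hh hc x
  exact hd.continuousAt

/-- The fixed-point equation behind stick-breaking. Writing `φ` and `g` for the two functionals, the
differential equation gives `d/du (u φ(s u ^ γ)) = g φ` at `s u ^ γ` when `γ = 1 / (2α)`; the
integral is the difference of the values at 1 and 0. -/
lemma integral_meanCharFun_mul_logFunctional (hα : 0 < α) (hh : Measurable h)
    (hc : ∀ y, |h y| ≤ c) (s : ℝ) :
    ∫ u : unitInterval, meanCharFun F h (s * (u : ℝ) ^ (1 / (2 * α))) *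
      logFunctional α F h (s * (u : ℝ) ^ (1 / (2 * α))) = logFunctional α F h s := by
  set γ : ℝ := 1 / (2 * α) with hγ
  have hγ0 : 0 < γ := by positivity
  have hcont := continuous_logFunctional (α := α) (F := F) hh hc
  have hrpow : Continuous fun u : ℝ => u ^ γ := Real.continuous_rpow_const hγ0.le
  rw [integral_subtype measurableSet_Icc fun u : ℝ =>
      meanCharFun F h (s * u ^ γ) * logFunctional α F h (s * u ^ γ),
    integral_Icc_eq_integral_Ioc, ← intervalIntegral.integral_of_le zero_le_one,
    intervalIntegral.integral_eq_sub_of_hasDerivAt_of_le zero_le_one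
      (f := fun u => u * logFunctional α F h (s * u ^ γ))]
  · simp
  · exact Continuous.continuousOn (by fun_prop)
  · intro u hu
    obtain ⟨d, hd, hd'⟩ := hasDerivAt_logFunctional (α := α) (F := F) hh hc (s * u ^ γ)
    have h1 : HasDerivAt (fun u : ℝ => s * u ^ γ) (s * (γ * u ^ (γ - 1))) u :=
      (Real.hasDerivAt_rpow_const (Or.inl hu.1.ne')).const_mul s
    have h2 := (hasDerivAt_id u).mul (hd.comp u h1)
    convert! h2 using 1
    have h3 : u * u ^ (γ - 1) = u ^ γ := by
      rw [Real.rpow_sub_one hu.1.ne']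
      field_simp [hu.1.ne']
    have h4 : γ * (2 * α) = 1 := by rw [hγ]; field_simp
    simp only [id_eq, Function.comp_apply]
    linear_combination (-γ) * hd' - d * s * γ * h3 +
      (1 - meanCharFun F h (s * u ^ γ)) * logFunctional α F h (s * u ^ γ) * h4
  · have hm := measurable_meanCharFun (F := F) hh
    have hm' := hcont.measurable
    refine (intervalIntegrable_const (c := (1 : ℝ))).mono_fun
      (Measurable.aestronglyMeasurable (by fun_prop)) (ae_of_all _ fun u => ?_)
    dsimp only
    rw [norm_one, Real.norm_eq_abs, abs_of_nonneg (mul_nonneg (meanCharFun_nonneg _)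
      (logFunctional_nonneg _))]
    exact mul_le_one₀ (meanCharFun_le_one hh _) (logFunctional_nonneg _)
      (logFunctional_le_one hα _)

end LogFunctional

/-! ### Shifting an infinite product measure -/

section InfiniteProduct

variable {E : Type u}

/-- The sequence `ω` with `z` put in front. -/
def seqCons (z : E) (ω : ℕ → E) : ℕ → E
  | 0 => z
  | n + 1 => ω n

variable [MeasurableSpace E]

lemma measurable_seqCons : Measurable fun q : E × (ℕ → E) => seqCons q.1 q.2 := by
  refine measurable_pi_iff.2 fun n => ?_
  cases n with
  | zero => exact measurable_fst
  | succ n => exact (measurable_pi_apply n).comp measurable_snd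

/-- A finite cylinder, padded with `univ`, becomes one over an initial segment; there coordinate 0
splits off and the remaining ones shift down. -/
lemma map_seqCons_prod (ρ : Measure E) [IsProbabilityMeasure ρ] :
    (ρ.prod (Measure.infinitePi fun _ : ℕ => ρ)).map (fun q => seqCons q.1 q.2) =
      Measure.infinitePi fun _ : ℕ => ρ := by
  classical
  refine Measure.eq_infinitePi _ fun s t ht => ?_
  set t' : ℕ → Set E := fun i => if i ∈ s then t i else Set.univ with ht'
  have ht'm : ∀ i, MeasurableSet (t' i) := fun i => by
    by_cases hi : i ∈ s <;> simp [ht', hi, ht]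
  obtain ⟨n, hn⟩ : ∃ n, s ⊆ Finset.range (n + 1) :=
    ⟨s.sup id, fun i hi => Finset.mem_range.2 (Nat.lt_succ_of_le (Finset.le_sup (f := id) hi))⟩
  have h1 : (s : Set ℕ).pi t = (Finset.range (n + 1) : Set ℕ).pi t' := by
    ext ω
    simp only [Set.mem_pi, Finset.mem_coe, ht']
    constructor
    · intro h i _
      by_cases hi : i ∈ s
      · simpa [hi] using h i hi
      · simp [hi]
    · intro h i hi
      simpa [hi] using h i (hn hi)
  have h2 : ∏ i ∈ s, ρ (t i) = ∏ i ∈ Finset.range (n + 1), ρ (t' i) := by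
    rw [← Finset.prod_subset hn (f := fun i => ρ (t' i))]
    · exact Finset.prod_congr rfl fun i hi => by simp [ht', hi]
    · intro i _ hi
      simp [ht', hi]
  have h3 : (fun q : E × (ℕ → E) => seqCons q.1 q.2) ⁻¹'
      ((Finset.range (n + 1) : Set ℕ).pi t') =
      t' 0 ×ˢ (Finset.range n : Set ℕ).pi fun i => t' (i + 1) := by
    ext q
    simp only [Set.mem_preimage, Set.mem_pi, Finset.mem_coe, Finset.mem_range, Set.mem_prod]
    constructor
    · exact fun h => ⟨h 0 (by omega), fun i hi => h (i + 1) (by omega)⟩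
    · rintro ⟨ha, hb⟩ i hi
      cases i with
      | zero => exact ha
      | succ i => exact hb i (by omega)
  rw [h1, h2, Measure.map_apply measurable_seqCons
    (MeasurableSet.pi (Finset.countable_toSet _) fun i _ => ht'm i), h3, Measure.prod_prod,
    Measure.infinitePi_pi _ fun i _ => ht'm _, Finset.prod_range_succ', mul_comm]

lemma integral_infinitePi_eq_integral_seqCons (ρ : Measure E) [IsProbabilityMeasure ρ]
    {f : (ℕ → E) → ℂ} (hf : Measurable f) {c : ℝ} (hc : ∀ ω, ‖f ω‖ ≤ c) :
    ∫ ω, f ω ∂(Measure.infinitePi fun _ : ℕ => ρ) =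
      ∫ z, ∫ ω, f (seqCons z ω) ∂(Measure.infinitePi fun _ : ℕ => ρ) ∂ρ := by
  conv_lhs => rw [← map_seqCons_prod ρ]
  rw [integral_map measurable_seqCons.aemeasurable hf.aestronglyMeasurable, integral_prod]
  exact Integrable.of_bound (hf.comp measurable_seqCons).aestronglyMeasurable c
    (ae_of_all _ fun q => hc _)

lemma lintegral_infinitePi_eq_lintegral_seqCons (ρ : Measure E) [IsProbabilityMeasure ρ]
    {f : (ℕ → E) → ℝ≥0∞} (hf : Measurable f) :
    ∫⁻ ω, f ω ∂(Measure.infinitePi fun _ : ℕ => ρ) =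
      ∫⁻ z, ∫⁻ ω, f (seqCons z ω) ∂(Measure.infinitePi fun _ : ℕ => ρ) ∂ρ := by
  conv_lhs => rw [← map_seqCons_prod ρ]
  rw [lintegral_map hf measurable_seqCons]
  exact lintegral_prod _ (hf.comp measurable_seqCons).aemeasurable

end InfiniteProduct

/-! ### A stick-breaking construction of the symmetric Gamma random measure -/

section StickBreaking

variable {𝓧 : Type u}

/-- The stick proportion with law `Beta(2α, 1)` obtained from a uniform random variable. -/
noncomputable def stickFactor (α : ℝ) (z : unitInterval × ℝ × 𝓧) : ℝ := (z.1 : ℝ) ^ (1 / (2 * α))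

/-- The length of the stick remaining after `n` steps. -/
noncomputable def stickWeight (α : ℝ) (ω : ℕ → unitInterval × ℝ × 𝓧) (n : ℕ) : ℝ :=
  ∏ j ∈ Finset.range n, stickFactor α (ω j)

/-- The mass of the `n`-th atom. -/
noncomputable def stickCoeff (α : ℝ) (ω : ℕ → unitInterval × ℝ × 𝓧) (n : ℕ) : ℝ :=
  (ω n).2.1 * stickWeight α ω (n + 1)

/-- The integral of `h` against the first `n` atoms. -/
noncomputable def stickSum (α : ℝ) (h : 𝓧 → ℝ) (ω : ℕ → unitInterval × ℝ × 𝓧) (n : ℕ) : ℝ :=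
  ∑ i ∈ Finset.range n, stickCoeff α ω i * h (ω i).2.2

lemma stickFactor_nonneg (α : ℝ) (z : unitInterval × ℝ × 𝓧) : 0 ≤ stickFactor α z :=
  Real.rpow_nonneg z.1.2.1 _

lemma stickFactor_le_one {α : ℝ} (hα : 0 < α) (z : unitInterval × ℝ × 𝓧) :
    stickFactor α z ≤ 1 :=
  Real.rpow_le_one z.1.2.1 z.1.2.2 (by positivity)

lemma stickWeight_nonneg (α : ℝ) (ω : ℕ → unitInterval × ℝ × 𝓧) (n : ℕ) :
    0 ≤ stickWeight α ω n :=
  Finset.prod_nonneg fun _ _ => stickFactor_nonneg _ _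

lemma stickWeight_seqCons (α : ℝ) (z : unitInterval × ℝ × 𝓧) (ω : ℕ → unitInterval × ℝ × 𝓧)
    (n : ℕ) : stickWeight α (seqCons z ω) (n + 1) = stickFactor α z * stickWeight α ω n := by
  rw [stickWeight, Finset.prod_range_succ', mul_comm]
  rfl

lemma stickCoeff_seqCons_zero (α : ℝ) (z : unitInterval × ℝ × 𝓧)
    (ω : ℕ → unitInterval × ℝ × 𝓧) :
    stickCoeff α (seqCons z ω) 0 = stickFactor α z * z.2.1 := by
  rw [stickCoeff, stickWeight_seqCons]
  simp [seqCons, stickWeight, mul_comm]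

lemma stickCoeff_seqCons_succ (α : ℝ) (z : unitInterval × ℝ × 𝓧)
    (ω : ℕ → unitInterval × ℝ × 𝓧) (n : ℕ) :
    stickCoeff α (seqCons z ω) (n + 1) = stickFactor α z * stickCoeff α ω n := by
  rw [stickCoeff, stickWeight_seqCons, stickCoeff]
  simp only [seqCons]
  ring

/-- Self-similarity: after the first atom, the rest is a copy of the construction scaled by the
first stick factor. -/
lemma stickSum_seqCons (α : ℝ) (h : 𝓧 → ℝ) (z : unitInterval × ℝ × 𝓧)
    (ω : ℕ → unitInterval × ℝ × 𝓧) (n : ℕ) :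
    stickSum α h (seqCons z ω) (n + 1) =
      stickFactor α z * (z.2.1 * h z.2.2) + stickFactor α z * stickSum α h ω n := by
  rw [stickSum, Finset.sum_range_succ', stickCoeff_seqCons_zero, stickSum, Finset.mul_sum,
    add_comm]
  congr 1
  · simp only [seqCons]
    ring
  · refine Finset.sum_congr rfl fun i _ => ?_
    rw [stickCoeff_seqCons_succ]
    simp only [seqCons]
    ring

lemma abs_stickCoeff_le (α : ℝ) (ω : ℕ → unitInterval × ℝ × 𝓧) (n : ℕ) :
    |stickCoeff α ω n| ≤ (|(ω n).2.1| + 1) * stickWeight α ω (n + 1) := by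
  rw [stickCoeff, abs_mul, abs_of_nonneg (stickWeight_nonneg _ _ _)]
  exact mul_le_mul_of_nonneg_right (by linarith) (stickWeight_nonneg _ _ _)

lemma summable_stickCoeff_mul {α : ℝ} {h : 𝓧 → ℝ} {c : ℝ} {ω : ℕ → unitInterval × ℝ × 𝓧}
    (hω : Summable fun n => |stickCoeff α ω n|) (hc : ∀ y, |h y| ≤ c) :
    Summable fun n => stickCoeff α ω n * h (ω n).2.2 := by
  refine Summable.of_norm_bounded (hω.mul_right c) fun n => ?_
  rw [Real.norm_eq_abs, abs_mul]
  exact mul_le_mul_of_nonneg_left (hc _) (abs_nonneg _)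

variable [MeasurableSpace 𝓧]

@[fun_prop]
lemma measurable_stickFactor (α : ℝ) : Measurable (stickFactor (𝓧 := 𝓧) α) := by
  unfold stickFactor
  fun_prop

@[fun_prop]
lemma measurable_stickWeight (α : ℝ) (n : ℕ) :
    Measurable fun ω : ℕ → unitInterval × ℝ × 𝓧 => stickWeight α ω n := by
  unfold stickWeight
  fun_prop

@[fun_prop]
lemma measurable_stickCoeff (α : ℝ) (n : ℕ) :
    Measurable fun ω : ℕ → unitInterval × ℝ × 𝓧 => stickCoeff α ω n := by
  unfold stickCoeff
  fun_prop

lemma measurable_stickSum (α : ℝ) {h : 𝓧 → ℝ} (hh : Measurable h) (n : ℕ) :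
    Measurable fun ω : ℕ → unitInterval × ℝ × 𝓧 => stickSum α h ω n := by
  unfold stickSum
  fun_prop

/-! ### The stick-breaking signed measure -/

/-- The signed measure `∑ n, r • stickCoeff n • δ_{ξ n}`, and `0` if the sum does not converge. -/
noncomputable def stickMeasure (α r : ℝ) (ω : ℕ → unitInterval × ℝ × 𝓧) : SignedMeasure 𝓧 :=
  (Measure.count.withDensityᵥ fun n => r * stickCoeff α ω n).map fun n => (ω n).2.2

lemma stickMeasure_apply_of_summable {α r : ℝ} {ω : ℕ → unitInterval × ℝ × 𝓧}
    (hω : Summable fun n => |stickCoeff α ω n|) {A : Set 𝓧} (hA : MeasurableSet A) :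
    stickMeasure α r ω A = ∑' n, stickCoeff α ω n * (r * A.indicator 1 (ω n).2.2) := by
  have hint : Integrable (fun n => r * stickCoeff α ω n) Measure.count := by
    rw [integrable_count_iff]
    simp_rw [Real.norm_eq_abs, abs_mul]
    exact hω.mul_left _
  have hpre : MeasurableSet ((fun n => (ω n).2.2) ⁻¹' A) := MeasurableSet.of_discrete
  rw [stickMeasure, VectorMeasure.map_apply _ (measurable_from_nat) hA,
    withDensityᵥ_apply hint hpre, ← integral_indicator hpre,
    integral_countable (hint.indicator hpre)]
  refine tsum_congr fun n => ?_
  by_cases hn : (ω n).2.2 ∈ A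
  · rw [Set.indicator_of_mem (by exact hn), Set.indicator_of_mem hn]
    simp [measureReal_def, mul_comm]
  · rw [Set.indicator_of_notMem (by exact hn), Set.indicator_of_notMem hn]
    simp

/-- Measurability is needed everywhere, not only almost everywhere. The event of summability is
measurable and the default value off it is 0. -/
lemma measurable_stickMeasure_apply (α r : ℝ) {A : Set 𝓧} (hA : MeasurableSet A) :
    Measurable fun ω : ℕ → unitInterval × ℝ × 𝓧 => stickMeasure α r ω A := by
  classical
  have hm : StronglyMeasurable (Function.uncurry fun (ω : ℕ → unitInterval × ℝ × 𝓧) (n : ℕ) =>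
      r * stickCoeff α ω n) := by
    refine Measurable.stronglyMeasurable (measurable_from_prod_countable_left fun n => ?_)
    simp only [Function.uncurry_apply_pair]
    fun_prop
  have hm' : StronglyMeasurable (Function.uncurry fun (ω : ℕ → unitInterval × ℝ × 𝓧) (n : ℕ) =>
      ((fun n => (ω n).2.2) ⁻¹' A).indicator (fun n => r * stickCoeff α ω n) n) := by
    refine Measurable.stronglyMeasurable (measurable_from_prod_countable_left fun n => ?_)
    have hs : MeasurableSet {ω : ℕ → unitInterval × ℝ × 𝓧 | (ω n).2.2 ∈ A} :=
      (measurable_snd.comp (measurable_snd.comp (measurable_pi_apply n))) hA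
    have h1 : Measurable fun ω : ℕ → unitInterval × ℝ × 𝓧 => r * stickCoeff α ω n := by fun_prop
    exact h1.indicator hs
  have h1 : (fun ω : ℕ → unitInterval × ℝ × 𝓧 => stickMeasure α r ω A) =
      {ω | Integrable (fun n => r * stickCoeff α ω n) Measure.count}.indicator fun ω =>
        ∫ n, ((fun n => (ω n).2.2) ⁻¹' A).indicator (fun n => r * stickCoeff α ω n) n
          ∂Measure.count := by
    ext ω
    rw [stickMeasure, VectorMeasure.map_apply _ (measurable_from_nat) hA]
    have hpre : MeasurableSet ((fun n => (ω n).2.2) ⁻¹' A) := MeasurableSet.of_discrete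
    by_cases hω : Integrable (fun n => r * stickCoeff α ω n) Measure.count
    · rw [Set.indicator_of_mem (by exact hω), withDensityᵥ_apply hω hpre, integral_indicator hpre]
    · rw [Set.indicator_of_notMem (by exact hω), Measure.withDensityᵥ, dif_neg hω]
      rfl
  rw [h1]
  exact (hm'.integral_prod_right (ν := Measure.count)).measurable.indicator
    (measurableSet_integrable hm)

/-! ### The characteristic functional of the stick-breaking series -/

/-- The law of a stick proportion, a jump with law `κ` and a location with law `F`. -/
noncomputable def stickLaw (κ : Measure ℝ) (F : Measure 𝓧) : Measure (unitInterval × ℝ × 𝓧) :=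
  (volume : Measure unitInterval).prod (κ.prod F)

variable {α : ℝ} {F : Measure 𝓧} [IsProbabilityMeasure F] {κ : Measure ℝ} [IsProbabilityMeasure κ]
  {h : 𝓧 → ℝ} {c : ℝ}

instance isProbabilityMeasure_stickLaw : IsProbabilityMeasure (stickLaw κ F) := by
  unfold stickLaw
  infer_instance

/-- Averaging over the jump and location produces the mean characteristic function; averaging over
the stick factor is then the fixed-point equation. -/
lemma integral_exp_stickLaw (hκ : ∀ t, charFun κ t = (((1 + t ^ 2)⁻¹ : ℝ) : ℂ)) (hα : 0 < α)
    (hh : Measurable h) (hc : ∀ y, |h y| ≤ c) (s : ℝ) :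
    ∫ z, Complex.exp (((s * stickFactor α z) * (z.2.1 * h z.2.2) : ℝ) * Complex.I) *
      (logFunctional α F h (s * stickFactor α z) : ℂ) ∂stickLaw κ F =
      (logFunctional α F h s : ℂ) := by
  have hφ := (continuous_logFunctional (α := α) (F := F) hh hc).measurable
  have hbound : ∀ (r x : ℝ), ‖Complex.exp ((r : ℝ) * Complex.I) *
      (logFunctional α F h x : ℂ)‖ ≤ 1 := fun r x => by
    rw [norm_mul, Complex.norm_exp_ofReal_mul_I, one_mul, Complex.norm_real, Real.norm_eq_abs,
      abs_of_nonneg (logFunctional_nonneg _)]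
    exact logFunctional_le_one hα _
  have hinner : ∀ x : ℝ, ∫ y : ℝ × 𝓧, Complex.exp ((x * (y.1 * h y.2) : ℝ) * Complex.I)
      ∂κ.prod F = (meanCharFun F h x : ℂ) := by
    intro x
    rw [integral_prod_symm, meanCharFun, ← integral_complex_ofReal]
    · refine integral_congr_ae (ae_of_all _ fun y => ?_)
      have h1 := hκ (x * h y)
      rw [charFun_apply_real] at h1
      dsimp only
      rw [← h1]
      refine integral_congr_ae (ae_of_all _ fun j => ?_)
      dsimp only
      congr 1
      push_cast
      ring
    · refine Integrable.of_bound (Measurable.aestronglyMeasurable (by fun_prop)) 1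
        (ae_of_all _ fun y => ?_)
      rw [Complex.norm_exp_ofReal_mul_I]
  rw [stickLaw, integral_prod]
  · simp only [stickFactor]
    simp_rw [integral_mul_const, hinner]
    rw [← integral_meanCharFun_mul_logFunctional hα hh hc s, ← integral_complex_ofReal]
    push_cast
    rfl
  · exact Integrable.of_bound (Measurable.aestronglyMeasurable (by fun_prop)) 1
      (ae_of_all _ fun z => hbound _ _)

/-- Iterated fixed-point equation: the expectation is the same for every `n`, by splitting off the
first coordinate. The scale `s` must vary in the induction. -/
lemma integral_exp_stickSum (hκ : ∀ t, charFun κ t = (((1 + t ^ 2)⁻¹ : ℝ) : ℂ)) (hα : 0 < α)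
    (hh : Measurable h) (hc : ∀ y, |h y| ≤ c) (n : ℕ) (s : ℝ) :
    ∫ ω, Complex.exp ((s * stickSum α h ω n : ℝ) * Complex.I) *
      (logFunctional α F h (s * stickWeight α ω n) : ℂ)
      ∂(Measure.infinitePi fun _ : ℕ => stickLaw κ F) = (logFunctional α F h s : ℂ) := by
  have hφ := (continuous_logFunctional (α := α) (F := F) hh hc).measurable
  have hbound : ∀ (r x : ℝ), ‖Complex.exp ((r : ℝ) * Complex.I) *
      (logFunctional α F h x : ℂ)‖ ≤ 1 := fun r x => by
    rw [norm_mul, Complex.norm_exp_ofReal_mul_I, one_mul, Complex.norm_real, Real.norm_eq_abs,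
      abs_of_nonneg (logFunctional_nonneg _)]
    exact logFunctional_le_one hα _
  induction n generalizing s with
  | zero => simp [stickSum, stickWeight]
  | succ n ih =>
    have hm := measurable_stickSum α hh (n + 1)
    have hm' : Measurable fun ω : ℕ → unitInterval × ℝ × 𝓧 =>
        Complex.exp ((s * stickSum α h ω (n + 1) : ℝ) * Complex.I) *
          (logFunctional α F h (s * stickWeight α ω (n + 1)) : ℂ) :=
      Measurable.mul (by fun_prop) (by fun_prop)
    rw [integral_infinitePi_eq_integral_seqCons _ hm' fun ω => hbound _ _]
    rw [← integral_exp_stickLaw (F := F) hκ hα hh hc s]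
    refine integral_congr_ae (ae_of_all _ fun z => ?_)
    dsimp only
    rw [← ih (s * stickFactor α z), ← integral_const_mul]
    refine integral_congr_ae (ae_of_all _ fun ω => ?_)
    dsimp only
    rw [stickSum_seqCons, stickWeight_seqCons,
      ← mul_assoc s (stickFactor α z) (stickWeight α ω n), ← mul_assoc (Complex.exp _),
      ← Complex.exp_add]
    congr 2
    push_cast
    ring

/-! ### Summability of the atoms -/

lemma lintegral_stickFactor_lt_one (hα : 0 < α) :
    ∫⁻ z, ENNReal.ofReal (stickFactor α z) ∂stickLaw κ F < 1 := by
  have hγ : 0 < 1 / (2 * α) := by positivity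
  have h1 : ∫ u : unitInterval, (u : ℝ) ^ (1 / (2 * α)) = 1 / (1 / (2 * α) + 1) := by
    rw [integral_subtype measurableSet_Icc fun u : ℝ => u ^ (1 / (2 * α)),
      integral_Icc_eq_integral_Ioc, ← intervalIntegral.integral_of_le zero_le_one,
      integral_rpow (Or.inl (by linarith)), Real.one_rpow, Real.zero_rpow (by linarith), sub_zero]
  have h2 : ∫⁻ z, ENNReal.ofReal (stickFactor α z) ∂stickLaw κ F =
      ∫⁻ u : unitInterval, ENNReal.ofReal ((u : ℝ) ^ (1 / (2 * α))) := by
    rw [stickLaw, lintegral_prod _ (by fun_prop)]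
    simp [stickFactor]
  rw [h2, ← ofReal_integral_eq_lintegral_ofReal, h1]
  · rw [ENNReal.ofReal_lt_one, div_lt_one (by positivity)]
    linarith
  · refine Integrable.of_bound (Measurable.aestronglyMeasurable (by fun_prop)) 1
      (ae_of_all _ fun u => ?_)
    rw [Real.norm_eq_abs, abs_of_nonneg (Real.rpow_nonneg u.2.1 _)]
    exact Real.rpow_le_one u.2.1 u.2.2 hγ.le
  · exact ae_of_all _ fun u => Real.rpow_nonneg u.2.1 _

lemma lintegral_jump_mul_stickFactor_lt_top (hα : 0 < α) (hκ1 : Integrable id κ) :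
    ∫⁻ z, ENNReal.ofReal ((|z.2.1| + 1) * stickFactor α z) ∂stickLaw κ F < ∞ := by
  calc ∫⁻ z, ENNReal.ofReal ((|z.2.1| + 1) * stickFactor α z) ∂stickLaw κ F
      ≤ ∫⁻ z, ENNReal.ofReal (|z.2.1| + 1) ∂stickLaw κ F := by
        refine lintegral_mono fun z => ENNReal.ofReal_le_ofReal ?_
        exact mul_le_of_le_one_right (by positivity) (stickFactor_le_one hα z)
    _ = ∫⁻ j, ENNReal.ofReal (|j| + 1) ∂κ := by
        rw [stickLaw, lintegral_prod _ (by fun_prop)]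
        simp only [lintegral_const, measure_univ, mul_one]
        rw [lintegral_prod _ (by fun_prop)]
        simp
    _ < ∞ := by
        have h1 : Integrable (fun j : ℝ => |j| + 1) κ := hκ1.abs.add (integrable_const _)
        have h2 := (hasFiniteIntegral_iff_ofReal (ae_of_all _ fun j : ℝ => by positivity)).1 h1.2
        exact h2

/-- Each coordinate peeled off contributes one mean stick factor. The factor sharing its index with
the jump stays with the jump, which leaves the power `n`. -/
lemma lintegral_jump_mul_stickWeight (n : ℕ) :
    ∫⁻ ω, ENNReal.ofReal ((|(ω n).2.1| + 1) * stickWeight α ω (n + 1))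
      ∂(Measure.infinitePi fun _ : ℕ => stickLaw κ F) =
    (∫⁻ z, ENNReal.ofReal (stickFactor α z) ∂stickLaw κ F) ^ n *
      ∫⁻ z, ENNReal.ofReal ((|z.2.1| + 1) * stickFactor α z) ∂stickLaw κ F := by
  induction n with
  | zero =>
    rw [lintegral_infinitePi_eq_lintegral_seqCons _ (by fun_prop), pow_zero, one_mul]
    refine lintegral_congr fun z => ?_
    simp only [stickWeight_seqCons]
    simp [seqCons, stickWeight]
  | succ n ih =>
    rw [lintegral_infinitePi_eq_lintegral_seqCons _ (by fun_prop), pow_succ', mul_assoc, ← ih,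
      ← lintegral_mul_const _ (by fun_prop)]
    refine lintegral_congr fun z => ?_
    rw [← lintegral_const_mul _ (by fun_prop)]
    refine lintegral_congr fun ω => ?_
    rw [stickWeight_seqCons, ← ENNReal.ofReal_mul (stickFactor_nonneg _ _)]
    simp only [seqCons]
    congr 1
    ring

/-- The expectations form a geometric series with ratio below 1. The `+ 1` makes one series dominate
both the atoms and the remaining stick lengths. -/
lemma ae_summable_jump_mul_stickWeight (hα : 0 < α) (hκ1 : Integrable id κ) :
    ∀ᵐ ω ∂(Measure.infinitePi fun _ : ℕ => stickLaw κ F),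
      Summable fun n => (|(ω n).2.1| + 1) * stickWeight α ω (n + 1) := by
  have h1 : ∫⁻ ω, ∑' n, ENNReal.ofReal ((|(ω n).2.1| + 1) * stickWeight α ω (n + 1))
      ∂(Measure.infinitePi fun _ : ℕ => stickLaw κ F) ≠ ∞ := by
    rw [lintegral_tsum fun n => by fun_prop]
    simp_rw [lintegral_jump_mul_stickWeight]
    rw [ENNReal.tsum_mul_right, ENNReal.tsum_geometric]
    refine ENNReal.mul_ne_top (ENNReal.inv_ne_top.2 ?_)
      (lintegral_jump_mul_stickFactor_lt_top hα hκ1).ne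
    exact (tsub_pos_of_lt (lintegral_stickFactor_lt_one hα)).ne'
  filter_upwards [ae_lt_top (by fun_prop) h1] with ω hω
  refine (ENNReal.summable_toReal hω.ne).congr fun n => ?_
  exact ENNReal.toReal_ofReal (mul_nonneg (by positivity) (stickWeight_nonneg _ _ _))

lemma ae_summable_abs_stickCoeff (hα : 0 < α) (hκ1 : Integrable id κ) :
    ∀ᵐ ω ∂(Measure.infinitePi fun _ : ℕ => stickLaw κ F),
      Summable fun n => |stickCoeff α ω n| := by
  filter_upwards [ae_summable_jump_mul_stickWeight hα hκ1] with ω hω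
  exact hω.of_nonneg_of_le (fun n => abs_nonneg _) fun n => abs_stickCoeff_le α ω n

lemma ae_tendsto_stickWeight (hα : 0 < α) (hκ1 : Integrable id κ) :
    ∀ᵐ ω ∂(Measure.infinitePi fun _ : ℕ => stickLaw κ F),
      Tendsto (fun n => stickWeight α ω n) atTop (𝓝 0) := by
  filter_upwards [ae_summable_jump_mul_stickWeight hα hκ1] with ω hω
  refine (tendsto_add_atTop_iff_nat 1).1 ?_
  refine squeeze_zero (fun n => stickWeight_nonneg _ _ _) (fun n => ?_) hω.tendsto_atTop_zero
  exact le_mul_of_one_le_left (stickWeight_nonneg _ _ _) (by linarith [abs_nonneg (ω n).2.1])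

/-- As `n → ∞` the remaining stick tends to 0, where the functional equals 1, and the partial sums
converge almost surely. -/
lemma integral_exp_tsum_stickCoeff (hκ : ∀ t, charFun κ t = (((1 + t ^ 2)⁻¹ : ℝ) : ℂ))
    (hκ1 : Integrable id κ) (hα : 0 < α) (hh : Measurable h) (hc : ∀ y, |h y| ≤ c) :
    ∫ ω, Complex.exp (((∑' n, stickCoeff α ω n * h (ω n).2.2 : ℝ) : ℂ) * Complex.I)
      ∂(Measure.infinitePi fun _ : ℕ => stickLaw κ F) = (logFunctional α F h 1 : ℂ) := by
  have hφ := continuous_logFunctional (α := α) (F := F) hh hc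
  have h1 : Tendsto (fun n => ∫ ω, Complex.exp ((1 * stickSum α h ω n : ℝ) * Complex.I) *
      (logFunctional α F h (1 * stickWeight α ω n) : ℂ)
      ∂(Measure.infinitePi fun _ : ℕ => stickLaw κ F)) atTop
      (𝓝 (∫ ω, Complex.exp (((∑' n, stickCoeff α ω n * h (ω n).2.2 : ℝ) : ℂ) * Complex.I) *
        ((1 : ℝ) : ℂ) ∂(Measure.infinitePi fun _ : ℕ => stickLaw κ F))) := by
    refine tendsto_integral_of_dominated_convergence (fun _ => 1) (fun n => ?_)
      (integrable_const _) (fun n => ae_of_all _ fun ω => ?_) ?_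
    · have hm := measurable_stickSum α hh n
      have hφm := hφ.measurable
      exact (Measurable.mul (by fun_prop) (by fun_prop)).aestronglyMeasurable
    · rw [norm_mul, Complex.norm_exp_ofReal_mul_I, one_mul, Complex.norm_real, Real.norm_eq_abs,
        abs_of_nonneg (logFunctional_nonneg _)]
      exact logFunctional_le_one hα _
    · filter_upwards [ae_summable_abs_stickCoeff (F := F) hα hκ1,
        ae_tendsto_stickWeight (F := F) hα hκ1] with ω hω hω'
      have h2 : Tendsto (fun n => stickSum α h ω n) atTop
          (𝓝 (∑' n, stickCoeff α ω n * h (ω n).2.2)) :=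
        (summable_stickCoeff_mul hω hc).hasSum.tendsto_sum_nat
      have h3 : Tendsto (fun n => logFunctional α F h (1 * stickWeight α ω n)) atTop (𝓝 1) := by
        have := (hφ.tendsto 0).comp hω'
        rw [logFunctional_zero] at this
        simpa [Function.comp_def] using this
      have hcont : Continuous fun z : ℝ => Complex.exp ((1 * z : ℝ) * Complex.I) := by fun_prop
      have h4 := (hcont.tendsto _).comp h2
      rw [one_mul] at h4
      exact h4.mul ((Complex.continuous_ofReal.tendsto _).comp h3)
  simp_rw [integral_exp_stickSum hκ hα hh hc] at h1
  have := tendsto_nhds_unique h1 tendsto_const_nhds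
  simpa using this

/-! ### Values of the stick-breaking measure on disjoint sets -/

lemma logFunctional_sum_indicator {b : ℝ} {k : ℕ} {A : Fin k → Set 𝓧}
    (hA : ∀ i, MeasurableSet (A i)) (hdisj : Pairwise fun i j => Disjoint (A i) (A j))
    (t : Fin k → ℝ) :
    logFunctional α F (fun y => ∑ i, t i * (b⁻¹ * (A i).indicator 1 y)) 1 =
      ∏ i, (1 + t i ^ 2 / b ^ 2) ^ (-(α * F.real (A i))) := by
  -- By disjointness at most one indicator is nonzero at `y`, so the logarithm splits into a sum.
  have h1 : ∀ y, Real.log (1 + (1 * ∑ i, t i * (b⁻¹ * (A i).indicator 1 y)) ^ 2) =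
      ∑ i, (A i).indicator (fun _ => Real.log (1 + t i ^ 2 / b ^ 2)) y := by
    intro y
    by_cases hy : ∃ j, y ∈ A j
    · obtain ⟨j, hj⟩ := hy
      have hne : ∀ i, i ≠ j → y ∉ A i := fun i hij hi =>
        Set.disjoint_left.1 (hdisj hij) hi hj
      rw [Finset.sum_eq_single j, Finset.sum_eq_single j]
      · simp [Set.indicator_of_mem hj, mul_pow, div_eq_mul_inv]
      · intro i _ hij
        exact Set.indicator_of_notMem (hne i hij) _
      · simp
      · intro i _ hij
        simp [Set.indicator_of_notMem (hne i hij)]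
      · simp
    · have hne : ∀ i, y ∉ A i := fun i hi => hy ⟨i, hi⟩
      simp [hne]
  rw [logFunctional]
  simp_rw [h1]
  rw [integral_finsetSum _ fun i _ => (integrable_const _).indicator (hA i), Finset.mul_sum,
    ← Finset.sum_neg_distrib, Real.exp_sum]
  refine Finset.prod_congr rfl fun i _ => ?_
  rw [integral_indicator_const _ (hA i), Real.rpow_def_of_pos (by positivity), smul_eq_mul]
  congr 1
  ring

/-- A combination of values on sets is the pairing with a combination of indicators. This joint
characteristic function yields both the marginal laws and their independence. -/
lemma integral_exp_sum_stickMeasure (hκ : ∀ t, charFun κ t = (((1 + t ^ 2)⁻¹ : ℝ) : ℂ))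
    (hκ1 : Integrable id κ) (hα : 0 < α) {b : ℝ} {k : ℕ} {A : Fin k → Set 𝓧}
    (hA : ∀ i, MeasurableSet (A i)) (hdisj : Pairwise fun i j => Disjoint (A i) (A j))
    (t : Fin k → ℝ) :
    ∫ ω, Complex.exp (((∑ i, t i * stickMeasure α b⁻¹ ω (A i) : ℝ) : ℂ) * Complex.I)
      ∂(Measure.infinitePi fun _ : ℕ => stickLaw κ F) =
      ((∏ i, (1 + t i ^ 2 / b ^ 2) ^ (-(α * F.real (A i))) : ℝ) : ℂ) := by
  set h : 𝓧 → ℝ := fun y => ∑ i, t i * (b⁻¹ * (A i).indicator 1 y) with hh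
  have hind : ∀ i y, |(A i).indicator (1 : 𝓧 → ℝ) y| ≤ 1 := fun i y => by
    by_cases hy : y ∈ A i <;> simp [hy]
  have hm : Measurable h := by
    have : ∀ i, Measurable ((A i).indicator (1 : 𝓧 → ℝ)) := fun i =>
      measurable_one.indicator (hA i)
    fun_prop
  have hc : ∀ y, |h y| ≤ ∑ i, |t i| * (|b⁻¹| * 1) := fun y => by
    refine (Finset.abs_sum_le_sum_abs _ _).trans (Finset.sum_le_sum fun i _ => ?_)
    rw [abs_mul, abs_mul]
    gcongr
    exact hind i y
  rw [← logFunctional_sum_indicator hA hdisj t, ← integral_exp_tsum_stickCoeff hκ hκ1 hα hm hc]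
  refine integral_congr_ae ?_
  filter_upwards [ae_summable_abs_stickCoeff (F := F) hα hκ1] with ω hω
  congr 3
  have hsum : ∀ i, Summable fun n =>
      stickCoeff α ω n * (t i * (b⁻¹ * (A i).indicator 1 (ω n).2.2)) := fun i =>
    summable_stickCoeff_mul (h := fun y => t i * (b⁻¹ * (A i).indicator 1 y)) hω
      (c := |t i| * (|b⁻¹| * 1)) fun y => by
        rw [abs_mul, abs_mul]
        gcongr
        exact hind i y
  simp_rw [stickMeasure_apply_of_summable hω (hA _), hh, Finset.mul_sum]
  rw [Summable.tsum_finsetSum fun i _ => hsum i]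
  refine Finset.sum_congr rfl fun i _ => ?_
  rw [← tsum_mul_left]
  exact tsum_congr fun n => by ring

/-- The stick-breaking measure is a symmetric Gamma random measure. -/
theorem isSymmetricGammaRandomMeasure_stickMeasure
    (hκ : ∀ t, charFun κ t = (((1 + t ^ 2)⁻¹ : ℝ) : ℂ))
    (hκ1 : Integrable id κ) (hα : 0 < α) (b : ℝ) :
    IsSymmetricGammaRandomMeasure (stickMeasure (𝓧 := 𝓧) α b⁻¹) α F b
      (Measure.infinitePi fun _ : ℕ => stickLaw κ F) := by
  have hlaw : ∀ A : Set 𝓧, MeasurableSet A → HasSymmetricGammaLaw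
      (fun ω => stickMeasure (𝓧 := 𝓧) α b⁻¹ ω A) (α * F.real A) b
      (Measure.infinitePi fun _ : ℕ => stickLaw κ F) := by
    intro A hA
    refine ⟨(measurable_stickMeasure_apply α _ hA).aemeasurable, fun t => ?_⟩
    have h1 := integral_exp_sum_stickMeasure (F := F) hκ hκ1 hα (b := b) (k := 1)
      (A := fun _ => A) (fun _ => hA) (fun i j hij => absurd (Subsingleton.elim i j) hij)
      fun _ => t
    rw [charFun_apply_real, integral_map (measurable_stickMeasure_apply α _ hA).aemeasurable
      (Measurable.aestronglyMeasurable (by fun_prop))]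
    simpa using h1
  refine ⟨fun A hA => measurable_stickMeasure_apply α _ hA, hlaw, fun k A hA hdisj => ?_⟩
  have hm := fun i => measurable_stickMeasure_apply (𝓧 := 𝓧) α b⁻¹ (hA i)
  -- Independence holds because the joint characteristic function is the product of the marginal
  -- ones.
  rw [iIndepFun_iff_charFun_pi fun i => (hm i).aemeasurable]
  intro t
  simp_rw [(hlaw _ (hA _)).charFun_eq]
  rw [← Complex.ofReal_prod, ← integral_exp_sum_stickMeasure (F := F) hκ hκ1 hα (b := b) hA hdisj t,
    charFun_apply, integral_map (by fun_prop) (Measurable.aestronglyMeasurable (by fun_prop))]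
  simp [PiLp.inner_apply]

end StickBreaking

/-! ### Existence and convergence combined -/

theorem theorem2 {𝓧 : Type u} [TopologicalSpace 𝓧] [PolishSpace 𝓧] [MeasurableSpace 𝓧]
    [BorelSpace 𝓧] (α η : ℝ) (hα : 0 < α) (hη : 0 < η)
    (F : Measure 𝓧) [IsProbabilityMeasure F]
    (Ω : ℕ → Type v) [∀ p, MeasurableSpace (Ω p)]
    (P : (p : ℕ) → Measure (Ω p)) [∀ p, IsProbabilityMeasure (P p)]
    (T : (p : ℕ) → Ω p → ℝ) (J : (p : ℕ) → Fin p → Ω p → ℝ) (X : (p : ℕ) → Fin p → Ω p → 𝓧)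
    (hT : ∀ p, HasLaw (T p) (gammaMeasure α η) (P p))
    (hJ : ∀ p i, HasSymmetricGammaLaw (J p i) 1 1 (P p))
    (hX : ∀ p, IsPolyaUrn (X p) α F (P p))
    (hJ_indep : ∀ p, iIndepFun (J p) (P p))
    (hTJ_indep : ∀ p, IndepFun (T p) (fun ω i => J p i ω) (P p))
    (hTJX_indep : ∀ p,
      IndepFun (fun ω => (T p ω, fun i => J p i ω)) (fun ω i => X p i ω) (P p)) :
    (∃ (Ω' : Type u) (_ : MeasurableSpace Ω') (P' : Measure Ω') (Q : Ω' → SignedMeasure 𝓧),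
      IsProbabilityMeasure P' ∧ IsSymmetricGammaRandomMeasure Q α F (Real.sqrt η) P') ∧
    ∀ (Ω' : Type w) [MeasurableSpace Ω'] (P' : Measure Ω') [IsProbabilityMeasure P']
      (Q : Ω' → SignedMeasure 𝓧), IsSymmetricGammaRandomMeasure Q α F (Real.sqrt η) P' →
      TendstoInDistribution (fun p => particleMeasure p (T p) (J p) (X p)) atTop Q P P' := by
  -- The given jumps also feed the stick-breaking construction, so no symmetric Gamma law has to be
  -- constructed from scratch.
  have hκ : ∀ t, charFun ((P 1).map (J 1 0)) t = (((1 + t ^ 2)⁻¹ : ℝ) : ℂ) := fun t => by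
    rw [(hJ 1 0).charFun_eq, Real.rpow_neg_one]
    simp
  have hprob : IsProbabilityMeasure ((P 1).map (J 1 0)) :=
    Measure.isProbabilityMeasure_map (hJ 1 0).aemeasurable
  have hκ1 : Integrable id ((P 1).map (J 1 0)) :=
    (integrable_map_measure aestronglyMeasurable_id (hJ 1 0).aemeasurable).2
      ((hJ 1 0).memLp_two.integrable (by norm_num))
  exact ⟨⟨ℕ → unitInterval × ℝ × 𝓧, inferInstance,
    Measure.infinitePi fun _ => stickLaw ((P 1).map (J 1 0)) F, _, inferInstance,
    isSymmetricGammaRandomMeasure_stickMeasure hκ hκ1 hα (√η)⟩,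
    fun Ω' _ P' _ Q hQ => tendstoInDistribution_particleMeasure hα hη hT hJ hX hJ_indep
      hTJ_indep hTJX_indep hQ⟩
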